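/- **Lemma 3.2 (weighted Poincaré inequalities).** Let $d\in\{2,3\}$, $\alpha\in(-1,1)$, let $\Omega\subset\mathbb{R}^d$ be a bounded Lipschitz domain (in particular connected) and $\Gamma:=\partial\Omega$. Put $\rho(x,y):=(1+|x|^2+|y|^2)^{1/2}$ for $(x,y)\in\mathbb{R}^d\times\mathbb{R}$. For $\mathcal{Y}\in(0,\infty]$ let $H^1_\rho(y^\alpha,(\mathbb{R}^d\setminus\Gamma)\times(0,\mathcal{Y}))$ be the space of real functions $\mathcal{U}$ on $(\mathbb{R}^d\setminus\Gamma)\times(0,\mathcal{Y})$ with a weak gradient $\nabla\mathcal{U}=(\nabla_x\mathcal{U},\partial_y\mathcal{U})$ such that $$\int_0^{\mathcal{Y}}\int_{\mathbb{R}^d\setminus\Gamma}y^\alpha\big(|\nabla\mathcal{U}|^2+\rho^{-2}|\mathcal{U}|^2\big)\,dx\,dy<\infty .$$ Write $[\![\mathcal{U}]\!]:=\gamma^-_\Gamma\,\mathcal{U}(\cdot,y)-\gamma^+_\Gamma\,\mathcal{U}(\cdot,y)$ for the jump across $\Gamma$, where $\gamma_\Gamma^-$ and $\gamma_\Gamma^+$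 are the traces on $\Gamma$ from $\Omega$ and from $\mathbb{R}^d\setminus\overline\Omega$, and $\mathrm{tr}_0\,\mathcal{U}$ for the trace of $\mathcal{U}$ at $y=0$. There is $\mu_0>0$ depending only on $d$ and $\alpha$, and a constant $C\ge 0$ depending only on $d$, $\alpha$ and $\Omega$, such that the following holds for every $\mathcal{Y}\in(0,\infty]$ and every $\mathcal{U}\in H^1_\rho(y^\alpha,(\mathbb{R}^d\setminus\Gamma)\times(0,\mathcal{Y}))$ with $\int_\Gamma[\![\mathcal{U}]\!]\,ds_x=0$ for almost every $y\in(0,\mathcal{Y})$. 1. If $\mathcal{Y}=\infty$, $0\le\mu\le2$ and $\mathbb{R}^d\setminus\overline\Omega$ is connected, then $$\int_0^\infty\int_{\mathbb{R}^d}y^\alpha\rho^{\mu-2}|\mathcal{U}|^2\,dx\,dy\le C\int_0^\infty\int_{\mathbb{R}^d\setminus\Gamma}y^\alpha\rho^\mu|\nabla\mathcal{U}|^2\,dx\,dy,$$ provided the right-hand side is finite. 2. If $\mathcal{Y}<\infty$, $0\le\mu<\mu_0$ and, in the case $d=3$, $\mathbb{R}^d\setminus\overline\Omega$ is connected, then $$\int_0^{\mathcal{Y}}\int_{\mathbb{R}^d}y^\alpha\rho^{\mu-2}|\mathcal{U}|^2\,dx\,dy\le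 C\left(\int_0^{\mathcal{Y}}\int_{\mathbb{R}^d\setminus\Gamma}y^\alpha\rho^\mu|\nabla\mathcal{U}|^2\,dx\,dy+|3-d|\,\|\mathrm{tr}_0\,\mathcal{U}\|_{L^2(\mathbb{R}^d)}^2\right),$$ provided the right-hand side is finite. -/

import Mathlib

open MeasureTheory Set Filter Topology
open scoped ENNReal NNReal ContDiff InnerProductSpace

noncomputable section

namespace FracPoincare

/-- `ℝ^d` with its Euclidean norm. -/
abbrev E (d : ℕ) : Type := EuclideanSpace ℝ (Fin d)

/-- Surface measure on hypersurfaces of `ℝ^d`: the `(d-1)`-dimensional Hausdorff measure,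
normalized to agree with Lebesgue measure on `ℝ^(d-1)`. -/
def surf (d : ℕ) : Measure (E d) := μHE[d - 1]

/-- A bounded Lipschitz domain: nonempty, connected, open, bounded, and near each boundary
point `x₀` it is, for a suitable unit vector `n`, the set lying strictly above the graph of a
Lipschitz function of the component `x - ⟪n, x⟫ n` of `x` orthogonal to `n`. -/
structure IsBoundedLipschitzDomain {d : ℕ} (Ω : Set (E d)) : Prop where
  isOpen : IsOpen Ω
  isConnected : IsConnected Ω
  isBounded : Bornology.IsBounded Ω
  lipschitz_boundary : ∀ x₀ ∈ frontier Ω, ∃ n : E d, ‖n‖ = 1 ∧ ∃ r : ℝ, 0 < r ∧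
    ∃ (K : ℝ≥0) (γ : E d → ℝ), LipschitzWith K γ ∧
      ∀ x ∈ Metric.ball x₀ r, x ∈ Ω ↔ γ (x - ⟪n, x⟫_ℝ • n) < ⟪n, x⟫_ℝ

/-- `G` is the weak (distributional) derivative of `u` on the open set `D`. -/
def HasWeakDeriv {F : Type*} [NormedAddCommGroup F] [NormedSpace ℝ F] [MeasureSpace F]
    (D : Set F) (u : F → ℝ) (G : F → F →L[ℝ] ℝ) : Prop :=
  LocallyIntegrableOn u D ∧ LocallyIntegrableOn G D ∧
    ∀ φ : F → ℝ, ContDiff ℝ ∞ φ → HasCompactSupport φ → tsupport φ ⊆ D →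
      ∀ v : F, ∫ z in D, u z * fderiv ℝ φ z v = -∫ z in D, G z v * φ z

/-- The open interval `(0, 𝒴)`, for `𝒴` possibly infinite. -/
def yInterval (Y : EReal) : Set ℝ := {y | 0 < y ∧ (y : EReal) < Y}

/-- The domain `(ℝ^d ∖ Γ) × (0, 𝒴)`, where `Γ = ∂Ω`. -/
def cutCylinder {d : ℕ} (Ω : Set (E d)) (Y : EReal) : Set (E d × ℝ) :=
  (frontier Ω)ᶜ ×ˢ yInterval Y

/-- The weight `ρ(x, y) = (1 + |x|² + |y|²)^{1/2}`. -/
def rho {d : ℕ} (z : E d × ℝ) : ℝ := √(1 + ‖z.1‖ ^ 2 + z.2 ^ 2)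

/-- `|∇U|² = |∇_x U|² + |∂_y U|²` in terms of the derivative `L` of `U`. (The operator norm of
`L` itself would be dual to the maximum norm on the product, hence the two components.) -/
def gradSq {d : ℕ} (L : E d × ℝ →L[ℝ] ℝ) : ℝ :=
  ‖L.comp (ContinuousLinearMap.inl ℝ (E d) ℝ)‖ ^ 2 + L (0, 1) ^ 2

/-- `U` belongs to `H¹_ρ(y^α, D)`, and `G` is its weak derivative. -/
def MemH1rho {d : ℕ} (α : ℝ) (D : Set (E d × ℝ)) (U : E d × ℝ → ℝ)
    (G : E d × ℝ → E d × ℝ →L[ℝ] ℝ) : Prop :=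
  HasWeakDeriv D U G ∧
    ∫⁻ z in D, ENNReal.ofReal (z.2 ^ α * (gradSq (G z) + rho z ^ (-2 : ℝ) * U z ^ 2)) < ⊤

/-- `g ∈ L²(∂D)` is the trace on `∂D` of `u`, where `u` is an `H¹` function on `D ∩ B_R(0)` for
every `R`. The trace operator is the continuous extension of the restriction `φ ↦ φ|_{∂D}` of
smooth functions: `u` is the limit in `H¹(D ∩ B_R(0))`, for every `R`, of smooth functions
whose restrictions to `∂D` converge to `g` in `L²(∂D)`. -/
def HasTrace {d : ℕ} (D : Set (E d)) (u g : E d → ℝ) : Prop :=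
  MemLp g 2 ((surf d).restrict (frontier D)) ∧
    ∃ G : E d → E d →L[ℝ] ℝ, HasWeakDeriv D u G ∧
    ∃ φ : ℕ → E d → ℝ, (∀ n, ContDiff ℝ ∞ (φ n)) ∧
      (∀ R : ℝ, Tendsto (fun n => ∫⁻ x in D ∩ Metric.ball 0 R,
        ENNReal.ofReal ((φ n x - u x) ^ 2 + ‖fderiv ℝ (φ n) x - G x‖ ^ 2)) atTop (𝓝 0)) ∧
      Tendsto (fun n => ∫⁻ x in frontier D, ENNReal.ofReal ((φ n x - g x) ^ 2) ∂(surf d))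
        atTop (𝓝 0)

/-- The jump `⟦u⟧ = γ⁻ u - γ⁺ u` across `Γ = ∂Ω` has vanishing integral over `Γ`, where `γ⁻` is
the trace from `Ω` and `γ⁺` the trace from the exterior `ℝ^d ∖ closure Ω`. (For a Lipschitz
domain the exterior has the same boundary `Γ`.) -/
def JumpMeanZero {d : ℕ} (Ω : Set (E d)) (u : E d → ℝ) : Prop :=
  ∃ gi ge : E d → ℝ, HasTrace Ω u gi ∧ HasTrace (closure Ω)ᶜ u ge ∧
    ∫ x in frontier Ω, (gi x - ge x) ∂(surf d) = 0

/-- `g = tr₀ U` is the trace at `y = 0` of a function `U` on `(ℝ^d ∖ Γ) × (0, 𝒴)` with weak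
derivative `G`. Again the trace operator is the continuous extension of the restriction
`Φ ↦ Φ(·, 0)` of smooth functions, for convergence in `H¹(y^α, K × (0, Y'))` and in `L²(K)`
respectively, for all compact `K ⊆ ℝ^d ∖ Γ` and all finite `0 < Y' < 𝒴`. Since `Γ` is a null
set, this determines `g` almost everywhere on `ℝ^d`. -/
def HasTraceZero {d : ℕ} (α : ℝ) (Ω : Set (E d)) (Y : EReal) (U : E d × ℝ → ℝ)
    (G : E d × ℝ → E d × ℝ →L[ℝ] ℝ) (g : E d → ℝ) : Prop :=
  AEStronglyMeasurable g ∧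
    ∃ Φ : ℕ → E d × ℝ → ℝ, (∀ n, ContDiff ℝ ∞ (Φ n)) ∧
      ∀ K : Set (E d), IsCompact K → K ⊆ (frontier Ω)ᶜ →
        (∀ Y' : ℝ, 0 < Y' → (Y' : EReal) < Y →
          Tendsto (fun n => ∫⁻ z in K ×ˢ Ioo 0 Y', ENNReal.ofReal
            (z.2 ^ α * (gradSq (fderiv ℝ (Φ n) z - G z) + (Φ n z - U z) ^ 2)))
            atTop (𝓝 0)) ∧
        Tendsto (fun n => ∫⁻ x in K, ENNReal.ofReal ((Φ n (x, 0) - g x) ^ 2)) atTop (𝓝 0)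

/-- `∫_0^𝒴 ∫_{ℝ^d} y^α ρ^{μ-2} |U|² dx dy`, as an element of `[0, ∞]`. -/
def weightedL2 {d : ℕ} (α μ : ℝ) (Y : EReal) (U : E d × ℝ → ℝ) : ℝ≥0∞ :=
  ∫⁻ z in univ ×ˢ yInterval Y, ENNReal.ofReal (z.2 ^ α * rho z ^ (μ - 2) * U z ^ 2)

/-- `∫_0^𝒴 ∫_{ℝ^d ∖ Γ} y^α ρ^μ |∇U|² dx dy`, as an element of `[0, ∞]`, where `G` is the weak
derivative of `U`. -/
def weightedEnergy {d : ℕ} (α μ : ℝ) (Ω : Set (E d)) (Y : EReal)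
    (G : E d × ℝ → E d × ℝ →L[ℝ] ℝ) : ℝ≥0∞ :=
  ∫⁻ z in cutCylinder Ω Y, ENNReal.ofReal (z.2 ^ α * rho z ^ μ * gradSq (G z))

end FracPoincare

end

noncomputable section

namespace FracPoincare

/-! ### Elementary L² inequalities; Poincaré on convex sets and propagation of L² bounds by
translation. -/

section

variable {d : ℕ}

/-! Two mechanisms are used: a radial multiplier argument for the half space and for the truncated
cylinder in dimension 3, and a vertical Hardy inequality for the truncated cylinder in dimension 2.

Multiplier argument. Write τ = ρ² and let ψ be a cutoff in x, nondecreasing in |x|, that vanishes on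
a ball containing the closure of Ω. Integrating the divergence of y^α ψ κ(τ) U² x over a horizontal
slice gives d κ + 2|x|²κ' times U², plus a cross term with U x·∇U. The remaining term contains the
derivative of ψ and has a favourable sign, so no remainder on a bounded set appears. If the
y-interval is the half line, the vertical field y ∂_y may be added: its boundary term at 0 also has
a good sign and the one at infinity vanishes. As long as t κ(t) is nondecreasing, the total
coefficient of U² is at least c κ, with c = d - 2 for the horizontal field alone and c = d - 1 + α
for both. Hence c = 1 works for d = 3, for any 𝒴, and c = 1 + α for d = 2 and 𝒴 = ∞. Taking κ(t) =
t^(μ/2 - 1) gives a weighted Hardy inequality outside a ball (`MemH1rho.exterior_hardy`). This κ is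
first truncated to be admissible; the loss of monotonicity caused by the truncation is measured by
`multiplierDefect` and tends to zero because U lies in H¹_ρ.

Near Ω the estimate is made on each slice (`exists_slice_estimate`). A connected exterior lets the
L² norm on a distant ball and the Dirichlet integral control both the L² norm near Γ and the
exterior trace. A zero mean jump transfers the mean of that trace to the interior trace, and a
Poincaré inequality on Ω normalized by the boundary mean then controls the function in Ω. For
bounded x the weight ρ^(μ-2) is comparable to a function of y alone, so the slice estimates can be
integrated and joined with the exterior inequality (`exists_weightedL2_le`).

Vertical argument. For d = 2 and 𝒴 finite the horizontal constant d - 2 is zero, and the trace at y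
= 0 is used instead. On each vertical line the Hardy inequality with weight y^(α-2) controls f -
f(0), while y^α ρ^(μ-2) has a uniformly bounded integral in y for μ ≤ (1 - α)/2, which takes care of
f(0). Smooth approximation on compact pieces gives the claim (`exists_weightedL2_le_of_trace`). -/

theorem ofReal_sq_eq_enorm_sq {F : Type*} [NormedAddCommGroup F] (a : F) :
    ENNReal.ofReal (‖a‖ ^ 2) = ‖a‖ₑ ^ 2 := by
  rw [← ofReal_norm, ENNReal.ofReal_pow (norm_nonneg _)]

theorem ofReal_sq_eq_enorm_sq' (a : ℝ) : ENNReal.ofReal (a ^ 2) = ‖a‖ₑ ^ 2 := by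
  rw [← ofReal_sq_eq_enorm_sq, Real.norm_eq_abs, sq_abs]

theorem enorm_add_sq_le {F : Type*} [NormedAddCommGroup F] (a b : F) :
    ‖a + b‖ₑ ^ 2 ≤ 2 * ‖a‖ₑ ^ 2 + 2 * ‖b‖ₑ ^ 2 := by
  rw [← ofReal_sq_eq_enorm_sq, ← ofReal_sq_eq_enorm_sq, ← ofReal_sq_eq_enorm_sq,
    ← ENNReal.ofReal_ofNat 2, ← ENNReal.ofReal_mul (by positivity),
    ← ENNReal.ofReal_mul (by positivity), ← ENNReal.ofReal_add (by positivity) (by positivity)]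
  refine ENNReal.ofReal_le_ofReal ?_
  nlinarith [norm_add_le a b, sq_nonneg (‖a‖ - ‖b‖), norm_nonneg (a + b), norm_nonneg a,
    norm_nonneg b]

theorem enorm_sub_sq_le {F : Type*} [NormedAddCommGroup F] (a b : F) :
    ‖a - b‖ₑ ^ 2 ≤ 2 * ‖a‖ₑ ^ 2 + 2 * ‖b‖ₑ ^ 2 := by
  simpa [sub_eq_add_neg] using enorm_add_sq_le a (-b)

theorem enorm_sq_le_two_sub {F : Type*} [NormedAddCommGroup F] (a b : F) :
    ‖a‖ₑ ^ 2 ≤ 2 * ‖b‖ₑ ^ 2 + 2 * ‖b - a‖ₑ ^ 2 := by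
  simpa using enorm_sub_sq_le b (b - a)

/-- Cauchy-Schwarz against the constant function. -/
theorem lintegral_sq_le {X : Type*} [MeasurableSpace X] (μ : Measure X) {f : X → ℝ≥0∞}
    (hf : AEMeasurable f μ) : (∫⁻ x, f x ∂μ) ^ 2 ≤ μ univ * ∫⁻ x, f x ^ 2 ∂μ := by
  have h := ENNReal.lintegral_mul_le_Lp_mul_Lq μ Real.HolderConjugate.two_two
    (aemeasurable_const (b := (1 : ℝ≥0∞))) hf
  simp only [Pi.mul_apply, one_mul, ENNReal.one_rpow, lintegral_const] at h
  calc (∫⁻ x, f x ∂μ) ^ 2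
      ≤ (μ univ ^ (1 / 2 : ℝ) * (∫⁻ x, f x ^ (2 : ℝ) ∂μ) ^ (1 / 2 : ℝ)) ^ 2 := by gcongr
    _ = μ univ * ∫⁻ x, f x ^ 2 ∂μ := by
      rw [mul_pow, ← ENNReal.rpow_natCast, ← ENNReal.rpow_natCast, ← ENNReal.rpow_mul,
        ← ENNReal.rpow_mul]
      norm_num

section Translation

variable {φ : E d → ℝ}

theorem continuous_segment_fderiv (hφ : ContDiff ℝ 1 φ) (v : E d) :
    Continuous fun p : E d × ℝ => fderiv ℝ φ (p.1 + p.2 • v) :=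
  (hφ.continuous_fderiv one_ne_zero).comp (by fun_prop)

/-- The fundamental theorem of calculus along the segment, followed by Cauchy-Schwarz in the
parameter. -/
theorem enorm_sub_sq_le_lintegral (hφ : ContDiff ℝ 1 φ) (x v : E d) {a : ℝ} (ha : 0 ≤ a) :
    ‖φ (x + a • v) - φ x‖ₑ ^ 2 ≤
      ‖v‖ₑ ^ 2 * (ENNReal.ofReal a * ∫⁻ s in Icc (0 : ℝ) a, ‖fderiv ℝ φ (x + s • v)‖ₑ ^ 2) := by
  have hc : Continuous fun s : ℝ => fderiv ℝ φ (x + s • v) :=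
    (hφ.continuous_fderiv one_ne_zero).comp (by fun_prop)
  have hder : ∀ s : ℝ, HasDerivAt (fun s : ℝ => φ (x + s • v)) (fderiv ℝ φ (x + s • v) v) s := by
    intro s
    have h1 : HasDerivAt (fun s : ℝ => x + s • v) v s := by
      simpa using ((hasDerivAt_id s).smul_const v).const_add x
    exact ((hφ.differentiable one_ne_zero _).hasFDerivAt).comp_hasDerivAt s h1
  have h0 : ∫ s in (0 : ℝ)..a, fderiv ℝ φ (x + s • v) v = φ (x + a • v) - φ x := by
    rw [intervalIntegral.integral_eq_sub_of_hasDerivAt (fun s _ => hder s)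
      ((hc.clm_apply continuous_const).intervalIntegrable _ _)]
    simp
  rw [← h0, intervalIntegral.integral_of_le ha, ← integral_Icc_eq_integral_Ioc]
  calc _ ≤ (∫⁻ s in Icc (0 : ℝ) a, ‖fderiv ℝ φ (x + s • v) v‖ₑ) ^ 2 := by
        gcongr; exact enorm_integral_le_lintegral_enorm _
    _ ≤ (∫⁻ s in Icc (0 : ℝ) a, ‖fderiv ℝ φ (x + s • v)‖ₑ * ‖v‖ₑ) ^ 2 := by
        gcongr with s
        exact ContinuousLinearMap.le_opENorm _ _
    _ = ‖v‖ₑ ^ 2 * (∫⁻ s in Icc (0 : ℝ) a, ‖fderiv ℝ φ (x + s • v)‖ₑ) ^ 2 := by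
        rw [lintegral_mul_const' _ _ (by simp)]; ring
    _ ≤ _ := by
        gcongr
        refine (lintegral_sq_le _ hc.enorm.aemeasurable).trans ?_
        simp

/-- After exchanging the integrals, translation invariance moves `A` by `s • v` into `L` for each
fixed `s`, so every parameter contributes at most the same Dirichlet integral. -/
theorem lintegral_translate_sub_sq_le (hφ : ContDiff ℝ 1 φ) {A L : Set (E d)}
    (hA : MeasurableSet A) (hL : MeasurableSet L) (v : E d)
    (hAL : ∀ x ∈ A, ∀ s ∈ Icc (0 : ℝ) 1, x + s • v ∈ L) :
    ∫⁻ x in A, ‖φ (x + v) - φ x‖ₑ ^ 2 ≤ ‖v‖ₑ ^ 2 * ∫⁻ x in L, ‖fderiv ℝ φ x‖ₑ ^ 2 := by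
  calc _ ≤ ∫⁻ x in A, ‖v‖ₑ ^ 2 * ∫⁻ s in Icc (0 : ℝ) 1, ‖fderiv ℝ φ (x + s • v)‖ₑ ^ 2 :=
        lintegral_mono fun x => by
          simpa using enorm_sub_sq_le_lintegral hφ x v zero_le_one
    _ = ‖v‖ₑ ^ 2 * ∫⁻ s in Icc (0 : ℝ) 1, ∫⁻ x in A, ‖fderiv ℝ φ (x + s • v)‖ₑ ^ 2 := by
        rw [lintegral_const_mul' _ _ (by simp), lintegral_lintegral_swap]
        exact ((continuous_segment_fderiv hφ v).enorm.measurable.pow_const 2).aemeasurable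
    _ ≤ ‖v‖ₑ ^ 2 * ∫⁻ s in Icc (0 : ℝ) 1, ∫⁻ x in L, ‖fderiv ℝ φ x‖ₑ ^ 2 := by
        gcongr 1
        refine setLIntegral_mono' measurableSet_Icc fun s hs => ?_
        rw [← lintegral_indicator hA, ← lintegral_indicator hL,
          ← lintegral_add_right_eq_self (L.indicator _) (s • v)]
        refine lintegral_mono fun x => ?_
        by_cases hx : x ∈ A
        · simp [hx, hAL x hx s hs]
        · simp [hx]
    _ = _ := by simp

theorem setLIntegral_comp_add_le {A B : Set (E d)} (hA : MeasurableSet A) (hB : MeasurableSet B)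
    (v : E d) (hAB : ∀ x ∈ A, x + v ∈ B) (f : E d → ℝ≥0∞) :
    ∫⁻ x in A, f (x + v) ≤ ∫⁻ x in B, f x := by
  rw [← lintegral_indicator hA, ← lintegral_indicator hB,
    ← lintegral_add_right_eq_self (B.indicator _) v]
  refine lintegral_mono fun x => ?_
  by_cases hx : x ∈ A
  · simp [hx, hAB x hx]
  · simp [hx]

/-- The basic transport step: mass on `A` is compared with mass on the translate, at the price of
the gradient on the region swept out. -/
theorem lintegral_sq_le_translate (hφ : ContDiff ℝ 1 φ) {A B L : Set (E d)}
    (hA : MeasurableSet A) (hB : MeasurableSet B) (hL : MeasurableSet L) (v : E d)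
    (hAB : ∀ x ∈ A, x + v ∈ B) (hAL : ∀ x ∈ A, ∀ s ∈ Icc (0 : ℝ) 1, x + s • v ∈ L) :
    ∫⁻ x in A, ‖φ x‖ₑ ^ 2 ≤
      2 * (∫⁻ x in B, ‖φ x‖ₑ ^ 2) + 2 * ‖v‖ₑ ^ 2 * ∫⁻ x in L, ‖fderiv ℝ φ x‖ₑ ^ 2 := by
  have hφc := hφ.continuous
  calc _ ≤ ∫⁻ x in A, (2 * ‖φ (x + v)‖ₑ ^ 2 + 2 * ‖φ (x + v) - φ x‖ₑ ^ 2) :=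
        lintegral_mono fun x => enorm_sq_le_two_sub _ _
    _ = 2 * (∫⁻ x in A, ‖φ (x + v)‖ₑ ^ 2) + 2 * ∫⁻ x in A, ‖φ (x + v) - φ x‖ₑ ^ 2 := by
        rw [lintegral_add_left (Measurable.const_mul (Continuous.measurable (by fun_prop)) 2),
          lintegral_const_mul' _ _ (by simp),
          lintegral_const_mul' _ _ (by simp)]
    _ ≤ _ := by
        rw [mul_assoc]
        exact add_le_add
          (mul_le_mul_right (setLIntegral_comp_add_le hA hB v hAB fun x => ‖φ x‖ₑ ^ 2) 2)
          (mul_le_mul_right (lintegral_translate_sub_sq_le hφ hA hL v hAL) 2)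

end Translation

/-- Poincaré inequality on bounded convex open sets. -/
theorem exists_poincare_of_convex {B : Set (E d)} (hB : Convex ℝ B) (hBo : IsOpen B)
    (hBb : Bornology.IsBounded B) (hBn : B.Nonempty) :
    ∃ C : ℝ≥0, ∀ φ : E d → ℝ, ContDiff ℝ 1 φ →
      ∃ c : ℝ, ∫⁻ x in B, ‖φ x - c‖ₑ ^ 2 ≤ C * ∫⁻ x in B, ‖fderiv ℝ φ x‖ₑ ^ 2 := by
  have hvol : volume B ≠ 0 := (hBo.measure_pos volume hBn).ne'
  have hvol' : volume B ≠ ⊤ := hBb.measure_lt_top.ne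
  obtain ⟨r, hr⟩ := hBb.subset_ball 0
  -- Twice the radius, so that `V` contains all differences of points of `B`.
  set V : Set (E d) := Metric.ball 0 (2 * r)
  have hV : volume V ≠ ⊤ := measure_ball_lt_top.ne
  set C : ℝ≥0∞ := ENNReal.ofReal (2 * r) ^ 2 * volume V * (volume B)⁻¹
  have hC : C ≠ ⊤ := ENNReal.mul_ne_top
    (ENNReal.mul_ne_top (ENNReal.pow_ne_top ENNReal.ofReal_ne_top) hV) (by simp [hvol])
  refine ⟨C.toNNReal, fun φ hφ => ?_⟩
  have hφc := hφ.continuous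
  set I := ∫⁻ x in B, ‖fderiv ℝ φ x‖ₑ ^ 2
  have hmeas : Measurable fun p : E d × E d => ‖φ p.2 - φ p.1‖ₑ ^ 2 :=
    Continuous.measurable (by fun_prop)
  have key : ∫⁻ y in B, ∫⁻ x in B, ‖φ x - φ y‖ₑ ^ 2 ≤
      ENNReal.ofReal (2 * r) ^ 2 * volume V * I := by
    have hmeas2 : Measurable fun p : E d × E d =>
        (B ×ˢ univ ∩ (fun p : E d × E d => p.1 + p.2) ⁻¹' B).indicator
          (fun p => ‖φ (p.1 + p.2) - φ p.1‖ₑ ^ 2) p := by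
      refine Measurable.indicator (Continuous.measurable (by fun_prop)) ?_
      exact (hBo.measurableSet.prod .univ).inter
        ((by fun_prop : Measurable fun p : E d × E d => p.1 + p.2) hBo.measurableSet)
    -- Substitute x = y + v and exchange the integrals: for fixed `v`, convexity keeps the whole
    -- segment from y to y + v inside `B`, so the translation estimate applies.
    calc ∫⁻ y in B, ∫⁻ x in B, ‖φ x - φ y‖ₑ ^ 2
        = ∫⁻ y, ∫⁻ v, (B ×ˢ univ ∩ (fun p : E d × E d => p.1 + p.2) ⁻¹' B).indicator
          (fun p => ‖φ (p.1 + p.2) - φ p.1‖ₑ ^ 2) (y, v) := by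
          rw [← lintegral_indicator hBo.measurableSet]
          refine lintegral_congr fun y => ?_
          by_cases hy : y ∈ B
          · rw [indicator_of_mem hy, ← lintegral_indicator hBo.measurableSet,
              ← lintegral_add_left_eq_self _ y]
            refine lintegral_congr fun v => ?_
            by_cases hv : y + v ∈ B
            · simp [hv, hy, indicator]
            · simp [hv, indicator]
          · simp [hy, indicator]
      _ = ∫⁻ v, ∫⁻ y, (B ×ˢ univ ∩ (fun p : E d × E d => p.1 + p.2) ⁻¹' B).indicator
          (fun p => ‖φ (p.1 + p.2) - φ p.1‖ₑ ^ 2) (y, v) :=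
          lintegral_lintegral_swap hmeas2.aemeasurable
      _ ≤ ∫⁻ v, V.indicator (fun _ => ENNReal.ofReal (2 * r) ^ 2 * I) v := by
          refine lintegral_mono fun v => ?_
          by_cases hv : v ∈ V
          · rw [indicator_of_mem hv]
            have hAm : MeasurableSet (B ∩ (fun y => y + v) ⁻¹' B) :=
              hBo.measurableSet.inter ((by fun_prop : Measurable fun y : E d => y + v)
                hBo.measurableSet)
            have h1 := lintegral_translate_sub_sq_le hφ hAm hBo.measurableSet v (by
              rintro x ⟨hx, hxv⟩ s hs
              have := hB hx hxv (sub_nonneg.2 hs.2) hs.1 (by ring)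
              convert this using 1
              module)
            rw [← lintegral_indicator hAm] at h1
            calc _ = ∫⁻ y, (B ∩ (fun y => y + v) ⁻¹' B).indicator
                  (fun x => ‖φ (x + v) - φ x‖ₑ ^ 2) y := by
                  refine lintegral_congr fun y => ?_
                  by_cases hy : y ∈ B ∩ (fun y => y + v) ⁻¹' B
                  · rw [indicator_of_mem hy, indicator_of_mem]
                    exact ⟨⟨hy.1, trivial⟩, hy.2⟩
                  · rw [indicator_of_notMem hy, indicator_of_notMem]
                    exact fun h => hy ⟨h.1.1, h.2⟩
              _ ≤ _ := h1
              _ ≤ _ := by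
                  gcongr
                  rw [← ofReal_norm]
                  exact ENNReal.ofReal_le_ofReal (by simpa [V] using (mem_ball_zero_iff.1 hv).le)
          · rw [indicator_of_notMem hv, nonpos_iff_eq_zero]
            refine lintegral_eq_zero_of_ae_eq_zero (ae_of_all _ fun y => ?_)
            refine indicator_of_notMem ?_ _
            rintro ⟨⟨hy, -⟩, hyv⟩
            apply hv
            have h1 := mem_ball_zero_iff.1 (hr hy)
            have h2 := mem_ball_zero_iff.1 (hr hyv)
            have h3 : ‖v‖ ≤ ‖y + v‖ + ‖y‖ := by simpa using norm_sub_le (y + v) y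
            simp only [V, mem_ball_zero_iff]
            simp only at h2
            linarith
      _ = _ := by
          rw [lintegral_indicator Metric.isOpen_ball.measurableSet, setLIntegral_const]; ring
  -- Some `y` does no worse than the average, so the value `φ y` can serve as the constant.
  obtain ⟨y, hyB, hy⟩ := exists_le_setLAverage (μ := volume) (s := B)
    (f := fun y => ∫⁻ x in B, ‖φ x - φ y‖ₑ ^ 2) hvol hvol'
    (Measurable.lintegral_prod_right' hmeas).aemeasurable
  refine ⟨φ y, hy.trans ?_⟩
  rw [setLAverage_eq, ENNReal.div_eq_inv_mul, ENNReal.coe_toNNReal hC]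
  calc _ ≤ (volume B)⁻¹ * (ENNReal.ofReal (2 * r) ^ 2 * volume V * I) := by gcongr
    _ = _ := by simp only [C]; ring

/-- On `A`, the `L²` norm of `C¹` functions is controlled by their `L²` norm on `B` and by their
Dirichlet integral over a bounded part of `D`. -/
def Controls (D A B : Set (E d)) : Prop :=
  ∃ C : ℝ≥0, ∃ R : ℝ, ∀ φ : E d → ℝ, ContDiff ℝ 1 φ → ∫⁻ x in A, ‖φ x‖ₑ ^ 2 ≤
    C * ((∫⁻ x in B, ‖φ x‖ₑ ^ 2) + ∫⁻ x in D ∩ Metric.ball 0 R, ‖fderiv ℝ φ x‖ₑ ^ 2)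

namespace Controls

variable {D A A' B B' : Set (E d)}

theorem of_subset (h : A ⊆ B) : Controls D A B :=
  ⟨1, 0, fun φ _ => by
    rw [ENNReal.coe_one, one_mul]
    exact (lintegral_mono_set h).trans le_self_add⟩

theorem mono (h : Controls D A B) (hA : A' ⊆ A) (hB : B ⊆ B') : Controls D A' B' := by
  obtain ⟨C, R, h⟩ := h
  refine ⟨C, R, fun φ hφ => (lintegral_mono_set hA).trans ((h φ hφ).trans ?_)⟩
  gcongr

theorem union (h : Controls D A B) (h' : Controls D A' B) : Controls D (A ∪ A') B := by
  obtain ⟨C, R, h⟩ := h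
  obtain ⟨C', R', h'⟩ := h'
  refine ⟨C + C', max R R', fun φ hφ => (lintegral_union_le _ _ _).trans ?_⟩
  rw [ENNReal.coe_add, add_mul]
  refine add_le_add ((h φ hφ).trans ?_) ((h' φ hφ).trans ?_)
  all_goals gcongr; simp

theorem trans {A₁ A₂ A₃ : Set (E d)} (h : Controls D A₁ A₂) (h' : Controls D A₂ A₃) :
    Controls D A₁ A₃ := by
  obtain ⟨C, R, h⟩ := h
  obtain ⟨C', R', h'⟩ := h'
  refine ⟨C * (C' + 1), max R R', fun φ hφ => (h φ hφ).trans ?_⟩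
  rw [ENNReal.coe_mul, mul_assoc]
  gcongr
  rw [ENNReal.coe_add, ENNReal.coe_one, add_mul, one_mul]
  refine add_le_add ((h' φ hφ).trans ?_) (le_add_left ?_)
  · gcongr; simp
  · refine lintegral_mono_set ?_
    gcongr; simp

theorem translate (hA : MeasurableSet A) (hB : MeasurableSet B) (hD : MeasurableSet D)
    (hAb : Bornology.IsBounded A)
    (v : E d) (hAB : ∀ x ∈ A, x + v ∈ B) (hAD : ∀ x ∈ A, ∀ s ∈ Icc (0 : ℝ) 1, x + s • v ∈ D) :
    Controls D A B := by
  obtain ⟨r, hr⟩ := hAb.subset_ball 0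
  -- The radius is enlarged by the length of `v` so that the ball contains every segment swept by
  -- the translation.
  refine ⟨2 + 2 * ‖v‖₊ ^ 2, r + ‖v‖, fun φ hφ => ?_⟩
  refine (lintegral_sq_le_translate hφ hA hB (hD.inter Metric.isOpen_ball.measurableSet) v hAB
    (L := D ∩ Metric.ball 0 (r + ‖v‖)) ?_).trans ?_
  · refine fun x hx s hs => ⟨hAD x hx s hs, ?_⟩
    have h1 := mem_ball_zero_iff.1 (hr hx)
    rw [mem_ball_zero_iff]
    have h2 : ‖s • v‖ ≤ ‖v‖ := by
      rw [norm_smul, Real.norm_of_nonneg hs.1]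
      exact mul_le_of_le_one_left (norm_nonneg _) hs.2
    linarith [norm_add_le x (s • v)]
  · rw [mul_add]
    gcongr
    · push_cast; exact le_self_add
    · push_cast
      rw [enorm_eq_nnnorm]
      exact le_add_self

/-- Covering argument: control is local on compact sets. -/
theorem of_isCompact {K : Set (E d)} (hK : IsCompact K)
    (h : ∀ x ∈ K, ∃ ε > 0, Controls D (A ∩ Metric.ball x ε) B) : Controls D (A ∩ K) B := by
  refine hK.induction_on (p := fun s => Controls D (A ∩ s) B) ?_ ?_ ?_ ?_
  · simpa using of_subset (empty_subset B)
  · exact fun s t hst ht => ht.mono (inter_subset_inter_right _ hst) subset_rfl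
  · intro s t hs ht
    rw [inter_union_distrib_left]
    exact hs.union ht
  · intro x hx
    obtain ⟨ε, hε, h⟩ := h x hx
    exact ⟨_, mem_nhdsWithin_of_mem_nhds (Metric.ball_mem_nhds x hε), h⟩

end Controls

/-- In a connected open set, `L²` norms on small balls are controlled by those on a given ball. -/
theorem controls_ball_of_isPreconnected {D : Set (E d)} (hDo : IsOpen D) (hD : IsPreconnected D)
    {p : E d} {r : ℝ} (hr : 0 < r) (hp : p ∈ D) {x : E d} (hx : x ∈ D) :
    ∃ ε > 0, Controls D (Metric.ball x ε) (Metric.ball p r) := by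
  -- Quantifying over all small radii, with the same radius at both ends, makes the relation
  -- transitive; it is symmetric by construction and holds locally by translation, hence it holds on
  -- the whole preconnected set.
  let P : E d → E d → Prop := fun x y => ∃ δ > 0, ∀ ε, 0 < ε → ε < δ →
    Controls D (Metric.ball x ε) (Metric.ball y ε) ∧
    Controls D (Metric.ball y ε) (Metric.ball x ε)
  have hP : P x p := by
    refine hD.induction₂ P ?_ ?_ ?_ hx hp
    · intro x hx
      obtain ⟨r, hr, hxr⟩ := Metric.isOpen_iff.1 hDo x hx
      refine mem_nhdsWithin_of_mem_nhds ?_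
      filter_upwards [Metric.ball_mem_nhds x (half_pos hr)] with y hy
      refine ⟨r / 2, half_pos hr, fun ε hε hεr => ?_⟩
      have haux : ∀ a b : E d, dist a x < r / 2 → dist b x < r / 2 →
          Controls D (Metric.ball a ε) (Metric.ball b ε) := by
        intro a b ha hb
        refine Controls.translate measurableSet_ball measurableSet_ball hDo.measurableSet
          Metric.isBounded_ball (b - a) ?_ ?_
        · intro z hz
          rw [Metric.mem_ball, dist_eq_norm] at hz ⊢
          convert hz using 2
          abel
        · intro z hz s hs
          apply hxr
          have hab : a + s • (b - a) ∈ Metric.ball x (r / 2) := by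
            have := (convex_ball x (r / 2)) (Metric.mem_ball.2 ha) (Metric.mem_ball.2 hb)
              (sub_nonneg.2 hs.2) hs.1 (by ring)
            convert this using 1
            module
          rw [Metric.mem_ball, dist_eq_norm] at hz hab ⊢
          have : z + s • (b - a) - x = (z - a) + (a + s • (b - a) - x) := by abel
          rw [this]
          linarith [norm_add_le (z - a) (a + s • (b - a) - x)]
      exact ⟨haux x y (by simpa using half_pos hr) hy, haux y x hy (by simpa using half_pos hr)⟩
    · rintro x y z - - - ⟨δ, hδ, h⟩ ⟨δ', hδ', h'⟩
      refine ⟨min δ δ', lt_min hδ hδ', fun ε hε hlt => ?_⟩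
      have h1 := h ε hε (hlt.trans_le (min_le_left _ _))
      have h2 := h' ε hε (hlt.trans_le (min_le_right _ _))
      exact ⟨h1.1.trans h2.1, h2.2.trans h1.2⟩
    · rintro x y - - ⟨δ, hδ, h⟩
      exact ⟨δ, hδ, fun ε hε hlt => (h ε hε hlt).symm⟩
  obtain ⟨δ, hδ, h⟩ := hP
  refine ⟨min (δ / 2) r, lt_min (half_pos hδ) hr, ?_⟩
  exact (h _ (lt_min (half_pos hδ) hr) ((min_le_left _ _).trans_lt (half_lt_self hδ))).1.mono
    subset_rfl (Metric.ball_subset_ball (min_le_right _ _))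

end

/-! ### Surface measure: Lipschitz graphs and projection along a direction. -/

section

variable {d : ℕ}

section Graph

open Measure

variable {n : E d}

theorem finrank_orthogonal_unit (hn : ‖n‖ = 1) : Module.finrank ℝ (ℝ ∙ n)ᗮ = d - 1 := by
  have h := Submodule.finrank_add_finrank_orthogonal (ℝ ∙ n)
  rw [finrank_span_singleton (by rintro rfl; simp at hn), finrank_euclideanSpace_fin] at h
  omega

theorem isAddHaarMeasure_surf_orthogonal (hn : ‖n‖ = 1) :
    (μHE[d - 1] : Measure (ℝ ∙ n)ᗮ).IsAddHaarMeasure := by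
  rw [← finrank_orthogonal_unit hn]
  infer_instance

theorem orthogonalProjectionOnto_add_smul (p : (ℝ ∙ n)ᗮ) (s : ℝ) :
    (ℝ ∙ n)ᗮ.orthogonalProjectionOnto ((p : E d) + s • n) = p := by
  rw [map_add, map_smul, Submodule.orthogonalProjectionOnto_mem_subspace_eq_self,
    Submodule.orthogonalProjectionOnto_orthogonal_apply_eq_zero (Submodule.mem_span_singleton_self n)]
  simp

theorem eq_orthogonalProjectionOnto_add_smul (hn : ‖n‖ = 1) (x : E d) :
    x = ((ℝ ∙ n)ᗮ.orthogonalProjectionOnto x : E d) + ⟪n, x⟫_ℝ • n := by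
  have hm : x - ⟪n, x⟫_ℝ • n ∈ (ℝ ∙ n)ᗮ := by
    rw [Submodule.mem_orthogonal_singleton_iff_inner_right, inner_sub_right, inner_smul_right,
      real_inner_self_eq_norm_sq, hn]
    ring
  have h := orthogonalProjectionOnto_add_smul (⟨_, hm⟩ : (ℝ ∙ n)ᗮ) ⟪n, x⟫_ℝ
  simp only [sub_add_cancel] at h
  rw [h]
  simp

/-- Decomposition of space into a line and its orthogonal complement. -/
def orthogonalLineEquiv (hn : ‖n‖ = 1) : ((ℝ ∙ n)ᗮ × ℝ) ≃L[ℝ] E d :=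
  LinearEquiv.toContinuousLinearEquiv
    { toFun := fun q => (q.1 : E d) + q.2 • n
      invFun := fun x => ((ℝ ∙ n)ᗮ.orthogonalProjectionOnto x, ⟪n, x⟫_ℝ)
      map_add' := fun q q' => by simp [add_smul]; abel
      map_smul' := fun c q => by simp [mul_smul]
      left_inv := fun q => by
        have h1 : ⟪n, (q.1 : E d)⟫_ℝ = 0 :=
          Submodule.mem_orthogonal_singleton_iff_inner_right.1 q.1.2
        ext1
        · exact orthogonalProjectionOnto_add_smul _ _
        · simp [inner_add_right, inner_smul_right, h1, hn]
      right_inv := fun x => (eq_orthogonalProjectionOnto_add_smul hn x).symm }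

/-- Uniqueness of Haar measure: the product measure, carried to the whole space, is invariant, hence
a multiple of Lebesgue measure. The value of the factor is never needed. -/
theorem exists_lintegral_orthogonalLine_eq (hn : ‖n‖ = 1) :
    ∃ c : ℝ≥0, ∀ F : E d → ℝ≥0∞, Measurable F →
      ∫⁻ p : (ℝ ∙ n)ᗮ, (∫⁻ s : ℝ, F ((p : E d) + s • n)) ∂μHE[d - 1] = c * ∫⁻ x, F x := by
  have := isAddHaarMeasure_surf_orthogonal hn
  set ν : Measure (ℝ ∙ n)ᗮ := μHE[d - 1]
  obtain ⟨c, h1⟩ : ∃ c : ℝ≥0, (ν.prod volume).map (orthogonalLineEquiv hn) =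
    c • (volume : Measure (E d)) := ⟨_, isAddLeftInvariant_eq_smul _ _⟩
  refine ⟨c, fun F hF => ?_⟩
  · have hm : Measurable (orthogonalLineEquiv hn) := (orthogonalLineEquiv hn).continuous.measurable
    have h2 : ∫⁻ x, F x ∂((ν.prod volume).map (orthogonalLineEquiv hn)) =
        ∫⁻ p : (ℝ ∙ n)ᗮ, (∫⁻ s : ℝ, F ((p : E d) + s • n)) ∂ν := by
      rw [lintegral_map hF hm, lintegral_prod (fun q => F (orthogonalLineEquiv hn q))
        (hF.comp hm).aemeasurable]
      rfl
    rw [← h2, h1, lintegral_smul_measure, ENNReal.smul_def, smul_eq_mul]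

/-- Surface measure does not increase under the projection along `n`. -/
theorem surf_image_orthogonalProjectionOnto_le (s : Set (E d)) :
    (μHE[d - 1] : Measure (ℝ ∙ n)ᗮ) ((ℝ ∙ n)ᗮ.orthogonalProjectionOnto '' s) ≤ surf d s := by
  simp only [surf, euclideanHausdorffMeasure_def, Measure.smul_apply]
  gcongr
  exact hausdorffMeasure_orthogonalProjectionOnto_le _ _ _ (Nat.cast_nonneg _)

/-- Fubini-type bound: integrating over the segments attached in direction `n` to a Lipschitz
graph is controlled by Lebesgue measure. -/
theorem exists_lintegral_graph_le (hn : ‖n‖ = 1) {h : E d → ℝ} {K : ℝ≥0} (hK : LipschitzWith K h)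
    (hh : ∀ x s, h (x + s • n) = h x + s) :
    ∃ C : ℝ≥0, ∀ F : E d → ℝ≥0∞, Measurable F →
      ∫⁻ x in {x | h x = 0}, (∫⁻ s : ℝ, F (x + s • n)) ∂(surf d) ≤ C * ∫⁻ x, F x := by
  obtain ⟨c, hc⟩ := exists_lintegral_orthogonalLine_eq hn
  set ν : Measure (ℝ ∙ n)ᗮ := μHE[d - 1] with hν
  -- Since `h` grows with unit speed along `n`, this map parametrizes the level set `h = 0` over the
  -- hyperplane. Its Lipschitz constant bounds the surface measure of the graph by the measure of
  -- the base.
  let g : (ℝ ∙ n)ᗮ → E d := fun p => (p : E d) - h p • n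
  have hg : LipschitzWith (1 + K) g := by
    refine (LipschitzWith.subtype_val _).sub ?_
    refine LipschitzWith.of_dist_le_mul fun p q => ?_
    rw [dist_eq_norm, ← sub_smul, norm_smul, hn, mul_one]
    simpa [dist_eq_norm] using hK.dist_le_mul (p : E d) q
  set L : ℝ≥0 := (1 + K) ^ (d - 1)
  have hmeas : (surf d).restrict {x | h x = 0} ≤ (L : ℝ≥0∞) • ν.map g := by
    refine Measure.le_iff.2 fun A hA => ?_
    rw [Measure.restrict_apply hA, Measure.smul_apply, smul_eq_mul,
      Measure.map_apply hg.continuous.measurable hA]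
    have hsub : A ∩ {x | h x = 0} ⊆ g '' (g ⁻¹' A) := by
      rintro x ⟨hxA, hx⟩
      have h1 := eq_orthogonalProjectionOnto_add_smul hn x
      have h2 : g ((ℝ ∙ n)ᗮ.orthogonalProjectionOnto x) = x := by
        have h3 := hh ((ℝ ∙ n)ᗮ.orthogonalProjectionOnto x : E d) ⟪n, x⟫_ℝ
        rw [← h1] at h3
        have hx' : h x = 0 := hx
        simp only [g]
        rw [show h ((ℝ ∙ n)ᗮ.orthogonalProjectionOnto x : E d) = -⟪n, x⟫_ℝ by linarith]
        conv_rhs => rw [h1]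
        simp
      exact ⟨_, by rw [mem_preimage, h2]; exact hxA, h2⟩
    refine (measure_mono hsub).trans ?_
    have h4 := hg.hausdorffMeasure_image_le (d := ((d - 1 : ℕ) : ℝ)) (Nat.cast_nonneg _)
      (g ⁻¹' A)
    simp only [surf, hν, euclideanHausdorffMeasure_def, Measure.smul_apply, ENNReal.smul_def,
      smul_eq_mul]
    rw [mul_left_comm]
    gcongr
    simpa [L] using h4
  refine ⟨L * c, fun F hF => ?_⟩
  have hFm : Measurable fun x => ∫⁻ s : ℝ, F (x + s • n) := by
    refine Measurable.lintegral_prod_right' (f := fun q : E d × ℝ => F (q.1 + q.2 • n)) ?_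
    exact hF.comp (by fun_prop)
  calc _ ≤ ∫⁻ x, (∫⁻ s : ℝ, F (x + s • n)) ∂((L : ℝ≥0∞) • ν.map g) :=
        lintegral_mono' hmeas le_rfl
    _ = L * ∫⁻ p, (∫⁻ s : ℝ, F (g p + s • n)) ∂ν := by
        rw [lintegral_smul_measure, smul_eq_mul, lintegral_map hFm hg.continuous.measurable]
    _ = L * ∫⁻ p : (ℝ ∙ n)ᗮ, (∫⁻ s : ℝ, F ((p : E d) + s • n)) ∂ν := by
        congr 1
        refine lintegral_congr fun p => ?_
        -- A shift by `h p` along the full line removes the graph function, leaving Fubini for a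
        -- hyperplane and its normal lines.
        rw [← lintegral_sub_right_eq_self (fun s : ℝ => F ((p : E d) + s • n)) (h p)]
        refine lintegral_congr fun s => ?_
        congr 1
        simp only [g]
        module
    _ = _ := by rw [hc F hF]; push_cast; ring

/-- The boundary of a nonempty bounded open set has positive surface measure. -/
theorem surf_frontier_pos (hd : 0 < d) {Ω : Set (E d)} (ho : IsOpen Ω) (hne : Ω.Nonempty)
    (hb : Bornology.IsBounded Ω) : 0 < surf d (frontier Ω) := by
  let n : E d := EuclideanSpace.single ⟨0, hd⟩ 1
  have hn : ‖n‖ = 1 := by simp [n]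
  have := isAddHaarMeasure_surf_orthogonal hn
  refine lt_of_lt_of_le ?_ (surf_image_orthogonalProjectionOnto_le (n := n) (frontier Ω))
  have hopen : IsOpen ((ℝ ∙ n)ᗮ.orthogonalProjectionOnto '' Ω) := by
    refine ContinuousLinearMap.isOpenMap (ℝ ∙ n)ᗮ.orthogonalProjectionOnto (fun p => ⟨p, ?_⟩) _ ho
    exact Submodule.orthogonalProjectionOnto_mem_subspace_eq_self p
  refine (hopen.measure_pos _ (hne.image _)).trans_le (measure_mono ?_)
  -- The line through `x` in direction `n` leaves the bounded set `Ω`, so it meets the frontier. The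
  -- projection of the frontier therefore contains the open projection of `Ω`, which has positive
  -- measure.
  rintro _ ⟨x, hx, rfl⟩
  have hline : IsPreconnected (range fun s : ℝ => x + s • n) :=
    isPreconnected_range (by fun_prop)
  obtain ⟨_, ⟨s, rfl⟩, hs⟩ : ((range fun s : ℝ => x + s • n) ∩ frontier Ω).Nonempty := by
    by_contra hcon
    have h1 : (range fun s : ℝ => x + s • n) ⊆ Ω := by
      refine hline.subset_of_closure_inter_subset ho ⟨x, ⟨0, by simp⟩, hx⟩ ?_
      rintro y ⟨hy1, hy2⟩
      by_contra hyn
      exact hcon ⟨y, hy2, by rw [ho.frontier_eq]; exact ⟨hy1, hyn⟩⟩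
    obtain ⟨r, hr⟩ := hb.subset_ball x
    have h2 := hr (h1 ⟨|r|, rfl⟩)
    rw [Metric.mem_ball, dist_eq_norm, add_sub_cancel_left, norm_smul, hn] at h2
    simp only [Real.norm_eq_abs, abs_abs, mul_one] at h2
    exact absurd h2 (not_lt.2 (le_abs_self r))
  refine ⟨_, hs, ?_⟩
  rw [map_add, map_smul,
    Submodule.orthogonalProjectionOnto_orthogonal_apply_eq_zero (Submodule.mem_span_singleton_self n)]
  simp

end Graph

end

/-! ### Lipschitz regions: charts, control up to the boundary, trace inequality. -/

section

variable {d : ℕ}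

/-- Near each boundary point, `D` is the set where a Lipschitz function `h` growing with unit
speed in a direction `n` is positive, i.e. it lies on one side of a Lipschitz graph. -/
def IsLipschitzRegion (D : Set (E d)) : Prop :=
  ∀ x₀ ∈ frontier D, ∃ n : E d, ‖n‖ = 1 ∧ ∃ r : ℝ, 0 < r ∧ ∃ (K : ℝ≥0) (h : E d → ℝ),
    LipschitzWith K h ∧ (∀ x (s : ℝ), h (x + s • n) = h x + s) ∧
    ∀ x ∈ Metric.ball x₀ r, x ∈ D ↔ 0 < h x

theorem IsBoundedLipschitzDomain.isLipschitzRegion {Ω : Set (E d)}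
    (hΩ : IsBoundedLipschitzDomain Ω) : IsLipschitzRegion Ω := by
  intro x₀ hx₀
  obtain ⟨n, hn, r, hr, K, γ, hγ, h⟩ := hΩ.lipschitz_boundary x₀ hx₀
  have hL : LipschitzWith 1 fun x : E d => ⟪n, x⟫_ℝ := by
    refine LipschitzWith.of_dist_le_mul fun x y => ?_
    rw [dist_eq_norm, ← inner_sub_right, dist_eq_norm]
    simpa [hn] using norm_inner_le_norm (𝕜 := ℝ) n (x - y)
  have hP : LipschitzWith (1 + 1) fun x : E d => x - ⟪n, x⟫_ℝ • n := by
    refine LipschitzWith.id.sub (LipschitzWith.of_dist_le_mul fun x y => ?_)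
    rw [dist_eq_norm, ← sub_smul, norm_smul, hn, mul_one, ← dist_eq_norm]
    exact hL.dist_le_mul x y
  refine ⟨n, hn, r, hr, _, fun x => ⟪n, x⟫_ℝ - γ (x - ⟪n, x⟫_ℝ • n), hL.sub (hγ.comp hP), ?_, ?_⟩
  · intro x s
    have h1 : ⟪n, x + s • n⟫_ℝ = ⟪n, x⟫_ℝ + s := by
      rw [inner_add_right, inner_smul_right, real_inner_self_eq_norm_sq, hn]; ring
    have h2 : x + s • n - (⟪n, x⟫_ℝ + s) • n = x - ⟪n, x⟫_ℝ • n := by module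
    simp only [h1, h2]; ring
  · intro x hx
    rw [h x hx, sub_pos]

section Chart

variable {D : Set (E d)} {n x₀ x : E d} {r : ℝ} {h : E d → ℝ}

/-- Points with `h < 0` have a neighbourhood outside `D`, and a point with `h ≥ 0` becomes a point
of `D` after an arbitrarily small move along `n`. -/
theorem chart_mem_closure (hc : Continuous h) (hh : ∀ x (s : ℝ), h (x + s • n) = h x + s)
    (hD : ∀ x ∈ Metric.ball x₀ r, x ∈ D ↔ 0 < h x) (hx : x ∈ Metric.ball x₀ r) :
    x ∈ closure D ↔ 0 ≤ h x := by
  constructor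
  · intro hcl
    by_contra! hneg
    obtain ⟨y, ⟨hy1, hy2⟩, hyD⟩ := mem_closure_iff.1 hcl (Metric.ball x₀ r ∩ {y | h y < 0})
      (Metric.isOpen_ball.inter (isOpen_lt hc continuous_const)) ⟨hx, hneg⟩
    exact absurd ((hD y hy1).1 hyD) (not_lt.2 (le_of_lt hy2))
  · intro hpos
    have ht : Tendsto (fun s : ℝ => x + s • n) (𝓝[>] 0) (𝓝 x) := by
      have : Continuous fun s : ℝ => x + s • n := by fun_prop
      simpa using (this.tendsto 0).mono_left nhdsWithin_le_nhds
    refine mem_closure_of_tendsto ht ?_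
    filter_upwards [ht.eventually (Metric.isOpen_ball.mem_nhds hx), self_mem_nhdsWithin]
      with s hs hs'
    rw [hD _ hs, hh]
    exact add_pos_of_nonneg_of_pos hpos hs'

theorem chart_mem_interior (hc : Continuous h)
    (hD : ∀ x ∈ Metric.ball x₀ r, x ∈ D ↔ 0 < h x) (hx : x ∈ Metric.ball x₀ r) :
    x ∈ interior D ↔ 0 < h x := by
  refine ⟨fun hi => (hD x hx).1 (interior_subset hi), fun hpos => ?_⟩
  refine mem_interior.2 ⟨Metric.ball x₀ r ∩ {y | 0 < h y}, fun y hy => (hD y hy.1).2 hy.2,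
    Metric.isOpen_ball.inter (isOpen_lt continuous_const hc), hx, hpos⟩

theorem chart_mem_frontier (hc : Continuous h) (hh : ∀ x (s : ℝ), h (x + s • n) = h x + s)
    (hD : ∀ x ∈ Metric.ball x₀ r, x ∈ D ↔ 0 < h x) (hx : x ∈ Metric.ball x₀ r) :
    x ∈ frontier D ↔ h x = 0 := by
  rw [frontier, Set.mem_sdiff, chart_mem_closure hc hh hD hx, chart_mem_interior hc hD hx, not_lt,
    le_antisymm_iff, and_comm]

end Chart

namespace IsLipschitzRegion

variable {D : Set (E d)}

/-- A Lipschitz region lies on one side of its boundary: from a boundary point, any small move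
against `n` leaves the closure. -/
theorem frontier_closure_eq (hD : IsLipschitzRegion D) : frontier (closure D) = frontier D := by
  refine Subset.antisymm frontier_closure_subset fun x₀ hx₀ => ?_
  obtain ⟨n, hn, r, hr, K, h, hK, hh, hx⟩ := hD x₀ hx₀
  have hmem := Metric.mem_ball_self (x := x₀) hr
  have h0 := (chart_mem_frontier hK.continuous hh hx hmem).1 hx₀
  refine ⟨subset_closure hx₀.1, fun hi => ?_⟩
  have ht : Tendsto (fun s : ℝ => x₀ + s • n) (𝓝[<] 0) (𝓝 x₀) := by
    have : Continuous fun s : ℝ => x₀ + s • n := by fun_prop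
    simpa using (this.tendsto 0).mono_left nhdsWithin_le_nhds
  obtain ⟨s, ⟨hs1, hs2⟩, hs3⟩ := (((ht.eventually (isOpen_interior.mem_nhds hi)).and
    ((ht.eventually (Metric.isOpen_ball.mem_nhds hmem)))).and self_mem_nhdsWithin).exists
  have := (chart_mem_closure hK.continuous hh hx hs2).1 (interior_subset hs1)
  rw [hh, h0, zero_add] at this
  exact absurd hs3 (not_lt.2 this)

/-- The same charts serve the exterior after reversing `n` and `h`; the inequality stays strict
because the closure is described by `0 ≤ h`. -/
theorem compl_closure (hD : IsLipschitzRegion D) : IsLipschitzRegion (closure D)ᶜ := by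
  intro x₀ hx₀
  rw [frontier_compl, hD.frontier_closure_eq] at hx₀
  obtain ⟨n, hn, r, hr, K, h, hK, hh, hx⟩ := hD x₀ hx₀
  refine ⟨-n, by rwa [norm_neg], r, hr, K, fun x => -h x, hK.neg, fun x s => ?_, fun x hxr => ?_⟩
  · have := hh x (-s)
    simp only [show x + s • -n = x + (-s) • n by module, this]; ring
  · rw [mem_compl_iff, chart_mem_closure hK.continuous hh hx hxr]
    simp

/-- Moving the zero set of `h` along `n` by different amounts gives disjoint sets, since `h` takes a
different constant value on each. A set with infinitely many disjoint translates by a bounded family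
of vectors is null. -/
theorem volume_frontier (hD : IsLipschitzRegion D) : volume (frontier D) = 0 := by
  refine measure_null_of_locally_null _ fun x₀ hx₀ => ?_
  obtain ⟨n, hn, r, hr, K, h, hK, hh, hx⟩ := hD x₀ hx₀
  have hz : volume {x | h x = 0} = 0 := by
    refine Measure.addHaar_eq_zero_of_disjoint_translates volume
      (fun k : ℕ => (1 / ((k : ℝ) + 1)) • n) ?_ ?_ (isClosed_eq hK.continuous
        continuous_const).measurableSet
    · refine isBounded_iff_forall_norm_le.2 ⟨1, ?_⟩
      rintro _ ⟨k, rfl⟩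
      rw [norm_smul, hn, mul_one, Real.norm_of_nonneg (by positivity)]
      rw [div_le_one (by positivity)]
      linarith [Nat.cast_nonneg (α := ℝ) k]
    · intro k l hkl
      refine disjoint_left.2 ?_
      simp only [singleton_add, image_add_left, mem_preimage, mem_ofPred_eq]
      intro y hy1 hy2
      rw [neg_add_eq_sub, sub_eq_add_neg, ← neg_smul, hh] at hy1 hy2
      apply hkl
      have h1 : 1 / ((k : ℝ) + 1) = 1 / ((l : ℝ) + 1) := by linarith
      rw [div_eq_div_iff (by positivity) (by positivity)] at h1
      exact_mod_cast (by linarith : (k : ℝ) = l)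
  refine ⟨frontier D ∩ Metric.ball x₀ r, inter_mem_nhdsWithin _ (Metric.ball_mem_nhds x₀ hr), ?_⟩
  exact measure_mono_null (fun x hx' =>
    (chart_mem_frontier hK.continuous hh hx hx'.2).1 hx'.1) hz

/-- Points of `D` near the boundary are pushed inwards along `n` into a compact subset of `D`, where
chains of small balls give the control. -/
theorem exists_controls_ball (hD : IsLipschitzRegion D) (ho : IsOpen D) (hc : IsPreconnected D)
    {p : E d} {r : ℝ} (hp : p ∈ D) (hr : 0 < r) {x₀ : E d} (hx₀ : x₀ ∈ frontier D) :
    ∃ ε > 0, Controls D (D ∩ Metric.ball x₀ ε) (Metric.ball p r) := by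
  obtain ⟨n, hn, a, ha, K, h, hK, hh, hx⟩ := hD x₀ hx₀
  refine ⟨a / 4, by positivity, ?_⟩
  -- A push of length `a / 4` raises `h` above `a / 4` and takes the ball of radius `a / 4` into the
  -- closed ball of radius `a / 2`, still within the chart.
  set S : Set (E d) := Metric.closedBall x₀ (a / 2) ∩ {z | a / 4 ≤ h z}
  have hS : IsCompact S := (isCompact_closedBall _ _).inter_right
    (isClosed_le continuous_const hK.continuous)
  have hmove : ∀ x ∈ Metric.ball x₀ (a / 4), ∀ s ∈ Icc (0 : ℝ) (a / 4),
      x + s • n ∈ Metric.closedBall x₀ (a / 2) := by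
    intro x hx s hs
    rw [Metric.mem_ball, dist_eq_norm] at hx
    rw [Metric.mem_closedBall, dist_eq_norm, show x + s • n - x₀ = (x - x₀) + s • n by abel]
    have := norm_add_le (x - x₀) (s • n)
    rw [norm_smul, hn, mul_one, Real.norm_of_nonneg hs.1] at this
    linarith [hs.2]
  have hball : Metric.closedBall x₀ (a / 2) ⊆ Metric.ball x₀ a :=
    Metric.closedBall_subset_ball (by linarith)
  have h1 : Controls D S (Metric.ball p r) := by
    have := Controls.of_isCompact (D := D) (A := univ) (B := Metric.ball p r) hS fun x hxS => by
      have hxD : x ∈ D := (hx x (hball hxS.1)).2 (lt_of_lt_of_le (by positivity) hxS.2)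
      simpa using controls_ball_of_isPreconnected ho hc hr hp hxD
    simpa using this
  refine Controls.trans ?_ h1
  refine Controls.translate (ho.measurableSet.inter measurableSet_ball) hS.measurableSet
    ho.measurableSet (Metric.isBounded_ball.subset inter_subset_right) ((a / 4) • n) ?_ ?_
  · rintro x ⟨hxD, hxb⟩
    refine ⟨hmove x hxb _ ⟨by positivity, le_rfl⟩, ?_⟩
    have := (hx x (Metric.ball_subset_ball (by linarith) hxb)).1 hxD
    simp only [mem_ofPred_eq, hh]
    linarith
  · rintro x ⟨hxD, hxb⟩ s hs
    rw [smul_smul]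
    have := (hx x (Metric.ball_subset_ball (by linarith) hxb)).1 hxD
    rw [hx _ (hball (hmove x hxb _ ⟨mul_nonneg hs.1 (by positivity),
      mul_le_of_le_one_left (by positivity) hs.2⟩)), hh]
    have := mul_nonneg hs.1 (by positivity : 0 ≤ a / 4)
    linarith

theorem controls_closedBall (hD : IsLipschitzRegion D) (ho : IsOpen D) (hc : IsPreconnected D)
    {p : E d} {r : ℝ} (hp : p ∈ D) (hr : 0 < r) (R : ℝ) :
    Controls D (D ∩ Metric.closedBall 0 R) (Metric.ball p r) := by
  refine Controls.of_isCompact (isCompact_closedBall _ _) fun x _ => ?_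
  by_cases hx : x ∈ closure D
  · by_cases hxD : x ∈ D
    · obtain ⟨ε, hε, h⟩ := controls_ball_of_isPreconnected ho hc hr hp hxD
      exact ⟨ε, hε, h.mono inter_subset_right subset_rfl⟩
    · exact hD.exists_controls_ball ho hc hp hr (by rw [ho.frontier_eq]; exact ⟨hx, hxD⟩)
  · obtain ⟨ε, hε, h⟩ := Metric.isOpen_iff.1 isClosed_closure.isOpen_compl x hx
    refine ⟨ε, hε, Controls.of_subset ?_⟩
    rintro y ⟨hyD, hy⟩
    exact absurd (subset_closure hyD) (h hy)

/-- Local trace inequality. -/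
theorem exists_trace_ball (hD : IsLipschitzRegion D) (ho : IsOpen D) {x₀ : E d}
    (hx₀ : x₀ ∈ frontier D) :
    ∃ ε > 0, ∃ C : ℝ≥0, ∃ R : ℝ, ∀ φ : E d → ℝ, ContDiff ℝ 1 φ →
      ∫⁻ x in frontier D ∩ Metric.ball x₀ ε, ‖φ x‖ₑ ^ 2 ∂(surf d) ≤
        C * ((∫⁻ x in D ∩ Metric.ball 0 R, ‖φ x‖ₑ ^ 2) +
          ∫⁻ x in D ∩ Metric.ball 0 R, ‖fderiv ℝ φ x‖ₑ ^ 2) := by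
  obtain ⟨n, hn, a, ha, K, h, hK, hh, hx⟩ := hD x₀ hx₀
  obtain ⟨C, hC⟩ := exists_lintegral_graph_le hn hK hh
  set H := a / 2 with hH
  have hHpos : 0 < H := by positivity
  have hH0 : ENNReal.ofReal H ≠ 0 := by simpa using hHpos
  refine ⟨H, hHpos, (2 / H.toNNReal + 2 * H.toNNReal) * C, ‖x₀‖ + a, fun φ hφ => ?_⟩
  have hφc := hφ.continuous
  have hφd := hφ.continuous_fderiv one_ne_zero
  set B := D ∩ Metric.ball 0 (‖x₀‖ + a)
  have hBm : MeasurableSet B := ho.measurableSet.inter measurableSet_ball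
  have hin : ∀ x ∈ frontier D ∩ Metric.ball x₀ H, ∀ s ∈ Ioc 0 H, x + s • n ∈ B := by
    rintro x ⟨hxf, hxb⟩ s ⟨hs0, hsH⟩
    have hb : x + s • n ∈ Metric.ball x₀ a := by
      rw [Metric.mem_ball, dist_eq_norm] at hxb ⊢
      rw [show x + s • n - x₀ = (x - x₀) + s • n by abel]
      have := norm_add_le (x - x₀) (s • n)
      rw [norm_smul, hn, mul_one, Real.norm_of_nonneg hs0.le] at this
      linarith
    refine ⟨?_, ?_⟩
    · rw [hx _ hb, hh, (chart_mem_frontier hK.continuous hh hx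
        (Metric.ball_subset_ball (by linarith) hxb)).1 hxf]
      simpa using hs0
    · rw [Metric.mem_ball, dist_eq_norm] at hb
      rw [mem_ball_zero_iff]
      linarith [norm_le_norm_add_norm_sub' (x + s • n) x₀]
  set f₁ : E d → ℝ≥0∞ := B.indicator fun x => ‖φ x‖ₑ ^ 2
  set f₂ : E d → ℝ≥0∞ := B.indicator fun x => ‖fderiv ℝ φ x‖ₑ ^ 2
  have hf₁ : Measurable f₁ := (hφc.enorm.measurable.pow_const 2).indicator hBm
  have hf₂ : Measurable f₂ := (hφd.enorm.measurable.pow_const 2).indicator hBm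
  set F : E d → ℝ≥0∞ := fun x => 2 / ENNReal.ofReal H * f₁ x + 2 * ENNReal.ofReal H * f₂ x
  have hF : Measurable F := (hf₁.const_mul _).add (hf₂.const_mul _)
  have hpt : ∀ x ∈ frontier D ∩ Metric.ball x₀ H, ‖φ x‖ₑ ^ 2 ≤ ∫⁻ s : ℝ, F (x + s • n) := by
    intro x hxm
    -- The boundary value is compared with the value at height `s` in the region. Averaging over `s`
    -- in `(0, H]` then produces the factors `2 / H` for the function and `2 * H` for its gradient.
    have h2 : ∀ s ∈ Ioc 0 H, ‖φ x‖ₑ ^ 2 ≤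
        2 * f₁ (x + s • n) + 2 * (ENNReal.ofReal H * ∫⁻ t : ℝ, f₂ (x + t • n)) := by
      intro s hs
      refine (enorm_sq_le_two_sub (φ x) (φ (x + s • n))).trans ?_
      gcongr 2 * ?_ + 2 * ?_
      · rw [show f₁ (x + s • n) = _ from indicator_of_mem (hin x hxm s hs) _]
      · refine (enorm_sub_sq_le_lintegral hφ x n hs.1.le).trans ?_
        have hn' : ‖n‖ₑ = 1 := by rw [← ofReal_norm, hn, ENNReal.ofReal_one]
        rw [hn', one_pow, one_mul]
        refine mul_le_mul' (ENNReal.ofReal_le_ofReal hs.2) ?_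
        · rw [Measure.restrict_congr_set Ioc_ae_eq_Icc.symm,
            ← lintegral_indicator measurableSet_Ioc]
          refine lintegral_mono fun t => ?_
          by_cases ht : t ∈ Ioc 0 s
          · rw [indicator_of_mem ht, show f₂ (x + t • n) = _ from
              indicator_of_mem (hin x hxm t ⟨ht.1, ht.2.trans hs.2⟩) _]
          · simp [ht]
    have h3 : ENNReal.ofReal H * ‖φ x‖ₑ ^ 2 ≤ 2 * (∫⁻ s : ℝ, f₁ (x + s • n)) +
        ENNReal.ofReal H * (2 * (ENNReal.ofReal H * ∫⁻ t : ℝ, f₂ (x + t • n))) := by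
      have hm1 : Measurable fun s : ℝ => f₁ (x + s • n) := hf₁.comp (by fun_prop)
      calc _ = ∫⁻ s in Ioc 0 H, ‖φ x‖ₑ ^ 2 := by
            rw [setLIntegral_const, Real.volume_Ioc, sub_zero, mul_comm]
        _ ≤ ∫⁻ s in Ioc 0 H, (2 * f₁ (x + s • n) +
              2 * (ENNReal.ofReal H * ∫⁻ t : ℝ, f₂ (x + t • n))) :=
            setLIntegral_mono' measurableSet_Ioc h2
        _ = 2 * (∫⁻ s in Ioc 0 H, f₁ (x + s • n)) +
              ENNReal.ofReal H * (2 * (ENNReal.ofReal H * ∫⁻ t : ℝ, f₂ (x + t • n))) := by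
            rw [lintegral_add_left (hm1.const_mul 2), lintegral_const_mul _ hm1,
              setLIntegral_const, Real.volume_Ioc, sub_zero]
            ring
        _ ≤ _ := by gcongr; exact Measure.restrict_le_self
    have hm1 : Measurable fun s : ℝ => f₁ (x + s • n) := hf₁.comp (by fun_prop)
    have hm2 : Measurable fun s : ℝ => f₂ (x + s • n) := hf₂.comp (by fun_prop)
    have h4 : ∫⁻ s : ℝ, F (x + s • n) = 2 / ENNReal.ofReal H * (∫⁻ s : ℝ, f₁ (x + s • n)) +
        2 * ENNReal.ofReal H * ∫⁻ t : ℝ, f₂ (x + t • n) := by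
      simp only [F]
      rw [lintegral_add_left (hm1.const_mul _), lintegral_const_mul _ hm1,
        lintegral_const_mul _ hm2]
    rw [h4]
    refine (ENNReal.mul_le_mul_iff_right hH0 ENNReal.ofReal_ne_top).1 (h3.trans (le_of_eq ?_))
    rw [mul_add, ← mul_assoc, ← mul_assoc (ENNReal.ofReal H), ENNReal.mul_div_cancel hH0
      ENNReal.ofReal_ne_top]
    ring
  have hmeas : MeasurableSet (frontier D ∩ Metric.ball x₀ H) :=
    isClosed_frontier.measurableSet.inter measurableSet_ball
  calc _ ≤ ∫⁻ x in frontier D ∩ Metric.ball x₀ H, (∫⁻ s : ℝ, F (x + s • n)) ∂(surf d) :=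
        setLIntegral_mono' hmeas hpt
    _ ≤ ∫⁻ x in {x | h x = 0}, (∫⁻ s : ℝ, F (x + s • n)) ∂(surf d) := by
        refine lintegral_mono_set fun x hxm => ?_
        exact (chart_mem_frontier hK.continuous hh hx
          (Metric.ball_subset_ball (by linarith) hxm.2)).1 hxm.1
    _ ≤ C * ∫⁻ x, F x := hC F hF
    _ = C * (2 / ENNReal.ofReal H * (∫⁻ x in B, ‖φ x‖ₑ ^ 2) +
          2 * ENNReal.ofReal H * ∫⁻ x in B, ‖fderiv ℝ φ x‖ₑ ^ 2) := by
        simp only [F]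
        rw [lintegral_add_left (hf₁.const_mul _), lintegral_const_mul _ hf₁,
          lintegral_const_mul _ hf₂, lintegral_indicator hBm, lintegral_indicator hBm]
    _ ≤ C * ((2 / ENNReal.ofReal H + 2 * ENNReal.ofReal H) * (∫⁻ x in B, ‖φ x‖ₑ ^ 2) +
          (2 / ENNReal.ofReal H + 2 * ENNReal.ofReal H) * ∫⁻ x in B, ‖fderiv ℝ φ x‖ₑ ^ 2) := by
        gcongr
        · exact le_self_add
        · exact le_add_self
    _ = _ := by
        push_cast
        rw [ENNReal.coe_div (by simpa using hHpos)]
        simp only [ENNReal.ofReal]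
        push_cast
        ring

/-- Trace inequality. -/
theorem exists_trace (hD : IsLipschitzRegion D) (ho : IsOpen D) (hf : IsCompact (frontier D)) :
    ∃ C : ℝ≥0, ∃ R : ℝ, ∀ φ : E d → ℝ, ContDiff ℝ 1 φ →
      ∫⁻ x in frontier D, ‖φ x‖ₑ ^ 2 ∂(surf d) ≤
        C * ((∫⁻ x in D ∩ Metric.ball 0 R, ‖φ x‖ₑ ^ 2) +
          ∫⁻ x in D ∩ Metric.ball 0 R, ‖fderiv ℝ φ x‖ₑ ^ 2) := by
  refine hf.induction_on (p := fun s => ∃ C : ℝ≥0, ∃ R : ℝ, ∀ φ : E d → ℝ, ContDiff ℝ 1 φ →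
      ∫⁻ x in s, ‖φ x‖ₑ ^ 2 ∂(surf d) ≤
        C * ((∫⁻ x in D ∩ Metric.ball 0 R, ‖φ x‖ₑ ^ 2) +
          ∫⁻ x in D ∩ Metric.ball 0 R, ‖fderiv ℝ φ x‖ₑ ^ 2)) ?_ ?_ ?_ ?_
  · exact ⟨0, 0, by simp⟩
  · rintro s t hst ⟨C, R, h⟩
    exact ⟨C, R, fun φ hφ => (lintegral_mono_set hst).trans (h φ hφ)⟩
  · rintro s t ⟨C, R, h⟩ ⟨C', R', h'⟩
    refine ⟨C + C', max R R', fun φ hφ => (lintegral_union_le _ _ _).trans ?_⟩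
    rw [ENNReal.coe_add, add_mul]
    refine add_le_add ((h φ hφ).trans ?_) ((h' φ hφ).trans ?_)
    all_goals gcongr <;> simp
  · intro x hx
    obtain ⟨ε, hε, C, R, h⟩ := hD.exists_trace_ball ho hx
    exact ⟨_, inter_mem_nhdsWithin _ (Metric.ball_mem_nhds x hε), C, R, h⟩

/-- The trace inequality applied to the constant function 1. -/
theorem surf_frontier_lt_top (hD : IsLipschitzRegion D) (ho : IsOpen D)
    (hf : IsCompact (frontier D)) : surf d (frontier D) < ⊤ := by
  obtain ⟨C, R, h⟩ := hD.exists_trace ho hf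
  have h1 : surf d (frontier D) ≤ C * volume (D ∩ Metric.ball 0 R) := by
    have h0 : ‖(0 : E d →L[ℝ] ℝ)‖ₑ = 0 := by rw [← ofReal_norm, norm_zero, ENNReal.ofReal_zero]
    simpa [h0] using h (fun _ => 1) contDiff_const
  refine h1.trans_lt (ENNReal.mul_lt_top ENNReal.coe_lt_top ?_)
  exact (measure_mono inter_subset_right).trans_lt
    (measure_ball_lt_top (μ := volume) (x := (0 : E d)) (r := R))

/-- On a connected Lipschitz region with compact boundary, the `L²` norm on bounded parts and
on the boundary is controlled by the `L²` norm on any ball and the Dirichlet integral. -/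
theorem exists_bulk_trace_le (hD : IsLipschitzRegion D) (ho : IsOpen D) (hc : IsPreconnected D)
    (hf : IsCompact (frontier D)) {p : E d} {r : ℝ} (hp : p ∈ D) (hr : 0 < r) (R₀ : ℝ) :
    ∃ C : ℝ≥0, ∃ R : ℝ, ∀ φ : E d → ℝ, ContDiff ℝ 1 φ →
      (∫⁻ x in D ∩ Metric.ball 0 R₀, ‖φ x‖ₑ ^ 2) + ∫⁻ x in frontier D, ‖φ x‖ₑ ^ 2 ∂(surf d) ≤
        C * ((∫⁻ x in Metric.ball p r, ‖φ x‖ₑ ^ 2) +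
          ∫⁻ x in D ∩ Metric.ball 0 R, ‖fderiv ℝ φ x‖ₑ ^ 2) := by
  obtain ⟨C₁, R₁, h₁⟩ := hD.exists_trace ho hf
  obtain ⟨C₂, R₂, h₂⟩ := hD.controls_closedBall ho hc hp hr R₀
  obtain ⟨C₃, R₃, h₃⟩ := hD.controls_closedBall ho hc hp hr R₁
  refine ⟨C₂ + C₁ * (C₃ + 1), max R₁ (max R₂ R₃), fun φ hφ => ?_⟩
  rw [ENNReal.coe_add, add_mul]
  refine add_le_add ?_ ?_
  · refine (lintegral_mono_set (by gcongr; exact Metric.ball_subset_closedBall)).trans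
      ((h₂ φ hφ).trans ?_)
    gcongr; simp
  · refine (h₁ φ hφ).trans ?_
    rw [ENNReal.coe_mul, mul_assoc, ENNReal.coe_add, add_mul, ENNReal.coe_one, one_mul]
    gcongr
    · refine (lintegral_mono_set (by gcongr; exact Metric.ball_subset_closedBall)).trans
        ((h₃ φ hφ).trans ?_)
      gcongr; simp
    · refine le_add_left (lintegral_mono_set ?_)
      gcongr; simp

end IsLipschitzRegion

end

/-! ### Weak derivatives, passage to functions with traces, and the estimate on a slice. -/

section

section WeakDeriv

variable {F : Type*} [NormedAddCommGroup F] [NormedSpace ℝ F] [FiniteDimensional ℝ F]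
  [MeasureSpace F] [BorelSpace F] {D : Set F}

theorem integrable_mul_of_hasCompactSupport {X : Type*} [TopologicalSpace X] [T2Space X]
    [SecondCountableTopology X] [MeasurableSpace X] [BorelSpace X] {μ : Measure X} {D : Set X}
    {f φ : X → ℝ} (hf : LocallyIntegrableOn f D μ)
    (hφ : Continuous φ) (hc : HasCompactSupport φ) (hs : tsupport φ ⊆ D) :
    Integrable (fun x => f x * φ x) μ := by
  refine (integrableOn_iff_integrable_of_support_subset (s := tsupport φ) ?_).1 ?_
  · exact (Function.support_mul_subset_right f φ).trans (subset_tsupport φ)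
  · have hK : IsCompact (tsupport φ) := hc
    have := hf.integrableOn_compact_subset hs hK
    exact this.mul_continuousOn hφ.continuousOn hK

theorem setIntegral_mul_eq_of_tsupport_subset {X : Type*} [TopologicalSpace X]
    [MeasurableSpace X] {μ : Measure X} {D : Set X} (f : X → ℝ) {φ : X → ℝ} (hs : tsupport φ ⊆ D) :
    ∫ x in D, f x * φ x ∂μ = ∫ x, f x * φ x ∂μ := by
  refine setIntegral_eq_integral_of_forall_compl_eq_zero fun x hx => ?_
  rw [image_eq_zero_of_notMem_tsupport fun h => hx (hs h), mul_zero]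

theorem tsupport_fderiv_apply_subset' {F : Type*} [NormedAddCommGroup F] [NormedSpace ℝ F]
    {φ : F → ℝ} (v : F) :
    tsupport (fun x => fderiv ℝ φ x v) ⊆ tsupport φ := by
  refine closure_minimal (fun x hx => ?_) (isClosed_tsupport φ)
  by_contra h
  exact hx (by simp [fderiv_of_notMem_tsupport ℝ h])

theorem LocallyIntegrableOn.apply_clm {F : Type*} [NormedAddCommGroup F] [NormedSpace ℝ F]
    {X : Type*} [TopologicalSpace X] [MeasurableSpace X]
    {μ : Measure X} {D : Set X} {G : X → F →L[ℝ] ℝ}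
    (hG : LocallyIntegrableOn G D μ) (v : F) : LocallyIntegrableOn (fun z => G z v) D μ := by
  intro x hx
  obtain ⟨s, hs, hi⟩ := hG x hx
  exact ⟨s, hs, hi.apply_continuousLinearMap v⟩

theorem HasWeakDeriv.mono {F : Type*} [NormedAddCommGroup F] [NormedSpace ℝ F] [MeasureSpace F]
    {D D' : Set F} {u : F → ℝ} {G : F → F →L[ℝ] ℝ} (h : HasWeakDeriv D u G)
    (hD : D' ⊆ D) : HasWeakDeriv D' u G := by
  refine ⟨h.1.mono_set hD, h.2.1.mono_set hD, fun φ hφ hc hs v => ?_⟩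
  have := h.2.2 φ hφ hc (hs.trans hD) v
  rwa [setIntegral_mul_eq_of_tsupport_subset _ ((tsupport_fderiv_apply_subset' v).trans
    (hs.trans hD)), setIntegral_mul_eq_of_tsupport_subset _ (hs.trans hD),
    ← setIntegral_mul_eq_of_tsupport_subset (D := D') _ ((tsupport_fderiv_apply_subset' v).trans
    hs), ← setIntegral_mul_eq_of_tsupport_subset (D := D') _ hs] at this

/-- The fundamental lemma of the calculus of variations in each direction of a basis. -/
theorem HasWeakDeriv.ae_eq (hD : IsOpen D) {u : F → ℝ} {G G' : F → F →L[ℝ] ℝ}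
    (h : HasWeakDeriv D u G) (h' : HasWeakDeriv D u G') : ∀ᵐ x, x ∈ D → G x = G' x := by
  have hv : ∀ v : F, ∀ᵐ x, x ∈ D → G x v - G' x v = 0 := by
    intro v
    have h1 := LocallyIntegrableOn.apply_clm h.2.1 v
    have h2 := LocallyIntegrableOn.apply_clm h'.2.1 v
    refine hD.ae_eq_zero_of_integral_contDiff_smul_eq_zero (h1.sub h2) fun φ hφ hc hs => ?_
    have e := (h.2.2 φ hφ hc hs v).symm.trans (h'.2.2 φ hφ hc hs v)
    rw [neg_inj, setIntegral_mul_eq_of_tsupport_subset (fun z => G z v) hs,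
      setIntegral_mul_eq_of_tsupport_subset (fun z => G' z v) hs] at e
    have i1 := integrable_mul_of_hasCompactSupport h1 hφ.continuous hc hs
    have i2 := integrable_mul_of_hasCompactSupport h2 hφ.continuous hc hs
    calc _ = ∫ x, (G x v * φ x - G' x v * φ x) := by
          refine integral_congr_ae (ae_of_all _ fun x => ?_)
          simp only [smul_eq_mul]; ring
      _ = 0 := by rw [integral_sub i1 i2, e, sub_self]
  have hb := ae_all_iff.2 fun i => hv (Module.finBasis ℝ F i)
  filter_upwards [hb] with x hx hxD
  have := (Module.finBasis ℝ F).ext (f₁ := (G x : F →ₗ[ℝ] ℝ)) (f₂ := (G' x : F →ₗ[ℝ] ℝ))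
    fun i => sub_eq_zero.1 (hx i hxD)
  exact ContinuousLinearMap.coe_injective this

end WeakDeriv

variable {d : ℕ}

theorem le_of_forall_le_add_of_tendsto {X M : ℝ≥0∞} {e : ℕ → ℝ≥0∞} (he : Tendsto e atTop (𝓝 0))
    (h : ∀ n, X ≤ M + e n) : X ≤ M := by
  have := (tendsto_const_nhds (x := M)).add he
  rw [add_zero] at this
  exact ge_of_tendsto' this h

theorem tendsto_const_mul_zero {c : ℝ≥0∞} (hc : c ≠ ⊤) {e : ℕ → ℝ≥0∞}
    (he : Tendsto e atTop (𝓝 0)) : Tendsto (fun n => c * e n) atTop (𝓝 0) := by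
  simpa using ENNReal.Tendsto.const_mul he (Or.inr hc)

theorem lintegral_enorm_sq_le_two_sub {X F : Type*} [MeasurableSpace X] [NormedAddCommGroup F]
    {μ : Measure X} {f g : X → F} (hg : AEStronglyMeasurable g μ) :
    ∫⁻ x, ‖f x‖ₑ ^ 2 ∂μ ≤ 2 * (∫⁻ x, ‖g x‖ₑ ^ 2 ∂μ) + 2 * ∫⁻ x, ‖g x - f x‖ₑ ^ 2 ∂μ := by
  calc _ ≤ ∫⁻ x, (2 * ‖g x‖ₑ ^ 2 + 2 * ‖g x - f x‖ₑ ^ 2) ∂μ :=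
        lintegral_mono fun x => enorm_sq_le_two_sub _ _
    _ = _ := by
        rw [lintegral_add_left' ((hg.enorm.pow_const 2).const_mul 2),
          lintegral_const_mul' _ _ (by simp), lintegral_const_mul' _ _ (by simp)]

/-- `φ n` are smooth functions approximating `u`, its derivative `G` and its trace `g`. -/
structure TraceApprox (D : Set (E d)) (u g : E d → ℝ) (G : E d → E d →L[ℝ] ℝ)
    (φ : ℕ → E d → ℝ) : Prop where
  contDiff : ∀ n, ContDiff ℝ 1 (φ n)
  aesm : AEStronglyMeasurable u (volume.restrict D)
  aesm_deriv : AEStronglyMeasurable G (volume.restrict D)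
  tendsto : ∀ R : ℝ, Tendsto (fun n => ∫⁻ x in D ∩ Metric.ball 0 R, ‖φ n x - u x‖ₑ ^ 2)
    atTop (𝓝 0)
  tendsto_deriv : ∀ R : ℝ, Tendsto (fun n => ∫⁻ x in D ∩ Metric.ball 0 R,
    ‖fderiv ℝ (φ n) x - G x‖ₑ ^ 2) atTop (𝓝 0)
  tendsto_trace : Tendsto (fun n => ∫⁻ x in frontier D, ‖φ n x - g x‖ₑ ^ 2 ∂(surf d))
    atTop (𝓝 0)

/-- The trace comes with a weak derivative of its own; uniqueness almost everywhere on `D`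
identifies it with the given `G`, so all estimates concern one and the same derivative. -/
theorem HasTrace.exists_traceApprox {D D₀ : Set (E d)} {u g : E d → ℝ} {G : E d → E d →L[ℝ] ℝ}
    (hD : IsOpen D) (hDD : D ⊆ D₀) (h : HasTrace D u g) (hu : HasWeakDeriv D₀ u G) :
    ∃ φ, TraceApprox D u g G φ := by
  obtain ⟨-, G', hG', φ, hφ, hφ1, hφ2⟩ := h
  have huD := hu.mono hDD
  have hae := HasWeakDeriv.ae_eq hD huD hG'
  refine ⟨φ, fun n => (hφ n).of_le (by norm_cast), huD.1.aestronglyMeasurable,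
    huD.2.1.aestronglyMeasurable, fun R => ?_, fun R => ?_, ?_⟩
  · refine tendsto_of_tendsto_of_tendsto_of_le_of_le tendsto_const_nhds (hφ1 R)
      (fun n => zero_le) fun n => lintegral_mono fun x => ?_
    rw [← ofReal_sq_eq_enorm_sq']
    exact ENNReal.ofReal_le_ofReal (le_add_of_nonneg_right (by positivity))
  · refine tendsto_of_tendsto_of_tendsto_of_le_of_le tendsto_const_nhds (hφ1 R)
      (fun n => zero_le) fun n => lintegral_mono_ae ?_
    rw [ae_restrict_iff' (hD.measurableSet.inter measurableSet_ball)]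
    filter_upwards [hae] with x hx hxD
    rw [← ofReal_sq_eq_enorm_sq, hx hxD.1]
    exact ENNReal.ofReal_le_ofReal (le_add_of_nonneg_left (by positivity))
  · simpa only [ofReal_sq_eq_enorm_sq'] using hφ2

/-- The bulk and trace bound for smooth functions survives the limit along a `TraceApprox`:
replacing the function by its approximation, and back, costs a factor 2 each time and errors that
vanish. -/
theorem IsLipschitzRegion.exists_trace_estimate {D : Set (E d)} (hD : IsLipschitzRegion D)
    (ho : IsOpen D) (hc : IsPreconnected D) (hf : IsCompact (frontier D)) {p : E d} {r : ℝ}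
    (hr : 0 < r) (hp : Metric.ball p r ⊆ D) (R₀ : ℝ) :
    ∃ C : ℝ≥0, ∀ u g G φ, TraceApprox D u g G φ →
      (∫⁻ x in D ∩ Metric.ball 0 R₀, ‖u x‖ₑ ^ 2) + ∫⁻ x in frontier D, ‖g x‖ₑ ^ 2 ∂(surf d) ≤
        C * ((∫⁻ x in Metric.ball p r, ‖u x‖ₑ ^ 2) + ∫⁻ x in D, ‖G x‖ₑ ^ 2) := by
  obtain ⟨C, R, h⟩ := hD.exists_bulk_trace_le ho hc hf (hp (Metric.mem_ball_self hr)) hr R₀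
  obtain ⟨R₁, hR₁⟩ := (Metric.isBounded_ball (x := p) (r := r)).subset_ball 0
  refine ⟨4 * C, fun u g G φ hA => ?_⟩
  have t1 := tendsto_const_mul_zero (c := 2 * (C : ℝ≥0∞)) (by finiteness)
    (by simpa using (hA.tendsto R₁).add (hA.tendsto_deriv R))
  have t2 := tendsto_const_mul_zero (c := 2) (by simp)
    (by simpa using ((hA.tendsto R₀).add hA.tendsto_trace).add t1)
  refine le_of_forall_le_add_of_tendsto t2 fun n => ?_
  have hφn := hA.contDiff n
  have e1 := lintegral_enorm_sq_le_two_sub (f := u)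
    (hφn.continuous.aestronglyMeasurable (μ := volume.restrict (D ∩ Metric.ball 0 R₀)))
  have e2 := lintegral_enorm_sq_le_two_sub (f := g)
    (hφn.continuous.aestronglyMeasurable (μ := (surf d).restrict (frontier D)))
  have e3 := lintegral_enorm_sq_le_two_sub (f := φ n) (g := u)
    (μ := volume.restrict (Metric.ball p r)) (hA.aesm.mono_set hp)
  have e4 := lintegral_enorm_sq_le_two_sub (f := fderiv ℝ (φ n)) (g := G)
    (μ := volume.restrict (D ∩ Metric.ball 0 R)) (hA.aesm_deriv.mono_set inter_subset_left)
  have e5 : ∫⁻ x in Metric.ball p r, ‖u x - φ n x‖ₑ ^ 2 ≤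
      ∫⁻ x in D ∩ Metric.ball 0 R₁, ‖φ n x - u x‖ₑ ^ 2 := by
    simp only [enorm_sub_rev (u _)]
    exact lintegral_mono_set (subset_inter hp hR₁)
  have e6 : ∫⁻ x in D ∩ Metric.ball 0 R, ‖G x‖ₑ ^ 2 ≤ ∫⁻ x in D, ‖G x‖ₑ ^ 2 :=
    lintegral_mono_set inter_subset_left
  simp only [enorm_sub_rev (G _)] at e4
  have hn := h (φ n) hφn
  set a1 := ∫⁻ x in D ∩ Metric.ball 0 R₀, ‖φ n x - u x‖ₑ ^ 2
  set a2 := ∫⁻ x in frontier D, ‖φ n x - g x‖ₑ ^ 2 ∂(surf d)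
  set a3 := ∫⁻ x in D ∩ Metric.ball 0 R₁, ‖φ n x - u x‖ₑ ^ 2
  set a4 := ∫⁻ x in D ∩ Metric.ball 0 R, ‖fderiv ℝ (φ n) x - G x‖ₑ ^ 2
  calc _ ≤ 2 * ((∫⁻ x in D ∩ Metric.ball 0 R₀, ‖φ n x‖ₑ ^ 2) +
          ∫⁻ x in frontier D, ‖φ n x‖ₑ ^ 2 ∂(surf d)) + 2 * (a1 + a2) := by
        refine (add_le_add e1 e2).trans (le_of_eq ?_)
        ring
    _ ≤ 2 * (C * ((2 * (∫⁻ x in Metric.ball p r, ‖u x‖ₑ ^ 2) + 2 * a3) +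
          (2 * (∫⁻ x in D, ‖G x‖ₑ ^ 2) + 2 * a4))) + 2 * (a1 + a2) := by
        gcongr
        refine hn.trans ?_
        gcongr
        · exact e3.trans (by gcongr)
        · exact e4.trans (by gcongr)
    _ = _ := by push_cast; ring

/-- Poincaré inequality on a bounded Lipschitz domain, normalized by the boundary mean. -/
theorem IsLipschitzRegion.exists_boundary_poincare (hd : 0 < d) {D : Set (E d)}
    (hD : IsLipschitzRegion D) (ho : IsOpen D) (hc : IsConnected D) (hb : Bornology.IsBounded D) :
    ∃ C : ℝ≥0, ∀ u g G φ, TraceApprox D u g G φ →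
      IntegrableOn g (frontier D) (surf d) →
      ∫⁻ x in D, ‖u x‖ₑ ^ 2 ≤
        C * ((∫⁻ x in D, ‖G x‖ₑ ^ 2) + ‖∫ x in frontier D, g x ∂(surf d)‖ₑ ^ 2) := by
  have hf : IsCompact (frontier D) := Metric.isCompact_of_isClosed_isBounded isClosed_frontier
    (hb.closure.subset frontier_subset_closure)
  have hσ := hD.surf_frontier_lt_top ho hf
  have hσ0 := surf_frontier_pos hd ho hc.nonempty hb
  have hvol : volume D < ⊤ := hb.measure_lt_top
  obtain ⟨p, hpD⟩ := hc.nonempty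
  obtain ⟨r, hr, hp⟩ := Metric.isOpen_iff.1 ho p hpD
  obtain ⟨R₀, hR₀⟩ := hb.subset_ball 0
  obtain ⟨C₁, R, h₁⟩ := hD.exists_bulk_trace_le ho hc.isPreconnected hf hpD hr R₀
  obtain ⟨C₂, h₂⟩ := exists_poincare_of_convex (convex_ball p r) Metric.isOpen_ball
    Metric.isBounded_ball ⟨p, Metric.mem_ball_self hr⟩
  set σ := surf d (frontier D) with hσdef
  set K : ℝ≥0∞ := 2 + 4 * σ⁻¹ * volume D
  set L : ℝ≥0∞ := C₁ * (C₂ + 1)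
  have hL : L ≠ ⊤ := by finiteness
  have hσi : σ⁻¹ ≠ ⊤ := by simpa using hσ0.ne'
  have hK : K ≠ ⊤ := by finiteness
  set C : ℝ≥0∞ := K * (4 * L) + 4 * (σ⁻¹ * σ⁻¹) * volume D
  have hC : C ≠ ⊤ := by finiteness
  refine ⟨C.toNNReal, fun u g G φ hA hg => ?_⟩
  rw [ENNReal.coe_toNNReal hC]
  set J := ‖∫ x in frontier D, g x ∂(surf d)‖ₑ ^ 2
  set T := ∫⁻ x in D, ‖G x‖ₑ ^ 2
  have t0 := tendsto_const_mul_zero (c := 2 * L) (by finiteness) (hA.tendsto_deriv R₀)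
  have t1 := tendsto_const_mul_zero hK (tendsto_const_mul_zero (c := 2) (by simp)
    (by simpa using ((hA.tendsto R₀).add hA.tendsto_trace).add t0))
  refine le_of_forall_le_add_of_tendsto t1 fun n => ?_
  have hφn := hA.contDiff n
  -- The Poincaré constant of the approximation on a small ball. Applied to `φ n - c`, the
  -- propagation bound leaves only the Dirichlet integral, both in the bulk and on the boundary.
  obtain ⟨c, hc'⟩ := h₂ (φ n) hφn
  have hDR : D ∩ Metric.ball 0 R₀ = D := inter_eq_left.2 hR₀
  have h3 := h₁ (fun x => φ n x - c) (hφn.sub contDiff_const)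
  simp only [fderiv_sub_const] at h3
  rw [hDR] at h3 ⊢
  set a1 := ∫⁻ x in D, ‖φ n x - u x‖ₑ ^ 2
  set a2 := ∫⁻ x in frontier D, ‖φ n x - g x‖ₑ ^ 2 ∂(surf d)
  set a4 := ∫⁻ x in D, ‖fderiv ℝ (φ n) x - G x‖ₑ ^ 2
  have e4 := lintegral_enorm_sq_le_two_sub (f := fderiv ℝ (φ n)) (g := G)
    (μ := volume.restrict D) hA.aesm_deriv
  simp only [enorm_sub_rev (G _)] at e4
  have hcφ : Continuous fun x => φ n x - c := hφn.continuous.sub continuous_const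
  have e1 := lintegral_enorm_sq_le_two_sub (f := fun x => u x - c)
    (hcφ.aestronglyMeasurable (μ := volume.restrict D))
  have e2 := lintegral_enorm_sq_le_two_sub (f := fun x => g x - c)
    (hcφ.aestronglyMeasurable (μ := (surf d).restrict (frontier D)))
  simp only [sub_sub_sub_cancel_right] at e1 e2
  have hS : (∫⁻ x in D, ‖u x - c‖ₑ ^ 2) + ∫⁻ x in frontier D, ‖g x - c‖ₑ ^ 2 ∂(surf d) ≤
      4 * L * T + 2 * (a1 + a2 + 2 * L * a4) := by
    calc _ ≤ 2 * ((∫⁻ x in D, ‖φ n x - c‖ₑ ^ 2) +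
            ∫⁻ x in frontier D, ‖φ n x - c‖ₑ ^ 2 ∂(surf d)) + 2 * (a1 + a2) := by
          refine (add_le_add e1 e2).trans (le_of_eq ?_)
          ring
      _ ≤ 2 * (L * (2 * T + 2 * a4)) + 2 * (a1 + a2) := by
          gcongr
          refine h3.trans ?_
          simp only [L]
          rw [mul_assoc, add_mul, one_mul]
          gcongr
          · exact hc'.trans (by gcongr; exact (lintegral_mono_set hp).trans e4)
          · exact (lintegral_mono_set inter_subset_left).trans e4
      _ = _ := by ring
  have hfin : IsFiniteMeasure ((surf d).restrict (frontier D)) :=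
    ⟨by simpa using hσ⟩
  -- The constant is recovered from the boundary mean: σ c is the integral of `g` minus that of `g -
  -- c`, and the latter is already controlled. Division by σ uses that the boundary has positive
  -- finite measure.
  have hcσ : ‖c‖ₑ ^ 2 ≤ 2 * (σ⁻¹ * σ⁻¹) * J +
      2 * σ⁻¹ * ∫⁻ x in frontier D, ‖g x - c‖ₑ ^ 2 ∂(surf d) := by
    have i1 : ∫ x in frontier D, (g x - c) ∂(surf d) =
        (∫ x in frontier D, g x ∂(surf d)) - σ.toReal * c := by
      rw [integral_sub hg (integrable_const c), setIntegral_const]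
      rfl
    have i2 : ‖∫ x in frontier D, (g x - c) ∂(surf d)‖ₑ ^ 2 ≤
        σ * ∫⁻ x in frontier D, ‖g x - c‖ₑ ^ 2 ∂(surf d) := by
      calc _ ≤ (∫⁻ x in frontier D, ‖g x - c‖ₑ ∂(surf d)) ^ 2 := by
            gcongr; exact enorm_integral_le_lintegral_enorm _
        _ ≤ _ := by
            refine (lintegral_sq_le _ (hg.1.sub aestronglyMeasurable_const).enorm).trans ?_
            rw [Measure.restrict_apply_univ]
            rfl
    have i3 : σ * σ * ‖c‖ₑ ^ 2 ≤ 2 * J +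
        2 * (σ * ∫⁻ x in frontier D, ‖g x - c‖ₑ ^ 2 ∂(surf d)) := by
      calc σ * σ * ‖c‖ₑ ^ 2 = ‖σ.toReal * c‖ₑ ^ 2 := by
            rw [enorm_mul, mul_pow, Real.enorm_of_nonneg ENNReal.toReal_nonneg,
              ENNReal.ofReal_toReal hσ.ne, sq σ]
        _ ≤ 2 * J + 2 * ‖∫ x in frontier D, (g x - c) ∂(surf d)‖ₑ ^ 2 := by
            refine (enorm_sq_le_two_sub _ (∫ x in frontier D, g x ∂(surf d))).trans ?_
            rw [i1]
        _ ≤ _ := by gcongr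
    have i4 : σ⁻¹ * σ = 1 := ENNReal.inv_mul_cancel hσ0.ne' hσ.ne
    calc ‖c‖ₑ ^ 2 = (σ⁻¹ * σ) * (σ⁻¹ * σ) * ‖c‖ₑ ^ 2 := by rw [i4]; ring
      _ = σ⁻¹ * σ⁻¹ * (σ * σ * ‖c‖ₑ ^ 2) := by ring
      _ ≤ σ⁻¹ * σ⁻¹ * (2 * J +
          2 * (σ * ∫⁻ x in frontier D, ‖g x - c‖ₑ ^ 2 ∂(surf d))) := by gcongr
      _ = 2 * (σ⁻¹ * σ⁻¹) * J + 2 * σ⁻¹ * (σ⁻¹ * σ) *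
          ∫⁻ x in frontier D, ‖g x - c‖ₑ ^ 2 ∂(surf d) := by ring
      _ = _ := by rw [i4]; ring
  set b1 := ∫⁻ x in D, ‖u x - c‖ₑ ^ 2
  set b2 := ∫⁻ x in frontier D, ‖g x - c‖ₑ ^ 2 ∂(surf d)
  have hlast : ∫⁻ x in D, ‖u x‖ₑ ^ 2 ≤ 2 * b1 + 2 * (‖c‖ₑ ^ 2 * volume D) := by
    calc _ ≤ ∫⁻ x in D, (2 * ‖u x - c‖ₑ ^ 2 + 2 * ‖c‖ₑ ^ 2) := by
          refine lintegral_mono fun x => ?_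
          simpa using enorm_add_sq_le (u x - c) c
      _ = _ := by
          rw [lintegral_add_right _ measurable_const, lintegral_const_mul' _ _ (by simp),
            setLIntegral_const, mul_assoc]
  calc _ ≤ 2 * b1 + 2 * ((2 * (σ⁻¹ * σ⁻¹) * J + 2 * σ⁻¹ * b2) * volume D) :=
        hlast.trans (by gcongr)
    _ = 2 * b1 + 4 * σ⁻¹ * volume D * b2 + 4 * (σ⁻¹ * σ⁻¹) * volume D * J := by ring
    _ ≤ K * (b1 + b2) + 4 * (σ⁻¹ * σ⁻¹) * volume D * J := by
        gcongr
        rw [mul_add]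
        gcongr
        · exact le_self_add
        · exact le_add_self
    _ ≤ K * (4 * L * T + 2 * (a1 + a2 + 2 * L * a4)) +
          4 * (σ⁻¹ * σ⁻¹) * volume D * J := by gcongr
    _ = K * (4 * L) * T + 4 * (σ⁻¹ * σ⁻¹) * volume D * J +
          K * (2 * (a1 + a2 + 2 * L * a4)) := by ring
    _ ≤ _ := by
        gcongr
        rw [mul_add]
        exact add_le_add (mul_le_mul_left le_self_add _) (mul_le_mul_left le_add_self _)

/-- Control of a function with mean-zero jump near `Γ` by its values on a ball in the exterior. -/
theorem exists_slice_estimate (hd : 0 < d) {Ω : Set (E d)} (hΩ : IsBoundedLipschitzDomain Ω)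
    (hext : IsConnected (closure Ω)ᶜ) {p : E d} {r : ℝ} (hr : 0 < r)
    (hp : Metric.ball p r ⊆ (closure Ω)ᶜ) (R₀ : ℝ) :
    ∃ C : ℝ≥0, ∀ u G, HasWeakDeriv (frontier Ω)ᶜ u G → JumpMeanZero Ω u →
      ∫⁻ x in Metric.ball 0 R₀, ‖u x‖ₑ ^ 2 ≤
        C * ((∫⁻ x in Metric.ball p r, ‖u x‖ₑ ^ 2) + ∫⁻ x in (frontier Ω)ᶜ, ‖G x‖ₑ ^ 2) := by
  have hL := hΩ.isLipschitzRegion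
  have hLe := hL.compl_closure
  have hΓ : frontier (closure Ω)ᶜ = frontier Ω := by rw [frontier_compl, hL.frontier_closure_eq]
  have hf : IsCompact (frontier Ω) := Metric.isCompact_of_isClosed_isBounded isClosed_frontier
    (hΩ.isBounded.closure.subset frontier_subset_closure)
  have hσ := hL.surf_frontier_lt_top hΩ.isOpen hf
  have heo : IsOpen (closure Ω)ᶜ := isClosed_closure.isOpen_compl
  obtain ⟨C₁, h₁⟩ := hLe.exists_trace_estimate heo hext.isPreconnected (hΓ ▸ hf) hr hp R₀
  obtain ⟨C₂, h₂⟩ := hL.exists_boundary_poincare hd hΩ.isOpen hΩ.isConnected hΩ.isBounded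
  set σ := surf d (frontier Ω)
  refine ⟨C₂ + (1 + C₂ * σ.toNNReal) * C₁, fun u G hu ⟨gi, ge, hgi, hge, hjump⟩ => ?_⟩
  have hsi : Ω ⊆ (frontier Ω)ᶜ := fun x hx hxf => by
    rw [hΩ.isOpen.frontier_eq] at hxf; exact hxf.2 hx
  have hse : (closure Ω)ᶜ ⊆ (frontier Ω)ᶜ := compl_subset_compl.2 frontier_subset_closure
  obtain ⟨φi, hφi⟩ := hgi.exists_traceApprox hΩ.isOpen hsi hu
  obtain ⟨φe, hφe⟩ := hge.exists_traceApprox heo hse hu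
  have hfin : IsFiniteMeasure ((surf d).restrict (frontier Ω)) := ⟨by simpa using hσ⟩
  have hgii : IntegrableOn gi (frontier Ω) (surf d) := hgi.1.integrable (by norm_num)
  have hgei : IntegrableOn ge (frontier Ω) (surf d) := by
    have := hge.1
    rw [hΓ] at this
    exact this.integrable (by norm_num)
  rw [integral_sub hgii hgei, sub_eq_zero] at hjump
  have e1 := h₁ u ge G φe hφe
  rw [hΓ] at e1
  have e2 := h₂ u gi G φi hφi hgii
  -- The only use of the vanishing mean jump in this estimate: the boundary mean of the interior
  -- trace becomes that of the exterior trace, which the exterior estimate bounds.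
  rw [hjump] at e2
  have e3 : ‖∫ x in frontier Ω, ge x ∂(surf d)‖ₑ ^ 2 ≤
      σ * ∫⁻ x in frontier Ω, ‖ge x‖ₑ ^ 2 ∂(surf d) := by
    calc _ ≤ (∫⁻ x in frontier Ω, ‖ge x‖ₑ ∂(surf d)) ^ 2 := by
          gcongr; exact enorm_integral_le_lintegral_enorm _
      _ ≤ _ := by
          refine (lintegral_sq_le _ hgei.1.enorm).trans ?_
          rw [Measure.restrict_apply_univ]
  set X := ∫⁻ x in Metric.ball p r, ‖u x‖ₑ ^ 2
  set T := ∫⁻ x in (frontier Ω)ᶜ, ‖G x‖ₑ ^ 2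
  have e4 : ∫⁻ x in Ω, ‖G x‖ₑ ^ 2 ≤ T := lintegral_mono_set hsi
  have e5 : ∫⁻ x in (closure Ω)ᶜ, ‖G x‖ₑ ^ 2 ≤ T := lintegral_mono_set hse
  have hcover : Metric.ball 0 R₀ ⊆ (Ω ∪ ((closure Ω)ᶜ ∩ Metric.ball 0 R₀)) ∪ frontier Ω := by
    intro x hx
    by_cases h1 : x ∈ closure Ω
    · by_cases h2 : x ∈ Ω
      · exact Or.inl (Or.inl h2)
      · exact Or.inr (by rw [hΩ.isOpen.frontier_eq]; exact ⟨h1, h2⟩)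
    · exact Or.inl (Or.inr ⟨h1, hx⟩)
  have e6 : ∫⁻ x in Metric.ball 0 R₀, ‖u x‖ₑ ^ 2 ≤
      (∫⁻ x in Ω, ‖u x‖ₑ ^ 2) + ∫⁻ x in (closure Ω)ᶜ ∩ Metric.ball 0 R₀, ‖u x‖ₑ ^ 2 := by
    refine (lintegral_mono_set hcover).trans ((lintegral_union_le _ _ _).trans ?_)
    rw [setLIntegral_measure_zero _ _ hL.volume_frontier, add_zero]
    exact lintegral_union_le _ _ _
  set b1 := ∫⁻ x in (closure Ω)ᶜ ∩ Metric.ball 0 R₀, ‖u x‖ₑ ^ 2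
  set b2 := ∫⁻ x in frontier Ω, ‖ge x‖ₑ ^ 2 ∂(surf d)
  have e7 : b1 + b2 ≤ C₁ * (X + T) := e1.trans (by gcongr)
  calc _ ≤ C₂ * (T + σ * b2) + b1 := by
        refine e6.trans ?_
        gcongr
        exact e2.trans (by gcongr)
    _ = C₂ * T + (b1 + C₂ * σ * b2) := by ring
    _ ≤ C₂ * (X + T) + (1 + C₂ * σ) * (C₁ * (X + T)) := by
        gcongr
        · exact le_add_self
        · refine le_trans ?_ (mul_le_mul_right e7 _)
          rw [mul_add, add_mul, add_mul, one_mul]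
          exact add_le_add le_self_add le_add_self
    _ = _ := by
        push_cast
        rw [ENNReal.coe_toNNReal hσ.ne]
        ring

end

/-! ### Slicing weak derivatives on product domains. -/

section

section Slicing

variable {F₁ F₂ : Type*} [NormedAddCommGroup F₁] [NormedSpace ℝ F₁] [FiniteDimensional ℝ F₁]
  [MeasurableSpace F₁] [BorelSpace F₁] [NormedAddCommGroup F₂] [NormedSpace ℝ F₂]
  [FiniteDimensional ℝ F₂] [MeasurableSpace F₂] [BorelSpace F₂]

/-- An exhaustion of an open set by compact sets. -/
def compactPart {F : Type*} [NormedAddCommGroup F] (D : Set F) (j : ℕ) : Set F :=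
  Metric.closedBall 0 j \ Metric.thickening (1 / ((j : ℝ) + 1)) Dᶜ

theorem isCompact_compactPart {F : Type*} [NormedAddCommGroup F] [ProperSpace F] (D : Set F)
    (j : ℕ) : IsCompact (compactPart D j) :=
  (isCompact_closedBall _ _).diff Metric.isOpen_thickening

theorem compactPart_subset {F : Type*} [NormedAddCommGroup F] (D : Set F) (j : ℕ) :
    compactPart D j ⊆ D := fun _ hx => by
  by_contra h
  exact hx.2 (Metric.self_subset_thickening (by positivity) _ h)

theorem compactPart_mono {F : Type*} [NormedAddCommGroup F] (D : Set F) :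
    Monotone (compactPart D) := by
  intro i j hij
  have h : (i : ℝ) ≤ j := by exact_mod_cast hij
  exact sdiff_subset_sdiff (Metric.closedBall_subset_closedBall h)
    (Metric.thickening_mono (by gcongr) _)

theorem exists_subset_compactPart {F : Type*} [NormedAddCommGroup F] {D K : Set F}
    (hD : IsOpen D) (hK : IsCompact K) (hKD : K ⊆ D) : ∃ j, K ⊆ compactPart D j := by
  obtain ⟨δ, hδ, hdisj⟩ := (disjoint_compl_right_iff_subset.2 hKD).exists_thickenings hK
    hD.isClosed_compl
  obtain ⟨R, hR⟩ := hK.isBounded.subset_closedBall 0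
  obtain ⟨j, hj⟩ := exists_nat_ge (max R (1 / δ))
  refine ⟨j, fun x hx => ⟨?_, fun hx' => ?_⟩⟩
  · exact Metric.closedBall_subset_closedBall ((le_max_left _ _).trans hj) (hR hx)
  · refine disjoint_left.1 hdisj (Metric.self_subset_thickening hδ _ hx)
      (Metric.thickening_mono ?_ _ hx')
    rw [one_div_le (by positivity) hδ]
    linarith [le_max_right R (1 / δ)]

theorem iUnion_compactPart {F : Type*} [NormedAddCommGroup F] {D : Set F} (hD : IsOpen D) :
    ⋃ j, compactPart D j = D := by
  refine Subset.antisymm (iUnion_subset fun j => compactPart_subset D j) fun x hx => ?_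
  obtain ⟨j, hj⟩ := exists_subset_compactPart hD isCompact_singleton (singleton_subset_iff.2 hx)
  exact mem_iUnion.2 ⟨j, hj rfl⟩

theorem locallyIntegrableOn_of_compactPart {F V : Type*} [NormedAddCommGroup F] [ProperSpace F]
    [MeasurableSpace F] [BorelSpace F] [NormedAddCommGroup V] {μ : Measure F} {D : Set F}
    (hD : IsOpen D) {f : F → V} (h : ∀ j, IntegrableOn f (compactPart D j) μ) :
    LocallyIntegrableOn f D μ := by
  refine (locallyIntegrableOn_iff hD.isLocallyClosed).2 fun K hK hKc => ?_
  obtain ⟨j, hj⟩ := exists_subset_compactPart hD hKc hK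
  exact (h j).mono_set hj

variable {μ₁ : Measure F₁} {μ₂ : Measure F₂} {D₁ : Set F₁} {D₂ : Set F₂}

theorem ae_locallyIntegrableOn_slice {F₁ F₂ V : Type*} [NormedAddCommGroup F₁] [ProperSpace F₁]
    [MeasurableSpace F₁] [BorelSpace F₁] [NormedAddCommGroup F₂] [ProperSpace F₂]
    [MeasurableSpace F₂] [BorelSpace F₂] [NormedAddCommGroup V]
    {μ₁ : Measure F₁} {μ₂ : Measure F₂} [SigmaFinite μ₁] [SigmaFinite μ₂]
    {D₁ : Set F₁} {D₂ : Set F₂}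
    (h₁ : IsOpen D₁) (h₂ : IsOpen D₂) {f : F₁ × F₂ → V}
    (hf : LocallyIntegrableOn f (D₁ ×ˢ D₂) (μ₁.prod μ₂)) :
    ∀ᵐ y ∂μ₂, y ∈ D₂ → LocallyIntegrableOn (fun x => f (x, y)) D₁ μ₁ := by
  have h : ∀ i j, ∀ᵐ y ∂μ₂, y ∈ compactPart D₂ i →
      IntegrableOn (fun x => f (x, y)) (compactPart D₁ j) μ₁ := by
    intro i j
    have hK := isCompact_compactPart D₁ j
    have hL := isCompact_compactPart D₂ i
    have h1 := hf.integrableOn_compact_subset (prod_mono (compactPart_subset D₁ j)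
      (compactPart_subset D₂ i)) (hK.prod hL)
    rw [IntegrableOn, ← Measure.prod_restrict] at h1
    exact (ae_restrict_iff' hL.measurableSet).1 h1.prod_left_ae
  filter_upwards [ae_all_iff.2 fun i => ae_all_iff.2 (h i)] with y hy hyD
  rw [← iUnion_compactPart h₂] at hyD
  obtain ⟨i, hi⟩ := mem_iUnion.1 hyD
  exact locallyIntegrableOn_of_compactPart h₁ fun j => hy i j hi

/-- Dominated convergence: maps close to `f₀` in the compact-open topology are uniformly bounded on
`K`. This continuity extends an identity from countably many test functions to all of them. -/
theorem continuous_integral_pairing {K : Set F₁} (hK : IsCompact K) {u g : F₁ → ℝ}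
    (hu : IntegrableOn u K μ₁) (hg : IntegrableOn g K μ₁) (v : F₁) :
    Continuous fun f : C(F₁, ℝ × (F₁ →L[ℝ] ℝ)) =>
      ∫ x in K, (u x * (f x).2 v + g x * (f x).1) ∂μ₁ := by
  rw [continuous_iff_continuousAt]
  intro f₀
  obtain ⟨M, hM⟩ := (hK.image f₀.continuous).isBounded.subset_ball 0
  have hev : ∀ᶠ f : C(F₁, ℝ × (F₁ →L[ℝ] ℝ)) in 𝓝 f₀, MapsTo f K (Metric.ball 0 M) :=
    (ContinuousMap.isOpen_setOfPred_mapsTo hK Metric.isOpen_ball).mem_nhds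
      (mapsTo_iff_image_subset.2 hM)
  refine continuousAt_of_dominated (bound := fun x => |u x| * (M * ‖v‖) + |g x| * M) ?_ ?_ ?_ ?_
  · refine Eventually.of_forall fun f => ?_
    have c1 : Continuous fun x => (f x).2 v := by fun_prop
    have c2 : Continuous fun x => (f x).1 := by fun_prop
    exact (hu.1.mul c1.aestronglyMeasurable).add (hg.1.mul c2.aestronglyMeasurable)
  · filter_upwards [hev] with f hf
    rw [ae_restrict_iff' hK.measurableSet]
    refine ae_of_all _ fun x hx => ?_
    have h1 := mem_ball_zero_iff.1 (hf hx)
    have h2 : ‖(f x).2 v‖ ≤ M * ‖v‖ := ((f x).2.le_opNorm v).trans (by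
      gcongr; exact (norm_snd_le _).trans h1.le)
    have h3 : ‖(f x).1‖ ≤ M := (norm_fst_le _).trans h1.le
    refine (norm_add_le _ _).trans ?_
    rw [norm_mul, norm_mul]
    exact add_le_add (mul_le_mul_of_nonneg_left h2 (norm_nonneg _))
      (mul_le_mul_of_nonneg_left h3 (norm_nonneg _))
  · exact (hu.abs.mul_const _).add (hg.abs.mul_const _)
  · refine ae_of_all _ fun x => Continuous.continuousAt ?_
    have he : Continuous fun f : C(F₁, ℝ × (F₁ →L[ℝ] ℝ)) => f x := continuous_eval_const x
    exact (continuous_const.mul ((continuous_snd.comp he).clm_apply continuous_const)).add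
      (continuous_const.mul (continuous_fst.comp he))

variable [SigmaFinite μ₁] [SigmaFinite μ₂]

/-- A partial weak derivative on a product is a weak derivative on almost every slice. -/
theorem ae_slice_weak_deriv (h₁ : IsOpen D₁) (h₂ : IsOpen D₂) {u g : F₁ × F₂ → ℝ} (v : F₁)
    (hu : LocallyIntegrableOn u (D₁ ×ˢ D₂) (μ₁.prod μ₂))
    (hg : LocallyIntegrableOn g (D₁ ×ˢ D₂) (μ₁.prod μ₂))
    (h : ∀ φ : F₁ → ℝ, ContDiff ℝ ∞ φ → HasCompactSupport φ → tsupport φ ⊆ D₁ →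
      ∀ ψ : F₂ → ℝ, ContDiff ℝ ∞ ψ → HasCompactSupport ψ → tsupport ψ ⊆ D₂ →
        ∫ z, (u z * fderiv ℝ φ z.1 v + g z * φ z.1) * ψ z.2 ∂(μ₁.prod μ₂) = 0) :
    ∀ᵐ y ∂μ₂, y ∈ D₂ → ∀ φ : F₁ → ℝ, ContDiff ℝ ∞ φ → HasCompactSupport φ → tsupport φ ⊆ D₁ →
      ∫ x, (u (x, y) * fderiv ℝ φ x v + g (x, y) * φ x) ∂μ₁ = 0 := by
  -- For a single `φ`, the pairing with the slice is a locally integrable function of `y` that is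
  -- orthogonal to all test functions `ψ`, hence zero almost everywhere. The exceptional null set
  -- still depends on `φ`.
  have hfix : ∀ φ : F₁ → ℝ, ContDiff ℝ ∞ φ → HasCompactSupport φ → tsupport φ ⊆ D₁ →
      ∀ᵐ y ∂μ₂, y ∈ D₂ → ∫ x, (u (x, y) * fderiv ℝ φ x v + g (x, y) * φ x) ∂μ₁ = 0 := by
    intro φ hφ hc hs
    have hK : IsCompact (tsupport φ) := hc
    have hφ' : Continuous fun x => fderiv ℝ φ x v :=
      (hφ.continuous_fderiv (by simp)).clm_apply continuous_const
    set w : F₁ × F₂ → ℝ := fun z => u z * fderiv ℝ φ z.1 v + g z * φ z.1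
    have hw0 : ∀ x y, x ∉ tsupport φ → w (x, y) = 0 := by
      intro x y hx
      simp [w, image_eq_zero_of_notMem_tsupport hx, fderiv_of_notMem_tsupport ℝ hx]
    have hwi : ∀ L ⊆ D₂, IsCompact L → Integrable w (μ₁.prod (μ₂.restrict L)) := by
      intro L hL hLc
      have hKL := hK.prod hLc
      have i1 : IntegrableOn w (tsupport φ ×ˢ L) (μ₁.prod μ₂) :=
        ((hu.integrableOn_compact_subset (prod_mono hs hL) hKL).mul_continuousOn
          (hφ'.comp continuous_fst).continuousOn hKL).add
        ((hg.integrableOn_compact_subset (prod_mono hs hL) hKL).mul_continuousOn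
          (hφ.continuous.comp continuous_fst).continuousOn hKL)
      have i2 : IntegrableOn w (tsupport φ ×ˢ univ) (μ₁.prod (μ₂.restrict L)) := by
        rw [IntegrableOn, ← Measure.prod_restrict, Measure.restrict_univ, Measure.prod_restrict]
        exact i1
      refine (integrableOn_iff_integrable_of_support_subset ?_).1 i2
      rintro ⟨x, y⟩ hxy
      refine ⟨?_, trivial⟩
      by_contra hx
      exact hxy (hw0 x y hx)
    have hloc : LocallyIntegrableOn (fun y => ∫ x, w (x, y) ∂μ₁) D₂ μ₂ :=
      (locallyIntegrableOn_iff h₂.isLocallyClosed).2 fun L hL hLc =>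
        (hwi L hL hLc).integral_prod_right
    refine h₂.ae_eq_zero_of_integral_contDiff_smul_eq_zero hloc fun ψ hψ hψc hψs => ?_
    have hLc : IsCompact (tsupport ψ) := hψc
    have hwψ : Integrable (fun z => w z * ψ z.2) (μ₁.prod μ₂) := by
      have i1 : IntegrableOn (fun z => w z * ψ z.2) (univ ×ˢ tsupport ψ) (μ₁.prod μ₂) := by
        rw [IntegrableOn, ← Measure.prod_restrict, Measure.restrict_univ]
        obtain ⟨M, hM⟩ := hψc.exists_bound_of_continuous hψ.continuous
        refine (hwi _ hψs hLc).mul_bdd (c := M) ?_ (ae_of_all _ fun z => hM z.2)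
        exact (hψ.continuous.comp continuous_snd).aestronglyMeasurable
      refine (integrableOn_iff_integrable_of_support_subset ?_).1 i1
      rintro ⟨x, y⟩ hxy
      refine ⟨trivial, ?_⟩
      by_contra hy
      exact hxy (by simp [image_eq_zero_of_notMem_tsupport hy])
    have := h φ hφ hc hs ψ hψ hψc hψs
    rw [integral_prod_symm _ hwψ] at this
    rw [← this]
    refine integral_congr_ae (ae_of_all _ fun y => ?_)
    simp only [smul_eq_mul]
    rw [integral_mul_const, mul_comm]
  -- Test functions supported in a fixed compact set, recorded together with their derivatives.
  -- Their space is second countable, so a countable dense subset gives one null set for all of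
  -- them.
  let A : ℕ → Set C(F₁, ℝ × (F₁ →L[ℝ] ℝ)) := fun j =>
    {f | ∃ φ : F₁ → ℝ, ContDiff ℝ ∞ φ ∧ HasCompactSupport φ ∧ tsupport φ ⊆ compactPart D₁ j ∧
      ∀ x, f x = (φ x, fderiv ℝ φ x)}
  have hdense : ∀ j, ∃ c ⊆ A j, c.Countable ∧ A j ⊆ closure c := by
    intro j
    obtain ⟨t, ht, htd⟩ := TopologicalSpace.exists_countable_dense (A j)
    exact ⟨Subtype.val '' t, by simp, ht.image _, Subtype.dense_iff.1 htd⟩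
  choose c hcA hcc hcd using hdense
  have hpair : ∀ j, ∀ f ∈ A j, ∀ᵐ y ∂μ₂, y ∈ D₂ →
      ∫ x in compactPart D₁ j, (u (x, y) * (f x).2 v + g (x, y) * (f x).1) ∂μ₁ = 0 := by
    rintro j f ⟨φ, hφ, hφc, hφs, hf⟩
    filter_upwards [hfix φ hφ hφc (hφs.trans (compactPart_subset D₁ j))] with y hy hyD
    rw [← hy hyD]
    simp only [hf]
    refine setIntegral_eq_integral_of_forall_compl_eq_zero fun x hx => ?_
    have hx' := fun h => hx (hφs h)
    simp [image_eq_zero_of_notMem_tsupport hx', fderiv_of_notMem_tsupport ℝ hx']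
  have hall : ∀ᵐ y ∂μ₂, ∀ j, ∀ f ∈ c j, y ∈ D₂ →
      ∫ x in compactPart D₁ j, (u (x, y) * (f x).2 v + g (x, y) * (f x).1) ∂μ₁ = 0 :=
    ae_all_iff.2 fun j => (ae_ball_iff (hcc j)).2 fun f hf => hpair j f (hcA j hf)
  filter_upwards [hall, ae_locallyIntegrableOn_slice h₁ h₂ hu,
    ae_locallyIntegrableOn_slice h₁ h₂ hg] with y hy hyu hyg hyD φ hφ hφc hφs
  obtain ⟨j, hj⟩ := exists_subset_compactPart h₁ hφc hφs
  have hK := isCompact_compactPart D₁ j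
  have hcont := continuous_integral_pairing hK
    ((hyu hyD).integrableOn_compact_subset (compactPart_subset D₁ j) hK)
    ((hyg hyD).integrableOn_compact_subset (compactPart_subset D₁ j) hK) v
  have hclosed := closure_minimal (s := c j) (fun f hf => hy j f hf hyD)
    (isClosed_eq hcont continuous_const)
  have hcd' : Continuous fun x => (φ x, fderiv ℝ φ x) :=
    hφ.continuous.prodMk (hφ.continuous_fderiv (by simp))
  have hmem : (⟨_, hcd'⟩ : C(F₁, ℝ × (F₁ →L[ℝ] ℝ))) ∈ A j := ⟨φ, hφ, hφc, hj, fun x => rfl⟩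
  have := hclosed (hcd j hmem)
  rw [← setIntegral_eq_integral_of_forall_compl_eq_zero (s := compactPart D₁ j)]
  · exact this
  · intro x hx
    have hx' := fun h => hx (hj h)
    simp [image_eq_zero_of_notMem_tsupport hx', fderiv_of_notMem_tsupport ℝ hx']

end Slicing

end

/-! ### Primitives on the half line, and slices in the horizontal and vertical directions. -/

section

section OneDim

/-- The bounds on `a` and `b` keep the base point 1 of the primitives inside the interval. -/
theorem exists_Ioo_of_isCompact {K : Set ℝ} (hK : IsCompact K) (h : K ⊆ Ioi 0) :
    ∃ a b : ℝ, 0 < a ∧ a < 1 / 2 ∧ 2 < b ∧ K ⊆ Ioo a b := by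
  rcases K.eq_empty_or_nonempty with rfl | hne
  · exact ⟨1 / 4, 3, by norm_num, by norm_num, by norm_num, empty_subset _⟩
  obtain ⟨m, hm, hm'⟩ := hK.exists_isLeast hne
  obtain ⟨M, hM, hM'⟩ := hK.exists_isGreatest hne
  have hm0 : 0 < m := h hm
  refine ⟨min (m / 2) (1 / 4), max (M + 1) 3, by positivity,
    (min_le_right _ _).trans_lt (by norm_num), lt_max_of_lt_right (by norm_num), fun x hx => ?_⟩
  exact ⟨(min_le_left _ _).trans_lt (by linarith [hm' hx]),
    lt_max_of_lt_left (by linarith [hM' hx])⟩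

theorem intervalIntegrable_of_Ioi {g : ℝ → ℝ} (hg : LocallyIntegrableOn g (Ioi 0)) {a b : ℝ}
    (ha : 0 < a) (hb : 0 < b) : IntervalIntegrable g volume a b := by
  have : uIcc a b ⊆ Ioi 0 := fun x hx => lt_of_lt_of_le (lt_min ha hb) hx.1
  exact (hg.integrableOn_compact_subset this isCompact_uIcc).intervalIntegrable

theorem absolutelyContinuous_primitive {g : ℝ → ℝ} (hg : LocallyIntegrableOn g (Ioi 0))
    {a b : ℝ} (ha : 0 < a) (ha1 : a ≤ 1) (hb : 1 ≤ b) :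
    AbsolutelyContinuousOnInterval (fun t => ∫ s in (1 : ℝ)..t, g s) a b :=
  (intervalIntegrable_of_Ioi hg ha (zero_lt_one.trans_le hb)).absolutelyContinuousOnInterval_intervalIntegral
    (by rw [uIcc_of_le (ha1.trans hb)]; exact ⟨ha1, hb⟩)

theorem ae_deriv_primitive {g : ℝ → ℝ} (hg : LocallyIntegrableOn g (Ioi 0))
    {a b : ℝ} (ha : 0 < a) (ha1 : a ≤ 1) (hb : 1 ≤ b) :
    ∀ᵐ t, t ∈ Icc a b → deriv (fun t => ∫ s in (1 : ℝ)..t, g s) t = g t := by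
  have h := (intervalIntegrable_of_Ioi hg ha (zero_lt_one.trans_le hb)).ae_hasDerivAt_integral
  rw [uIcc_of_le (ha1.trans hb)] at h
  filter_upwards [h] with t ht htm
  exact (ht htm 1 ⟨ha1, hb⟩).deriv

/-- A function on the half line with a locally integrable weak derivative is a primitive. -/
theorem ae_eq_primitive_of_weak_deriv {f g : ℝ → ℝ} (hf : LocallyIntegrableOn f (Ioi 0))
    (hg : LocallyIntegrableOn g (Ioi 0))
    (h : ∀ ψ : ℝ → ℝ, ContDiff ℝ ∞ ψ → HasCompactSupport ψ → tsupport ψ ⊆ Ioi 0 →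
      ∫ t, (f t * fderiv ℝ ψ t 1 + g t * ψ t) = 0) :
    ∃ c : ℝ, ∀ᵐ t, t ∈ Ioi (0 : ℝ) → f t = c + ∫ s in (1 : ℝ)..t, g s := by
  set P : ℝ → ℝ := fun t => ∫ s in (1 : ℝ)..t, g s with hP
  have hPloc : LocallyIntegrableOn P (Ioi 0) := by
    refine (locallyIntegrableOn_iff isOpen_Ioi.isLocallyClosed).2 fun K hK hKc => ?_
    obtain ⟨a, b, ha, ha', hb, hKab⟩ := exists_Ioo_of_isCompact hKc hK
    have hc := (absolutelyContinuous_primitive hg ha (by linarith)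
      (by linarith : (1 : ℝ) ≤ b)).continuousOn
    rw [uIcc_of_le (by linarith)] at hc
    exact (hc.integrableOn_compact isCompact_Icc).mono_set (hKab.trans Ioo_subset_Icc_self)
  set w : ℝ → ℝ := fun t => f t - P t with hw
  have hwloc : LocallyIntegrableOn w (Ioi 0) := hf.sub hPloc
  -- The difference `w` of `f` and the primitive of `g` has zero weak derivative, by integration by
  -- parts for absolutely continuous functions.
  have hder : ∀ ψ : ℝ → ℝ, ContDiff ℝ ∞ ψ → HasCompactSupport ψ → tsupport ψ ⊆ Ioi 0 →
      ∫ t, w t * deriv ψ t = 0 := by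
    intro ψ hψ hc hs
    obtain ⟨a, b, ha, ha', hb, hKab⟩ := exists_Ioo_of_isCompact hc hs
    have hdc : HasCompactSupport (deriv ψ) := hc.deriv
    have hds : tsupport (deriv ψ) ⊆ tsupport ψ := closure_minimal
      (support_deriv_subset) (isClosed_tsupport ψ)
    have hdcont : Continuous (deriv ψ) := hψ.continuous_deriv (by simp)
    have hab : a ≤ b := by linarith
    have hsub : tsupport ψ ⊆ Ioc a b := hKab.trans Ioo_subset_Ioc_self
    have i1 := integrable_mul_of_hasCompactSupport hf hdcont hdc (hds.trans hs)
    have i2 := integrable_mul_of_hasCompactSupport hPloc hdcont hdc (hds.trans hs)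
    have i3 := integrable_mul_of_hasCompactSupport hg hψ.continuous hc hs
    have e1 : ∫ t, P t * deriv ψ t = -∫ t, g t * ψ t := by
      have hac := (absolutelyContinuous_primitive hg ha (by linarith)
        (by linarith : (1 : ℝ) ≤ b)).integral_mul_deriv_eq_deriv_mul
        (ContDiffOn.absolutelyContinuousOnInterval (f := ψ) (a := a) (b := b)
          (hψ.of_le (by norm_cast)).contDiffOn)
      have hψa : ψ a = 0 := image_eq_zero_of_notMem_tsupport fun h => lt_irrefl _ (hKab h).1
      have hψb : ψ b = 0 := image_eq_zero_of_notMem_tsupport fun h => lt_irrefl _ (hKab h).2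
      rw [hψa, hψb, mul_zero, mul_zero, sub_zero, zero_sub,
        intervalIntegral.integral_eq_integral_of_support_subset
          ((Function.support_mul_subset_right _ _).trans
            (((subset_tsupport _).trans hds).trans hsub))] at hac
      rw [hac]
      congr 1
      rw [← intervalIntegral.integral_eq_integral_of_support_subset (f := fun t => g t * ψ t)
          ((Function.support_mul_subset_right g ψ).trans ((subset_tsupport _).trans hsub))]
      refine intervalIntegral.integral_congr_ae ?_
      filter_upwards [ae_deriv_primitive hg ha (by linarith) (by linarith : (1 : ℝ) ≤ b)]
        with t ht htm
      rw [uIoc_of_le hab] at htm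
      rw [ht (Ioc_subset_Icc_self htm)]
    have e2 := h ψ hψ hc hs
    simp only [fderiv_apply_one_eq_deriv] at e2
    rw [integral_add i1 i3] at e2
    calc ∫ t, w t * deriv ψ t = ∫ t, (f t * deriv ψ t - P t * deriv ψ t) := by
          refine integral_congr_ae (ae_of_all _ fun t => ?_)
          simp only [hw]; ring
      _ = 0 := by rw [integral_sub i1 i2, e1]; linarith
  -- A fixed bump of unit integral inside the half line; the constant sought is the pairing of `w`
  -- with it.
  let β : ContDiffBump (1 : ℝ) := ⟨1 / 4, 1 / 2, by norm_num, by norm_num⟩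
  set b₀ : ℝ → ℝ := β.normed volume
  have hb₀ : ContDiff ℝ ∞ b₀ := β.contDiff_normed
  have hb₀s : tsupport b₀ ⊆ Ioi 0 := by
    rw [β.tsupport_normed_eq]
    intro x hx
    rw [Metric.mem_closedBall, Real.dist_eq] at hx
    have := (abs_le.1 hx).1
    simp only [β] at this
    rw [mem_Ioi]
    linarith
  have hb₀c : HasCompactSupport b₀ := β.hasCompactSupport_normed
  have hb₀i : ∫ t, b₀ t = 1 := β.integral_normed
  set c := ∫ t, w t * b₀ t
  refine ⟨c, ?_⟩
  have hz := isOpen_Ioi.ae_eq_zero_of_integral_contDiff_smul_eq_zero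
    (hwloc.sub (locallyIntegrableOn_const (s := Ioi (0 : ℝ)) c)) ?_
  · filter_upwards [hz] with t ht htm
    have : f t - (∫ s in (1 : ℝ)..t, g s) - c = 0 := ht htm
    linarith
  · intro η hη hηc hηs
    -- Subtracting a multiple of the bump makes the integral zero, so `χ` is the derivative of a
    -- compactly supported test function and `w` is orthogonal to it.
    set χ : ℝ → ℝ := fun t => η t - (∫ s, η s) * b₀ t
    have hχ : ContDiff ℝ ∞ χ := hη.sub (contDiff_const.mul hb₀)
    obtain ⟨a, b, ha, ha', hb, hKab⟩ := exists_Ioo_of_isCompact (hηc.union hb₀c)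
      (union_subset hηs hb₀s)
    have hχ0 : ∀ t, t ∉ Ioo a b → χ t = 0 := by
      intro t ht
      have h1 : η t = 0 := image_eq_zero_of_notMem_tsupport fun h => ht (hKab (Or.inl h))
      have h2 : b₀ t = 0 := image_eq_zero_of_notMem_tsupport fun h => ht (hKab (Or.inr h))
      simp [χ, h1, h2]
    have hηi : Integrable η := hη.continuous.integrable_of_hasCompactSupport hηc
    have hb₀int : Integrable b₀ := hb₀.continuous.integrable_of_hasCompactSupport hb₀c
    have hχi : ∫ t, χ t = 0 := by
      simp only [χ]
      rw [integral_sub hηi (hb₀int.const_mul _), integral_const_mul, hb₀i]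
      ring
    have hab : a ≤ b := by linarith
    have hiab : ∫ t in a..b, χ t = 0 := by
      rw [intervalIntegral.integral_eq_integral_of_support_subset, hχi]
      intro t ht
      by_contra h'
      exact ht (hχ0 t fun h => h' (Ioo_subset_Ioc_self h))
    set ψ : ℝ → ℝ := fun t => ∫ s in a..t, χ s
    have hψd : deriv ψ = χ := by
      ext t
      exact Continuous.deriv_integral χ hχ.continuous a t
    have hψ : ContDiff ℝ ∞ ψ := by
      rw [contDiff_infty_iff_deriv, hψd]
      refine ⟨fun t => ?_, hχ⟩
      exact (intervalIntegral.integral_hasDerivAt_right (hχ.continuous.intervalIntegrable _ _)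
        (hχ.continuous.stronglyMeasurableAtFilter _ _) hχ.continuous.continuousAt).differentiableAt
    have hψ0 : ∀ t, t ∉ Icc a b → ψ t = 0 := by
      intro t ht
      rcases lt_or_ge t a with hta | hta
      · refine intervalIntegral.integral_zero_ae (ae_of_all _ fun s hs => hχ0 s fun h => ?_)
        rw [uIoc_of_ge hta.le] at hs
        exact absurd h.1 (not_lt.2 hs.2)
      · have htb : b < t := by
          by_contra! hcon
          exact ht ⟨hta, hcon⟩
        simp only [ψ]
        rw [← intervalIntegral.integral_add_adjacent_intervals
          (hχ.continuous.intervalIntegrable a b) (hχ.continuous.intervalIntegrable b t), hiab,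
          zero_add]
        refine intervalIntegral.integral_zero_ae (ae_of_all _ fun s hs => hχ0 s fun h => ?_)
        rw [uIoc_of_le htb.le] at hs
        exact absurd h.2 (not_lt.2 hs.1.le)
    have hψs : tsupport ψ ⊆ Icc a b := closure_minimal
      (fun t ht => by by_contra h'; exact ht (hψ0 t h')) isClosed_Icc
    have hψc : HasCompactSupport ψ := HasCompactSupport.intro isCompact_Icc hψ0
    have e := hder ψ hψ hψc (hψs.trans fun t ht => ha.trans_le ht.1)
    rw [hψd] at e
    have i1 := integrable_mul_of_hasCompactSupport hwloc hη.continuous hηc hηs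
    have i2 := integrable_mul_of_hasCompactSupport hwloc hb₀.continuous hb₀c hb₀s
    have e2 : ∫ t, w t * η t = (∫ s, η s) * c := by
      have : ∫ t, w t * χ t = (∫ t, w t * η t) - (∫ s, η s) * c := by
        rw [← integral_const_mul, ← integral_sub i1 (i2.const_mul _)]
        refine integral_congr_ae (ae_of_all _ fun t => ?_)
        simp only [χ]; ring
      linarith
    calc _ = ∫ t, (w t * η t - c * η t) := by
          refine integral_congr_ae (ae_of_all _ fun t => ?_)
          simp only [Pi.sub_apply, smul_eq_mul]; ring
      _ = 0 := by
          rw [integral_sub i1 (hηi.const_mul c), e2, integral_const_mul]; ring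

end OneDim

variable {d : ℕ}

theorem locallyIntegrableOn_comp_swap {F₁ F₂ V : Type*} [NormedAddCommGroup F₁] [ProperSpace F₁]
    [MeasurableSpace F₁] [BorelSpace F₁] [NormedAddCommGroup F₂] [ProperSpace F₂]
    [MeasurableSpace F₂] [BorelSpace F₂] [NormedAddCommGroup V]
    {μ₁ : Measure F₁} {μ₂ : Measure F₂} [SigmaFinite μ₁] [SigmaFinite μ₂]
    {D₁ : Set F₁} {D₂ : Set F₂} (h₁ : IsOpen D₁) (h₂ : IsOpen D₂) {f : F₁ × F₂ → V}
    (hf : LocallyIntegrableOn f (D₁ ×ˢ D₂) (μ₁.prod μ₂)) :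
    LocallyIntegrableOn (fun z => f z.swap) (D₂ ×ˢ D₁) (μ₂.prod μ₁) := by
  refine (locallyIntegrableOn_iff (h₂.prod h₁).isLocallyClosed).2 fun K hK hKc => ?_
  have hK' : IsCompact (Prod.swap '' K) := hKc.image continuous_swap
  have h1 : IntegrableOn f (Prod.swap '' K) (μ₁.prod μ₂) := by
    refine hf.integrableOn_compact_subset ?_ hK'
    rintro _ ⟨z, hz, rfl⟩
    exact ⟨(hK hz).2, (hK hz).1⟩
  have := (Measure.measurePreserving_swap (μ := μ₂) (ν := μ₁)).integrableOn_comp_preimage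
    MeasurableEquiv.prodComm.measurableEmbedding (f := f) (s := Prod.swap '' K)
  rw [preimage_image_eq _ Prod.swap_injective] at this
  exact this.2 h1

/-- Testing a weak derivative on a product domain with a product of test functions. -/
theorem integral_weak_deriv_prod {D₁ : Set (E d)} {D₂ : Set ℝ} {U : E d × ℝ → ℝ}
    {G : E d × ℝ → E d × ℝ →L[ℝ] ℝ} (h : HasWeakDeriv (D₁ ×ˢ D₂) U G) {φ : E d → ℝ}
    (hφ : ContDiff ℝ ∞ φ) (hφc : HasCompactSupport φ) (hφs : tsupport φ ⊆ D₁) {ψ : ℝ → ℝ}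
    (hψ : ContDiff ℝ ∞ ψ) (hψc : HasCompactSupport ψ) (hψs : tsupport ψ ⊆ D₂) (v : E d × ℝ) :
    ∫ z : E d × ℝ, (U z * (fderiv ℝ φ z.1 v.1 * ψ z.2 + φ z.1 * fderiv ℝ ψ z.2 v.2) +
      G z v * (φ z.1 * ψ z.2)) = 0 := by
  set η : E d × ℝ → ℝ := fun z => φ z.1 * ψ z.2
  have hη : ContDiff ℝ ∞ η := (hφ.comp contDiff_fst).mul (hψ.comp contDiff_snd)
  have hK : IsCompact (tsupport φ ×ˢ tsupport ψ) := IsCompact.prod hφc hψc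
  have hη0 : ∀ z, z ∉ tsupport φ ×ˢ tsupport ψ → η z = 0 := by
    intro z hz
    by_cases h1 : z.1 ∈ tsupport φ
    · have h2 : z.2 ∉ tsupport ψ := fun h2 => hz ⟨h1, h2⟩
      simp [η, image_eq_zero_of_notMem_tsupport h2]
    · simp [η, image_eq_zero_of_notMem_tsupport h1]
  have hηc : HasCompactSupport η := HasCompactSupport.intro hK hη0
  have hηs : tsupport η ⊆ D₁ ×ˢ D₂ := (closure_minimal
    (fun z hz => by by_contra h'; exact hz (hη0 z h')) hK.isClosed).trans (prod_mono hφs hψs)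
  have hd : ∀ z, fderiv ℝ η z v = fderiv ℝ φ z.1 v.1 * ψ z.2 + φ z.1 * fderiv ℝ ψ z.2 v.2 := by
    intro z
    have h1 : HasFDerivAt (fun z : E d × ℝ => φ z.1) ((fderiv ℝ φ z.1).comp
        (ContinuousLinearMap.fst ℝ (E d) ℝ)) z :=
      (hφ.differentiable (by simp) z.1).hasFDerivAt.comp z hasFDerivAt_fst
    have h2 : HasFDerivAt (fun z : E d × ℝ => ψ z.2) ((fderiv ℝ ψ z.2).comp
        (ContinuousLinearMap.snd ℝ (E d) ℝ)) z :=
      (hψ.differentiable (by simp) z.2).hasFDerivAt.comp z hasFDerivAt_snd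
    have h3 : fderiv ℝ η z = _ := (h1.mul h2).fderiv
    rw [h3]
    simp only [add_apply, smul_apply,
      ContinuousLinearMap.comp_apply, ContinuousLinearMap.coe_fst', ContinuousLinearMap.coe_snd',
      smul_eq_mul]
    ring
  have e := h.2.2 η hη hηc hηs v
  rw [setIntegral_mul_eq_of_tsupport_subset _ ((tsupport_fderiv_apply_subset' v).trans hηs),
    setIntegral_mul_eq_of_tsupport_subset (fun z => G z v) hηs] at e
  have i1 := integrable_mul_of_hasCompactSupport h.1
    ((hη.continuous_fderiv (by simp)).clm_apply (continuous_const (y := v)))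
    (hηc.fderiv_apply ℝ v) ((tsupport_fderiv_apply_subset' v).trans hηs)
  have i2 := integrable_mul_of_hasCompactSupport (LocallyIntegrableOn.apply_clm h.2.1 v)
    hη.continuous hηc hηs
  simp only [← hd]
  rw [integral_add i1 i2, e]
  ring

/-- Slicing is done for the finitely many vectors of a basis and extended to all directions by
linearity, so that a single null set of `y` suffices. -/
theorem HasWeakDeriv.ae_slice_fst {D₁ : Set (E d)} {D₂ : Set ℝ} (h₁ : IsOpen D₁)
    (h₂ : IsOpen D₂) {U : E d × ℝ → ℝ} {G : E d × ℝ → E d × ℝ →L[ℝ] ℝ}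
    (h : HasWeakDeriv (D₁ ×ˢ D₂) U G) :
    ∀ᵐ y, y ∈ D₂ → HasWeakDeriv D₁ (fun x => U (x, y))
      fun x => (G (x, y)).comp (ContinuousLinearMap.inl ℝ (E d) ℝ) := by
  have hb : ∀ i, ∀ᵐ y, y ∈ D₂ → ∀ φ : E d → ℝ, ContDiff ℝ ∞ φ → HasCompactSupport φ →
      tsupport φ ⊆ D₁ → ∫ x, (U (x, y) * fderiv ℝ φ x (Module.finBasis ℝ (E d) i) +
        G (x, y) (Module.finBasis ℝ (E d) i, 0) * φ x) = 0 := by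
    intro i
    refine ae_slice_weak_deriv h₁ h₂ (g := fun z => G z (Module.finBasis ℝ (E d) i, 0))
      _ h.1 (LocallyIntegrableOn.apply_clm h.2.1 _) ?_
    intro φ hφ hφc hφs ψ hψ hψc hψs
    refine Eq.trans ?_
      (integral_weak_deriv_prod h hφ hφc hφs hψ hψc hψs (Module.finBasis ℝ (E d) i, 0))
    refine integral_congr_ae (ae_of_all _ fun z => ?_)
    simp only [map_zero]
    ring
  filter_upwards [ae_all_iff.2 hb, ae_locallyIntegrableOn_slice h₁ h₂ h.1,
    ae_locallyIntegrableOn_slice h₁ h₂ h.2.1] with y hy hU hG hyD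
  have hGl : LocallyIntegrableOn (fun x => (G (x, y)).comp (ContinuousLinearMap.inl ℝ (E d) ℝ)) D₁ := by
    intro x hx
    obtain ⟨s, hs, hi⟩ := hG hyD x hx
    exact ⟨s, hs, ((ContinuousLinearMap.compL ℝ (E d) (E d × ℝ) ℝ).flip
      (ContinuousLinearMap.inl ℝ (E d) ℝ)).integrable_comp hi⟩
  refine ⟨hU hyD, hGl, fun φ hφ hφc hφs v => ?_⟩
  rw [setIntegral_mul_eq_of_tsupport_subset _ ((tsupport_fderiv_apply_subset' v).trans hφs),
    setIntegral_mul_eq_of_tsupport_subset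
      (fun x => (G (x, y)).comp (ContinuousLinearMap.inl ℝ (E d) ℝ) v) hφs]
  have i1 : ∀ v, Integrable fun x => U (x, y) * fderiv ℝ φ x v := fun v =>
    integrable_mul_of_hasCompactSupport (hU hyD)
      ((hφ.continuous_fderiv (by simp)).clm_apply (continuous_const (y := v)))
      (hφc.fderiv_apply ℝ v) ((tsupport_fderiv_apply_subset' v).trans hφs)
  have i2 : ∀ v : E d, Integrable fun x => G (x, y) (v, 0) * φ x := fun v => by
    have := integrable_mul_of_hasCompactSupport (LocallyIntegrableOn.apply_clm (hG hyD) (v, 0))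
      hφ.continuous hφc hφs
    exact this
  let T : E d →ₗ[ℝ] ℝ :=
    { toFun := fun v => ∫ x, (U (x, y) * fderiv ℝ φ x v + G (x, y) (v, 0) * φ x)
      map_add' := fun v w => by
        refine Eq.trans ?_ (integral_add ((i1 v).add (i2 v)) ((i1 w).add (i2 w)))
        refine integral_congr_ae (ae_of_all _ fun x => ?_)
        have : ((v + w, 0) : E d × ℝ) = (v, 0) + (w, 0) := by simp
        simp only [map_add, this]
        ring
      map_smul' := fun c v => by
        rw [RingHom.id_apply, smul_eq_mul, ← integral_const_mul]
        refine integral_congr_ae (ae_of_all _ fun x => ?_)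
        have : ((c • v, 0) : E d × ℝ) = c • (v, 0) := by simp
        simp only [map_smul, this, smul_eq_mul]
        ring }
  have hT : T = 0 := (Module.finBasis ℝ (E d)).ext fun i => hy i hyD φ hφ hφc hφs
  have hTv : ∫ x, (U (x, y) * fderiv ℝ φ x v + G (x, y) (v, 0) * φ x) = 0 :=
    congrArg (fun L : E d →ₗ[ℝ] ℝ => L v) hT
  rw [integral_add (i1 v) (i2 v)] at hTv
  exact eq_neg_of_add_eq_zero_left hTv

/-- The coordinates are exchanged to reuse the slicing result; the one-dimensional theorem then
turns the weak derivative on almost every vertical line into a primitive. -/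
theorem HasWeakDeriv.ae_slice_snd {D₁ : Set (E d)} (h₁ : IsOpen D₁) {U : E d × ℝ → ℝ}
    {G : E d × ℝ → E d × ℝ →L[ℝ] ℝ} (h : HasWeakDeriv (D₁ ×ˢ Ioi 0) U G) :
    ∀ᵐ x, x ∈ D₁ → LocallyIntegrableOn (fun t => G (x, t) (0, 1)) (Ioi 0) ∧
      ∃ c : ℝ, ∀ᵐ t, t ∈ Ioi (0 : ℝ) → U (x, t) = c + ∫ s in (1 : ℝ)..t, G (x, s) (0, 1) := by
  have hU := locallyIntegrableOn_comp_swap h₁ isOpen_Ioi h.1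
  have hG := locallyIntegrableOn_comp_swap h₁ isOpen_Ioi
    (LocallyIntegrableOn.apply_clm h.2.1 (0, 1))
  have hs := ae_slice_weak_deriv isOpen_Ioi h₁ (u := fun z => U z.swap)
    (g := fun z => G z.swap (0, 1)) (1 : ℝ) hU hG (by
      intro ψ hψ hψc hψs φ hφ hφc hφs
      refine Eq.trans ?_ ((integral_prod_swap (μ := volume) (ν := volume) _).trans
        (integral_weak_deriv_prod h hφ hφc hφs hψ hψc hψs (0, 1)))
      refine integral_congr_ae (ae_of_all _ fun z => ?_)
      simp only [map_zero, Prod.fst_swap, Prod.snd_swap]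
      ring)
  filter_upwards [hs, ae_locallyIntegrableOn_slice isOpen_Ioi h₁ hU,
    ae_locallyIntegrableOn_slice isOpen_Ioi h₁ hG] with x hx hxU hxG hxD
  exact ⟨hxG hxD, ae_eq_primitive_of_weak_deriv (hxU hxD) (hxG hxD) (hx hxD)⟩

end

/-! ### The horizontal multiplier inequality on slices. -/

section


section SquareIntegrable

variable {X : Type*} [MeasurableSpace X] {ν : Measure X}

theorem eLpNorm_two_sq {F : Type*} [NormedAddCommGroup F] (f : X → F) :
    eLpNorm f 2 ν ^ 2 = ∫⁻ x, ‖f x‖ₑ ^ 2 ∂ν := by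
  have h := eLpNorm_nnreal_pow_eq_lintegral (μ := ν) (f := f) (p := 2) two_ne_zero
  simpa using h

theorem memLp_two_of_lintegral_lt_top {F : Type*} [NormedAddCommGroup F] {f : X → F}
    (hf : AEStronglyMeasurable f ν) (h : ∫⁻ x, ‖f x‖ₑ ^ 2 ∂ν < ⊤) : MemLp f 2 ν := by
  refine ⟨hf, ?_⟩
  rw [← eLpNorm_two_sq] at h
  by_contra hne
  rw [not_lt, top_le_iff] at hne
  simp [hne] at h

/-- Continuity of the inner product of L²; used to pass to the limit in quadratic expressions. -/
theorem tendsto_integral_mul_of_tendsto_sq {f g : ℕ → X → ℝ} {f₀ g₀ : X → ℝ}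
    (hf : ∀ n, MemLp (f n) 2 ν) (hg : ∀ n, MemLp (g n) 2 ν) (hf₀ : MemLp f₀ 2 ν)
    (hg₀ : MemLp g₀ 2 ν)
    (hfl : Tendsto (fun n => ∫⁻ x, ‖f n x - f₀ x‖ₑ ^ 2 ∂ν) atTop (𝓝 0))
    (hgl : Tendsto (fun n => ∫⁻ x, ‖g n x - g₀ x‖ₑ ^ 2 ∂ν) atTop (𝓝 0)) :
    Tendsto (fun n => ∫ x, f n x * g n x ∂ν) atTop (𝓝 (∫ x, f₀ x * g₀ x ∂ν)) := by
  have key : ∀ {f : ℕ → X → ℝ} {f₀ : X → ℝ} (hf : ∀ n, MemLp (f n) 2 ν) (hf₀ : MemLp f₀ 2 ν),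
      Tendsto (fun n => ∫⁻ x, ‖f n x - f₀ x‖ₑ ^ 2 ∂ν) atTop (𝓝 0) →
      Tendsto (fun n => (hf n).toLp (f n)) atTop (𝓝 (hf₀.toLp f₀)) := by
    intro f f₀ hf hf₀ h
    rw [Lp.tendsto_Lp_iff_tendsto_eLpNorm'']
    have h2 : Tendsto (fun n => eLpNorm (f n - f₀) 2 ν ^ 2) atTop (𝓝 0) := by
      simpa only [eLpNorm_two_sq, Pi.sub_apply] using h
    have h3 := h2.ennrpow_const (1 / 2)
    simp only [← ENNReal.rpow_natCast, ← ENNReal.rpow_mul] at h3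
    simpa using h3
  have e : ∀ {f g : X → ℝ} (hf : MemLp f 2 ν) (hg : MemLp g 2 ν),
      ⟪hg.toLp g, hf.toLp f⟫_ℝ = ∫ x, f x * g x ∂ν := by
    intro f g hf hg
    rw [L2.inner_def]
    refine integral_congr_ae ?_
    filter_upwards [hf.coeFn_toLp, hg.coeFn_toLp] with x h1 h2
    rw [h1, h2]
    simp
  have := (key hg hg₀ hgl).inner (𝕜 := ℝ) (key hf hf₀ hfl)
  simpa only [e] using this

theorem tendsto_sq_bdd_mul {F : Type*} [NormedAddCommGroup F] {p : ℕ → X → ℝ} {p₀ : X → ℝ}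
    {f : ℕ → X → F} {f₀ : X → F} {C : ℝ≥0}
    (hp : ∀ n, ∀ᵐ x ∂ν, ‖p n x - p₀ x‖ ≤ C * ‖f n x - f₀ x‖)
    (hfl : Tendsto (fun n => ∫⁻ x, ‖f n x - f₀ x‖ₑ ^ 2 ∂ν) atTop (𝓝 0)) :
    Tendsto (fun n => ∫⁻ x, ‖p n x - p₀ x‖ₑ ^ 2 ∂ν) atTop (𝓝 0) := by
  refine tendsto_of_tendsto_of_tendsto_of_le_of_le tendsto_const_nhds
    (tendsto_const_mul_zero (c := (C : ℝ≥0∞) ^ 2) (by simp) hfl) (fun n => zero_le) fun n => ?_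
  beta_reduce
  rw [← lintegral_const_mul' _ _ (by simp)]
  refine lintegral_mono_ae ?_
  filter_upwards [hp n] with x hx
  rw [← mul_pow]
  gcongr
  have := ENNReal.ofReal_le_ofReal hx
  rwa [ENNReal.ofReal_mul C.coe_nonneg, ENNReal.ofReal_coe_nnreal, ofReal_norm,
    ofReal_norm] at this

end SquareIntegrable

/-- A nonnegative `C¹` function on the half line that vanishes beyond `T`. -/
structure RadialMultiplier (κ : ℝ → ℝ) (T : ℝ) : Prop where
  contDiffOn : ContDiffOn ℝ 1 κ (Ioi 0)
  nonneg : ∀ t, 0 < t → 0 ≤ κ t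
  eq_zero : ∀ t, T ≤ t → κ t = 0

namespace RadialMultiplier

variable {κ : ℝ → ℝ} {T : ℝ}

theorem hasDerivAt (h : RadialMultiplier κ T) {t : ℝ} (ht : 0 < t) :
    HasDerivAt κ (deriv κ t) t :=
  ((h.contDiffOn.contDiffAt (Ioi_mem_nhds ht)).differentiableAt one_ne_zero).hasDerivAt

theorem continuousOn_deriv (h : RadialMultiplier κ T) : ContinuousOn (deriv κ) (Ioi 0) :=
  h.contDiffOn.continuousOn_deriv_of_isOpen isOpen_Ioi le_rfl

theorem deriv_eq_zero (h : RadialMultiplier κ T) {t : ℝ} (ht : T < t) : deriv κ t = 0 := by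
  have : κ =ᶠ[𝓝 t] fun _ => 0 := by
    filter_upwards [Ioi_mem_nhds ht] with s hs using h.eq_zero s (le_of_lt hs)
  rw [this.deriv_eq]
  simp

end RadialMultiplier

section Horizontal

variable {d : ℕ}

/-- The integrand is the divergence of `p x`; it is integrated by parts one coordinate at a time. -/
theorem integral_fderiv_self_add (p : E d → ℝ) (hp : ContDiff ℝ 1 p) (hc : HasCompactSupport p) :
    ∫ x, (fderiv ℝ p x x + d * p x) = 0 := by
  have hpc : Continuous p := hp.continuous
  have hp' : Continuous (fderiv ℝ p) := hp.continuous_fderiv one_ne_zero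
  have hc' : HasCompactSupport (fderiv ℝ p) := hc.fderiv ℝ
  have hi : ∀ i : Fin d, ∫ x, p x = -∫ x, fderiv ℝ p x (EuclideanSpace.single i 1) * x i := by
    intro i
    set L : E d →L[ℝ] ℝ := EuclideanSpace.proj i
    have hL : ∀ x, fderiv ℝ (fun x => L x) x (EuclideanSpace.single i 1) = 1 := by
      intro x
      rw [L.hasFDerivAt.fderiv]
      simp [L]
    have h := integral_mul_fderiv_eq_neg_fderiv_mul_of_integrable (μ := (volume : Measure (E d)))
      (f := p) (g := fun x => L x) (v := EuclideanSpace.single i 1) ?_ ?_ ?_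
      (fun x _ => hp.differentiable one_ne_zero x) (fun x _ => L.differentiableAt)
    · simp only [hL, mul_one] at h
      exact h
    · refine Continuous.integrable_of_hasCompactSupport (by fun_prop) ?_
      exact (hc'.comp_left (g := fun l : E d →L[ℝ] ℝ => l (EuclideanSpace.single i 1))
        (by simp)).mul_right
    · simp only [hL, mul_one]
      exact hpc.integrable_of_hasCompactSupport hc
    · exact Continuous.integrable_of_hasCompactSupport (by fun_prop) hc.mul_right
  have hint : ∀ i : Fin d,
      Integrable (fun x => fderiv ℝ p x (EuclideanSpace.single i 1) * x i) := fun i => by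
    refine Continuous.integrable_of_hasCompactSupport (by fun_prop) ?_
    exact (hc'.comp_left (g := fun l : E d →L[ℝ] ℝ => l (EuclideanSpace.single i 1))
      (by simp)).mul_right
  have hsum : ∀ x : E d, fderiv ℝ p x x =
      ∑ i, fderiv ℝ p x (EuclideanSpace.single i 1) * x i := by
    intro x
    refine (congrArg (fderiv ℝ p x)
      ((EuclideanSpace.basisFun (Fin d) ℝ).sum_repr x)).symm.trans ?_
    rw [map_sum]
    refine Finset.sum_congr rfl fun i _ => ?_
    simp [mul_comm]
  simp only [hsum]
  rw [integral_add (integrable_finsetSum _ fun i _ => hint i)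
    ((hpc.integrable_of_hasCompactSupport hc).const_mul _), integral_finsetSum _ fun i _ => hint i,
    integral_const_mul]
  have : ∀ i ∈ Finset.univ, ∫ x, fderiv ℝ p x (EuclideanSpace.single i 1) * x i = -∫ x, p x :=
    fun i _ => by rw [hi i, neg_neg]
  rw [Finset.sum_congr rfl this]
  simp

/-- The cutoff vanishing on the ball of radius `R` and equal to `1` where `R ^ 2 + 1 ≤ ‖x‖ ^ 2`. -/
def outerCutoff (R : ℝ) (x : E d) : ℝ := Real.smoothTransition (‖x‖ ^ 2 - R ^ 2)

theorem contDiff_outerCutoff (R : ℝ) : ContDiff ℝ 1 (outerCutoff R : E d → ℝ) :=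
  Real.smoothTransition.contDiff.comp ((contDiff_norm_sq ℝ).sub contDiff_const)

theorem outerCutoff_nonneg (R : ℝ) (x : E d) : 0 ≤ outerCutoff R x :=
  Real.smoothTransition.nonneg _

theorem outerCutoff_le_one (R : ℝ) (x : E d) : outerCutoff R x ≤ 1 :=
  Real.smoothTransition.le_one _

theorem outerCutoff_eq_zero {R : ℝ} {x : E d} (h : ‖x‖ ^ 2 ≤ R ^ 2) : outerCutoff R x = 0 :=
  Real.smoothTransition.zero_of_nonpos (by linarith)

theorem outerCutoff_eq_one {R : ℝ} {x : E d} (h : R ^ 2 + 1 ≤ ‖x‖ ^ 2) : outerCutoff R x = 1 :=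
  Real.smoothTransition.one_of_one_le (by linarith)

theorem hasFDerivAt_comp_norm_sq {k : ℝ → ℝ} {k' b : ℝ} {x : E d}
    (hk : HasDerivAt k k' (b + ‖x‖ ^ 2)) :
    HasFDerivAt (fun x : E d => k (b + ‖x‖ ^ 2)) (k' • (2 • innerSL ℝ x)) x :=
  hk.comp_hasFDerivAt x ((hasStrictFDerivAt_norm_sq x).hasFDerivAt.const_add b)

variable {D : Set (E d)} {u g : E d → ℝ} {G : E d → E d →L[ℝ] ℝ} {φ : ℕ → E d → ℝ}

/-- The limits are locally square integrable because some continuous approximation lies at finite L²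
distance. -/
theorem TraceApprox.memLp (h : TraceApprox D u g G φ) (r : ℝ) :
    MemLp u 2 (volume.restrict (D ∩ Metric.ball 0 r)) ∧
      MemLp G 2 (volume.restrict (D ∩ Metric.ball 0 r)) ∧
      ∀ n, MemLp (φ n) 2 (volume.restrict (D ∩ Metric.ball 0 r)) ∧
        MemLp (fderiv ℝ (φ n)) 2 (volume.restrict (D ∩ Metric.ball 0 r)) := by
  set ν : Measure (E d) := volume.restrict (D ∩ Metric.ball 0 r)
  have hcont : ∀ {F : Type} [NormedAddCommGroup F] [SecondCountableTopology F] {f : E d → F},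
      Continuous f → MemLp f 2 ν := by
    intro F _ _ f hf
    have h1 : MemLp f 2 (volume.restrict (Metric.closedBall (0 : E d) r)) := by
      obtain ⟨C, hC⟩ := (isCompact_closedBall (0 : E d) r).exists_bound_of_continuousOn
        hf.continuousOn
      have : IsFiniteMeasure (volume.restrict (Metric.closedBall (0 : E d) r)) :=
        ⟨by simpa using (isCompact_closedBall (0 : E d) r).measure_lt_top⟩
      exact MemLp.of_bound hf.aestronglyMeasurable C
        ((ae_restrict_iff' Metric.isClosed_closedBall.measurableSet).2 (ae_of_all _ hC))
    exact h1.mono_measure (Measure.restrict_mono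
      (inter_subset_right.trans Metric.ball_subset_closedBall) le_rfl)
  have hlim : ∀ {F : Type} [NormedAddCommGroup F] {f : ℕ → E d → F} {f₀ : E d → F},
      AEStronglyMeasurable f₀ (volume.restrict D) → (∀ n, MemLp (f n) 2 ν) →
      Tendsto (fun n => ∫⁻ x, ‖f n x - f₀ x‖ₑ ^ 2 ∂ν) atTop (𝓝 0) → MemLp f₀ 2 ν := by
    intro F _ f f₀ hf₀ hf ht
    obtain ⟨n, hn⟩ := (ht.eventually_lt_const ENNReal.zero_lt_top).exists
    have hm : AEStronglyMeasurable f₀ ν :=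
      hf₀.mono_measure (Measure.restrict_mono inter_subset_left le_rfl)
    have := (hf n).sub (memLp_two_of_lintegral_lt_top ((hf n).1.sub hm) hn)
    simpa using this
  have h1 : ∀ n, MemLp (φ n) 2 ν := fun n => hcont (h.contDiff n).continuous
  have h2 : ∀ n, MemLp (fderiv ℝ (φ n)) 2 ν :=
    fun n => hcont ((h.contDiff n).continuous_fderiv one_ne_zero)
  exact ⟨hlim h.aesm h1 (h.tendsto r), hlim h.aesm_deriv h2 (h.tendsto_deriv r),
    fun n => ⟨h1 n, h2 n⟩⟩

/-- The divergence of ψ κ φ² x has zero integral. Its expansion consists of the integrand stated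
here and a term with the radial derivative of ψ, which is nonnegative and can be dropped. -/
theorem integral_outerCutoff_le {κ : ℝ → ℝ} {T : ℝ} (hκ : RadialMultiplier κ T) {b : ℝ}
    (hb : 0 < b) (R : ℝ) {φ : E d → ℝ} (hφ : ContDiff ℝ 1 φ) :
    ∫ x, (outerCutoff R x * (d * κ (b + ‖x‖ ^ 2) + 2 * ‖x‖ ^ 2 * deriv κ (b + ‖x‖ ^ 2)) * φ x * φ x
      + φ x * (2 * outerCutoff R x * κ (b + ‖x‖ ^ 2) * fderiv ℝ φ x x)) ≤ 0 := by
  have hpos : ∀ x : E d, 0 < b + ‖x‖ ^ 2 := fun x => by positivity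
  have hκc : ContDiff ℝ 1 fun x : E d => κ (b + ‖x‖ ^ 2) := by
    rw [← contDiffOn_univ]
    exact hκ.contDiffOn.comp (contDiff_const.add (contDiff_norm_sq ℝ)).contDiffOn
      fun x _ => hpos x
  have hp : ContDiff ℝ 1 fun x : E d => outerCutoff R x * κ (b + ‖x‖ ^ 2) * φ x ^ 2 :=
    ((contDiff_outerCutoff R).mul hκc).mul (hφ.pow 2)
  have hcs : HasCompactSupport fun x : E d => κ (b + ‖x‖ ^ 2) := by
    refine HasCompactSupport.intro (isCompact_closedBall (0 : E d) (√(max T 0))) fun x hx => ?_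
    refine hκ.eq_zero _ ?_
    rw [mem_closedBall_zero_iff, not_le, Real.sqrt_lt' ((Real.sqrt_nonneg _).trans_lt
      (by simpa using hx))] at hx
    linarith [le_max_left T 0]
  have hpc : HasCompactSupport fun x : E d => outerCutoff R x * κ (b + ‖x‖ ^ 2) * φ x ^ 2 :=
    hcs.mul_left.mul_right
  have hE := integral_fderiv_self_add _ hp hpc
  set S : E d → ℝ := fun x => deriv Real.smoothTransition (‖x‖ ^ 2 - R ^ 2) with hS
  have hder : ∀ x : E d, fderiv ℝ (fun x : E d => outerCutoff R x * κ (b + ‖x‖ ^ 2) * φ x ^ 2) x x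
      = 2 * ‖x‖ ^ 2 * S x * κ (b + ‖x‖ ^ 2) * φ x ^ 2
        + outerCutoff R x * (2 * ‖x‖ ^ 2 * deriv κ (b + ‖x‖ ^ 2)) * φ x ^ 2
        + φ x * (2 * outerCutoff R x * κ (b + ‖x‖ ^ 2) * fderiv ℝ φ x x) := by
    intro x
    have h1 := hasFDerivAt_comp_norm_sq (x := x) (hκ.hasDerivAt (hpos x))
    have hs : HasDerivAt Real.smoothTransition (S x) (-R ^ 2 + ‖x‖ ^ 2) := by
      have : -R ^ 2 + ‖x‖ ^ 2 = ‖x‖ ^ 2 - R ^ 2 := by ring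
      rw [this]
      exact ((Real.smoothTransition.contDiff (n := 1)).differentiable (by norm_num) _).hasDerivAt
    have h2 := hasFDerivAt_comp_norm_sq (x := x) hs
    have h2a : HasFDerivAt (outerCutoff R : E d → ℝ) (S x • (2 • innerSL ℝ x)) x := by
      refine h2.congr_of_eventuallyEq (Eventually.of_forall fun y => ?_)
      simp only [outerCutoff]
      congr 1
      ring
    have h3 : HasFDerivAt φ (fderiv ℝ φ x) x := (hφ.differentiable one_ne_zero x).hasFDerivAt
    refine (congrArg (fun L : E d →L[ℝ] ℝ => L x)
      (HasFDerivAt.fderiv (f := fun x : E d => outerCutoff R x * κ (b + ‖x‖ ^ 2) * φ x ^ 2)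
        ((h2a.mul h1).mul (h3.pow 2)))).trans ?_
    have hx : innerSL ℝ x x = ‖x‖ ^ 2 := by simp
    simp only [add_apply, smul_apply, smul_eq_mul, nsmul_eq_mul, Nat.cast_ofNat, Pi.mul_apply, hx]
    ring
  have hS0 : ∀ x, 0 ≤ S x := fun x => Real.smoothTransition.monotone.deriv_nonneg
  have hSc : Continuous S := by
    have := (Real.smoothTransition.contDiff (n := 1)).continuous_deriv (by norm_num)
    exact this.comp (by fun_prop)
  have hint1 : Integrable fun x : E d => 2 * ‖x‖ ^ 2 * S x * κ (b + ‖x‖ ^ 2) * φ x ^ 2 := by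
    refine Continuous.integrable_of_hasCompactSupport ?_ hcs.mul_left.mul_right
    exact ((((continuous_const.mul (continuous_norm.pow 2)).mul hSc).mul hκc.continuous).mul
      (hφ.continuous.pow 2))
  have hint2 : Integrable fun x : E d =>
      fderiv ℝ (fun x : E d => outerCutoff R x * κ (b + ‖x‖ ^ 2) * φ x ^ 2) x x
        + d * (outerCutoff R x * κ (b + ‖x‖ ^ 2) * φ x ^ 2) := by
    refine Integrable.add ?_ ((hp.continuous.integrable_of_hasCompactSupport hpc).const_mul _)
    have hc' : Continuous (fderiv ℝ fun x : E d => outerCutoff R x * κ (b + ‖x‖ ^ 2) * φ x ^ 2) :=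
      hp.continuous_fderiv one_ne_zero
    refine Continuous.integrable_of_hasCompactSupport (hc'.clm_apply continuous_id) ?_
    refine (hpc.fderiv ℝ).mono fun x hx => ?_
    contrapose! hx
    rw [Function.notMem_support] at hx ⊢
    simp only [hx, zero_apply]
  have h0 : 0 ≤ ∫ x : E d, 2 * ‖x‖ ^ 2 * S x * κ (b + ‖x‖ ^ 2) * φ x ^ 2 :=
    integral_nonneg fun x => by
      have := hS0 x
      have := hκ.nonneg _ (hpos x)
      positivity
  have : ∫ x, (outerCutoff R x * (d * κ (b + ‖x‖ ^ 2) + 2 * ‖x‖ ^ 2 * deriv κ (b + ‖x‖ ^ 2))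
      * φ x * φ x + φ x * (2 * outerCutoff R x * κ (b + ‖x‖ ^ 2) * fderiv ℝ φ x x))
      = 0 - ∫ x : E d, 2 * ‖x‖ ^ 2 * S x * κ (b + ‖x‖ ^ 2) * φ x ^ 2 := by
    rw [← hE, ← integral_sub hint2 hint1]
    refine integral_congr_ae (ae_of_all _ fun x => ?_)
    simp only [hder]
    ring
  linarith

theorem exists_abs_le_of_continuous {f : E d → ℝ} (hf : Continuous f) (r : ℝ) :
    ∃ C : ℝ≥0, ∀ x ∈ Metric.closedBall (0 : E d) r, |f x| ≤ C := by
  obtain ⟨C, hC⟩ := (isCompact_closedBall (0 : E d) r).exists_bound_of_continuousOn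
    hf.continuousOn
  exact ⟨C.toNNReal, fun x hx => (hC x hx).trans (Real.le_coe_toNNReal C)⟩

/-- The inequality for smooth functions passes to the limit: the cutoff removes everything outside
`D` and `κ` everything far away, so all coefficients are bounded and live on a bounded part of `D`,
where the approximation converges in L². -/
theorem TraceApprox.integral_outerCutoff_le (hD : IsOpen D) (h : TraceApprox D u g G φ)
    {R : ℝ} (hR : ∀ x : E d, R ^ 2 < ‖x‖ ^ 2 → x ∈ D) {κ : ℝ → ℝ} {T : ℝ}
    (hκ : RadialMultiplier κ T) {b : ℝ} (hb : 0 < b) :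
    ∫ x in D, outerCutoff R x * ((d * κ (b + ‖x‖ ^ 2) + 2 * ‖x‖ ^ 2 * deriv κ (b + ‖x‖ ^ 2))
      * u x ^ 2 + 2 * κ (b + ‖x‖ ^ 2) * (u x * G x x)) ≤ 0 := by
  have hpos : ∀ x : E d, 0 < b + ‖x‖ ^ 2 := fun x => by positivity
  -- Beyond this radius the argument of `κ` exceeds `T` strictly, so `κ` and its derivative both
  -- vanish.
  set r : ℝ := √(max T 0) + 1 with hr
  have hbig : ∀ x : E d, x ∉ Metric.ball 0 r → T < b + ‖x‖ ^ 2 := by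
    intro x hx
    rw [mem_ball_zero_iff, not_lt] at hx
    have h1 : √(max T 0) ^ 2 = max T 0 := Real.sq_sqrt (le_max_right _ _)
    nlinarith [le_max_left T 0, Real.sqrt_nonneg (max T 0)]
  set a : E d → ℝ := fun x =>
    outerCutoff R x * (d * κ (b + ‖x‖ ^ 2) + 2 * ‖x‖ ^ 2 * deriv κ (b + ‖x‖ ^ 2)) with ha
  set c : E d → ℝ := fun x => 2 * outerCutoff R x * κ (b + ‖x‖ ^ 2) with hc
  have hsq : Continuous fun x : E d => b + ‖x‖ ^ 2 := by fun_prop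
  have hκ0 : Continuous fun x : E d => κ (b + ‖x‖ ^ 2) :=
    hκ.contDiffOn.continuousOn.comp_continuous hsq hpos
  have hκ1 : Continuous fun x : E d => deriv κ (b + ‖x‖ ^ 2) :=
    hκ.continuousOn_deriv.comp_continuous hsq hpos
  have hψ : Continuous (outerCutoff R : E d → ℝ) := (contDiff_outerCutoff R).continuous
  have hac : Continuous a := by
    rw [ha]
    exact hψ.mul ((continuous_const.mul hκ0).add
      ((continuous_const.mul (continuous_norm.pow 2)).mul hκ1))
  have hcc : Continuous c := (continuous_const.mul hψ).mul hκ0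
  have hzero : ∀ x : E d, x ∉ D ∩ Metric.ball 0 r → a x = 0 ∧ c x = 0 := by
    intro x hx
    by_cases hxD : x ∈ D
    · have hx' := hbig x fun hb => hx ⟨hxD, hb⟩
      simp [ha, hc, hκ.eq_zero _ hx'.le, hκ.deriv_eq_zero hx']
    · have : outerCutoff R x = 0 :=
        outerCutoff_eq_zero (not_lt.1 fun hlt => hxD (hR x hlt))
      simp [ha, hc, this]
  set B : Set (E d) := D ∩ Metric.ball 0 r with hB
  have hBm : MeasurableSet B := (hD.inter Metric.isOpen_ball).measurableSet
  have hBr : ∀ x ∈ B, x ∈ Metric.closedBall (0 : E d) r :=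
    fun x hx => Metric.ball_subset_closedBall hx.2
  obtain ⟨Ca, hCa⟩ := exists_abs_le_of_continuous hac r
  obtain ⟨Cc, hCc⟩ := exists_abs_le_of_continuous (hcc.mul continuous_norm) r
  have hbound : ∀ x ∈ B, ∀ L : E d →L[ℝ] ℝ, ‖c x * L x‖ ≤ Cc * ‖L‖ := by
    intro x hx L
    have h1 := hCc x (hBr x hx)
    rw [Pi.mul_apply, abs_mul, abs_of_nonneg (norm_nonneg x)] at h1
    calc ‖c x * L x‖ = |c x| * ‖L x‖ := by rw [norm_mul, Real.norm_eq_abs]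
      _ ≤ |c x| * (‖L‖ * ‖x‖) := by gcongr; exact L.le_opNorm x
      _ = |c x| * ‖x‖ * ‖L‖ := by ring
      _ ≤ Cc * ‖L‖ := by gcongr
  obtain ⟨mu, mG, mφ⟩ := h.memLp r
  have mconst : ∀ {f : E d → ℝ}, MemLp f 2 (volume.restrict B) →
      MemLp (fun x => a x * f x) 2 (volume.restrict B) := by
    intro f hf
    refine (hf.const_mul (Ca : ℝ)).mono (hac.aestronglyMeasurable.mul hf.1)
      ((ae_restrict_iff' hBm).2 (ae_of_all _ fun x hx => ?_))
    rw [norm_mul (a x), norm_mul (Ca : ℝ), Real.norm_eq_abs, Real.norm_of_nonneg Ca.coe_nonneg]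
    exact mul_le_mul_of_nonneg_right (hCa x (hBr x hx)) (norm_nonneg _)
  have mclm : ∀ {L : E d → E d →L[ℝ] ℝ}, MemLp L 2 (volume.restrict B) →
      MemLp (fun x => c x * L x x) 2 (volume.restrict B) := by
    intro L hL
    have hm : AEStronglyMeasurable (fun x => L x x) (volume.restrict B) :=
      (ContinuousLinearMap.apply ℝ ℝ : E d →L[ℝ] (E d →L[ℝ] ℝ) →L[ℝ] ℝ).aestronglyMeasurable_comp₂
        aestronglyMeasurable_id hL.1
    refine (hL.norm.const_mul (Cc : ℝ)).mono (hcc.aestronglyMeasurable.mul hm)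
      ((ae_restrict_iff' hBm).2 (ae_of_all _ fun x hx => ?_))
    rw [norm_mul (Cc : ℝ), norm_norm, Real.norm_of_nonneg Cc.coe_nonneg]
    exact hbound x hx _
  have l1 := tendsto_integral_mul_of_tendsto_sq (fun n => mconst (mφ n).1) (fun n => (mφ n).1)
    (mconst mu) mu (tendsto_sq_bdd_mul (C := Ca) (fun n => (ae_restrict_iff' hBm).2
      (ae_of_all _ fun x hx => by
        rw [← mul_sub, norm_mul, Real.norm_eq_abs]
        exact mul_le_mul_of_nonneg_right (hCa x (hBr x hx)) (norm_nonneg _)))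
      (h.tendsto r)) (h.tendsto r)
  have l2 := tendsto_integral_mul_of_tendsto_sq (fun n => (mφ n).1) (fun n => mclm (mφ n).2)
    mu (mclm mG) (h.tendsto r) (tendsto_sq_bdd_mul (C := Cc) (fun n => (ae_restrict_iff' hBm).2
      (ae_of_all _ fun x hx => by
        rw [← mul_sub, ← sub_apply]
        exact hbound x hx _))
      (h.tendsto_deriv r))
  have hle : ∀ n, (∫ x in B, a x * φ n x * φ n x)
      + (∫ x in B, φ n x * (c x * fderiv ℝ (φ n) x x)) ≤ 0 := by
    intro n
    have i1 : Integrable (fun x => a x * φ n x * φ n x) (volume.restrict B) :=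
      (mconst (mφ n).1).integrable_mul (mφ n).1
    have i2 : Integrable (fun x => φ n x * (c x * fderiv ℝ (φ n) x x)) (volume.restrict B) :=
      (mφ n).1.integrable_mul (mclm (mφ n).2)
    rw [← integral_add i1 i2]
    refine le_of_eq_of_le ?_ (FracPoincare.integral_outerCutoff_le hκ hb R (h.contDiff n))
    rw [setIntegral_eq_integral_of_forall_compl_eq_zero]
    intro x hx
    simp [hzero x hx]
  have hlim := le_of_tendsto' (l1.add l2) hle
  have i1 : Integrable (fun x => a x * u x * u x) (volume.restrict B) :=
    (mconst mu).integrable_mul mu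
  have i2 : Integrable (fun x => u x * (c x * G x x)) (volume.restrict B) :=
    mu.integrable_mul (mclm mG)
  rw [← integral_add i1 i2] at hlim
  refine le_of_eq_of_le ?_ hlim
  rw [setIntegral_eq_of_subset_of_forall_sdiff_eq_zero hD.measurableSet
    (inter_subset_left : B ⊆ D)]
  · refine setIntegral_congr_fun hBm fun x hx => ?_
    simp only [ha, hc]
    ring
  · intro x hx
    have h1 := (hzero x hx.2).1
    have h2 := (hzero x hx.2).2
    simp only [ha, hc] at h1 h2
    linear_combination u x ^ 2 * h1 + (u x * G x x) * h2

end Horizontal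

end

/-! ### The vertical multiplier inequality on lines. -/

section


/-- A function that is not integrable has integral 0 by convention; otherwise the half line is
exhausted from the left, and the right end is fixed by the support of `f`. -/
theorem setIntegral_Ioi_le_zero {f : ℝ → ℝ} {M : ℝ} (hM : ∀ t, M ≤ t → f t = 0)
    (h : ∀ ε, 0 < ε → ε ≤ 1 → ∀ b, 1 ≤ b → M ≤ b → ∫ t in ε..b, f t ≤ 0) :
    ∫ t in Ioi (0 : ℝ), f t ≤ 0 := by
  by_cases hf : IntegrableOn f (Ioi 0)
  swap
  · rw [integral_undef hf]
  have hU : ⋃ n : ℕ, Ioi (1 / ((n : ℝ) + 1)) = Ioi (0 : ℝ) := by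
    refine subset_antisymm (iUnion_subset fun n x hx =>
      lt_trans (show (0 : ℝ) < 1 / ((n : ℝ) + 1) by positivity) hx)
      fun x hx => ?_
    obtain ⟨n, hn⟩ := exists_nat_one_div_lt (show (0 : ℝ) < x from hx)
    exact mem_iUnion.2 ⟨n, hn⟩
  have hlim := tendsto_setIntegral_of_monotone (μ := volume) (f := f)
    (s := fun n : ℕ => Ioi (1 / ((n : ℝ) + 1))) (fun n => measurableSet_Ioi)
    (fun m n hmn => Ioi_subset_Ioi (by gcongr)) (by rwa [hU])
  rw [hU] at hlim
  refine le_of_tendsto' hlim fun n => ?_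
  have h1 : 1 / ((n : ℝ) + 1) ≤ 1 := by
    rw [div_le_one (by positivity)]
    linarith [n.cast_nonneg (α := ℝ)]
  refine le_of_eq_of_le ?_ (h (1 / ((n : ℝ) + 1)) (by positivity) h1 (max 1 M) (le_max_left _ _)
    (le_max_right _ _))
  rw [intervalIntegral.integral_of_le (h1.trans (le_max_left _ _))]
  refine setIntegral_eq_of_subset_of_forall_sdiff_eq_zero measurableSet_Ioi
    Ioc_subset_Ioi_self fun x hx => hM x ?_
  by_contra hlt
  exact hx.2 ⟨hx.1, ((not_le.1 hlt).le.trans (le_max_right _ _))⟩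

/-- The integrand is the derivative of t^(α+1) κ f². On `[ε, M]` with `M` large, the upper boundary
value is zero and the lower one enters with a negative sign. A finite upper end without such
vanishing would contribute with the wrong sign, so this is reserved for the half line. -/
theorem integral_vertical_le {κ : ℝ → ℝ} {T : ℝ} (hκ : RadialMultiplier κ T) (α : ℝ) {b : ℝ}
    (hb : 0 < b) {f g : ℝ → ℝ} (hg : LocallyIntegrableOn g (Ioi 0)) {c : ℝ}
    (hf : ∀ᵐ t, t ∈ Ioi (0 : ℝ) → f t = c + ∫ s in (1 : ℝ)..t, g s) :
    ∫ t in Ioi (0 : ℝ), t ^ α * (((1 + α) * κ (b + t ^ 2) + 2 * t ^ 2 * deriv κ (b + t ^ 2))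
      * f t ^ 2 + 2 * κ (b + t ^ 2) * (f t * (t * g t))) ≤ 0 := by
  have hpos : ∀ t : ℝ, 0 < b + t ^ 2 := fun t => by positivity
  have hbig : ∀ t : ℝ, √(max T 0) + 1 ≤ t → T < b + t ^ 2 := by
    intro t ht
    have h1 : √(max T 0) ^ 2 = max T 0 := Real.sq_sqrt (le_max_right _ _)
    nlinarith [le_max_left T 0, Real.sqrt_nonneg (max T 0)]
  refine setIntegral_Ioi_le_zero (M := √(max T 0) + 1) (fun t ht => ?_)
    fun ε hε hε1 M hM1 hM => ?_
  · simp [hκ.eq_zero _ (hbig t ht).le, hκ.deriv_eq_zero (hbig t ht)]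
  have hεM : ε ≤ M := hε1.trans hM1
  set P : ℝ → ℝ := fun t => c + ∫ s in (1 : ℝ)..t, g s with hP
  set F : ℝ → ℝ := fun t => t ^ (α + 1) * κ (b + t ^ 2) with hF
  have hPac : AbsolutelyContinuousOnInterval P ε M :=
    (LipschitzOnWith.absolutelyContinuousOnInterval
      (LipschitzWith.const c).lipschitzOnWith).add (absolutelyContinuous_primitive hg hε hε1 hM1)
  have hFc : ContDiffOn ℝ 1 F (Ioi 0) := by
    refine ContDiffOn.mul (fun t ht => ?_) (hκ.contDiffOn.comp (by fun_prop) fun t _ => hpos t)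
    exact (Real.contDiffAt_rpow_const_of_ne (ne_of_gt ht)).contDiffWithinAt
  have hsub : uIcc ε M ⊆ Ioi 0 := by
    rw [uIcc_of_le hεM]
    exact fun t ht => hε.trans_le ht.1
  have hFac : AbsolutelyContinuousOnInterval F ε M :=
    (hFc.mono hsub).absolutelyContinuousOnInterval
  have hder := (intervalIntegrable_of_Ioi hg hε (zero_lt_one.trans_le hM1)).ae_hasDerivAt_integral
  rw [uIcc_of_le hεM] at hder
  have hint := ((hPac.mul hPac).mul hFac).integral_deriv_eq_sub
  have hFM : F M = 0 := by simp [hF, hκ.eq_zero _ (hbig M hM).le]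
  have hFε : 0 ≤ F ε := mul_nonneg (by positivity) (hκ.nonneg _ (hpos ε))
  have hval : ∫ t in ε..M, deriv (P * P * F) t ≤ 0 := by
    rw [hint]
    simp only [Pi.mul_apply, hFM, mul_zero, zero_sub, neg_nonpos]
    exact mul_nonneg (mul_self_nonneg _) hFε
  refine le_of_eq_of_le ?_ hval
  refine intervalIntegral.integral_congr_ae ?_
  filter_upwards [hder, hf] with t ht hft htm
  rw [uIoc_of_le hεM] at htm
  have ht0 : 0 < t := hε.trans htm.1
  have hP' : HasDerivAt P (g t) t := (ht ⟨htm.1.le, htm.2⟩ 1 ⟨hε1, hM1⟩).const_add c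
  have hF' : HasDerivAt F ((α + 1) * t ^ α * κ (b + t ^ 2)
      + t ^ (α + 1) * (deriv κ (b + t ^ 2) * (2 * t))) t := by
    have h1 := Real.hasDerivAt_rpow_const (x := t) (p := α + 1) (Or.inl ht0.ne')
    rw [add_sub_cancel_right] at h1
    have h2 : HasDerivAt (fun t : ℝ => b + t ^ 2) (2 * t) t := by
      simpa using (hasDerivAt_pow 2 t).const_add b
    exact h1.mul ((hκ.hasDerivAt (hpos t)).comp t h2)
  rw [((hP'.mul hP').mul hF').deriv, hft ht0, show c + ∫ s in (1 : ℝ)..t, g s = P t from rfl]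
  simp only [Pi.mul_apply, hF]
  rw [Real.rpow_add_one ht0.ne']
  ring

end

/-! ### The multiplier estimate on the cylinder, up to a defect. -/

section


variable {d : ℕ}

/-- The square of the weight `rho`. -/
def tau (z : E d × ℝ) : ℝ := 1 + ‖z.1‖ ^ 2 + z.2 ^ 2

theorem one_le_tau (z : E d × ℝ) : 1 ≤ tau z := by
  unfold tau
  nlinarith [sq_nonneg ‖z.1‖, sq_nonneg z.2]

theorem tau_pos (z : E d × ℝ) : 0 < tau z := zero_lt_one.trans_le (one_le_tau z)

theorem continuous_tau : Continuous (tau : E d × ℝ → ℝ) := by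
  unfold tau
  fun_prop

theorem rho_rpow (z : E d × ℝ) (s : ℝ) : rho z ^ s = tau z ^ (s / 2) := by
  rw [rho, Real.sqrt_eq_rpow, ← tau, ← Real.rpow_mul (tau_pos z).le]
  ring_nf

theorem isOpen_yInterval (Y : EReal) : IsOpen (yInterval Y) :=
  isOpen_Ioi.inter (isOpen_Iio.preimage continuous_coe_real_ereal)

theorem yInterval_top : yInterval ⊤ = Ioi 0 := by
  ext y
  simp [yInterval, EReal.coe_lt_top]

theorem isOpen_cutCylinder (Ω : Set (E d)) (Y : EReal) : IsOpen (cutCylinder Ω Y) :=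
  isClosed_frontier.isOpen_compl.prod (isOpen_yInterval Y)

/-- The density of the squared norm of `H¹_ρ(y^α, D)`. -/
def energyDensity (α : ℝ) (U : E d × ℝ → ℝ) (G : E d × ℝ → E d × ℝ →L[ℝ] ℝ) (z : E d × ℝ) : ℝ :=
  z.2 ^ α * (gradSq (G z) + rho z ^ (-2 : ℝ) * U z ^ 2)

theorem gradSq_nonneg (L : E d × ℝ →L[ℝ] ℝ) : 0 ≤ gradSq L := by
  unfold gradSq
  positivity

theorem aestronglyMeasurable_gradSq {ν : Measure (E d × ℝ)} {G : E d × ℝ → E d × ℝ →L[ℝ] ℝ}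
    (hG : AEStronglyMeasurable G ν) : AEStronglyMeasurable (fun z => gradSq (G z)) ν := by
  have h : Continuous fun L : E d × ℝ →L[ℝ] ℝ => gradSq L := by
    unfold gradSq
    refine ((Continuous.norm ?_).pow 2).add ((ContinuousLinearMap.apply ℝ ℝ (0, 1)).continuous.pow 2)
    exact ((ContinuousLinearMap.compL ℝ (E d) (E d × ℝ) ℝ).flip
      (ContinuousLinearMap.inl ℝ (E d) ℝ)).continuous
  exact h.comp_aestronglyMeasurable hG

theorem measurable_snd_rpow (α : ℝ) : Measurable fun z : E d × ℝ => z.2 ^ α :=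
  measurable_snd.pow_const α

section Integrable

variable {α : ℝ} {Ω : Set (E d)} {Y : EReal} {U : E d × ℝ → ℝ} {G : E d × ℝ → E d × ℝ →L[ℝ] ℝ}

theorem energyDensity_nonneg {z : E d × ℝ} (hz : z ∈ cutCylinder Ω Y) :
    0 ≤ energyDensity α U G z := by
  have := gradSq_nonneg (G z)
  have := hz.2.1
  have : 0 ≤ rho z := Real.sqrt_nonneg _
  unfold energyDensity
  positivity

theorem MemH1rho.integrableOn_energyDensity (h : MemH1rho α (cutCylinder Ω Y) U G) :
    IntegrableOn (energyDensity α U G) (cutCylinder Ω Y) := by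
  have hD := (isOpen_cutCylinder Ω Y).measurableSet
  refine ⟨?_, ?_⟩
  · refine (measurable_snd_rpow α).aestronglyMeasurable.mul
      ((aestronglyMeasurable_gradSq h.1.2.1.aestronglyMeasurable).add
      (AEStronglyMeasurable.mul ?_ (h.1.1.aestronglyMeasurable.pow 2)))
    simp only [rho_rpow]
    exact (continuous_tau.measurable.pow_const _).aestronglyMeasurable
  · rw [hasFiniteIntegral_iff_ofReal ((ae_restrict_iff' hD).2
      (ae_of_all _ fun z hz => energyDensity_nonneg hz))]
    exact h.2

theorem MemH1rho.integrableOn_of_le (h : MemH1rho α (cutCylinder Ω Y) U G) {f : E d × ℝ → ℝ}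
    (hf : AEStronglyMeasurable f (volume.restrict (cutCylinder Ω Y))) {M : ℝ}
    (hM : ∀ z ∈ cutCylinder Ω Y, |f z| ≤ M * energyDensity α U G z) :
    IntegrableOn f (cutCylinder Ω Y) := by
  refine (h.integrableOn_energyDensity.const_mul M).mono' hf ?_
  exact (ae_restrict_iff' (isOpen_cutCylinder Ω Y).measurableSet).2 (ae_of_all _ hM)

/-- Quadratic expressions in `U` and its derivative with a bounded coefficient supported in
`{tau ≤ T}` are controlled by the energy density. -/
theorem abs_le_energyDensity {T K : ℝ} (hK : 0 ≤ K) {z : E d × ℝ} (hz : z ∈ cutCylinder Ω Y)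
    (hT : tau z ≤ T) {f : ℝ} (hf : |f| ≤ K * (U z ^ 2 + gradSq (G z))) :
    |z.2 ^ α * f| ≤ K * T * energyDensity α U G z := by
  have hy := hz.2.1
  have h1 := one_le_tau z
  have hg := gradSq_nonneg (G z)
  have hrho : rho z ^ (-2 : ℝ) = (tau z)⁻¹ := by
    rw [rho_rpow, show (-2 : ℝ) / 2 = -1 by norm_num, Real.rpow_neg_one]
  have h2 : U z ^ 2 + gradSq (G z) ≤ T * (gradSq (G z) + (tau z)⁻¹ * U z ^ 2) := by
    have h3 : 1 ≤ T * (tau z)⁻¹ := by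
      rw [← div_eq_mul_inv, one_le_div (tau_pos z)]
      exact hT
    nlinarith [sq_nonneg (U z)]
  rw [abs_mul, abs_of_pos (Real.rpow_pos_of_pos hy α), energyDensity, hrho]
  have := Real.rpow_pos_of_pos hy α
  calc z.2 ^ α * |f| ≤ z.2 ^ α * (K * (T * (gradSq (G z) + (tau z)⁻¹ * U z ^ 2))) := by
        gcongr
        exact hf.trans (by gcongr)
    _ = _ := by ring

end Integrable

namespace RadialMultiplier

variable {κ : ℝ → ℝ} {T : ℝ}

theorem continuous_comp_tau (h : RadialMultiplier κ T) :
    Continuous fun z : E d × ℝ => κ (tau z) :=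
  h.contDiffOn.continuousOn.comp_continuous continuous_tau tau_pos

theorem continuous_deriv_comp_tau (h : RadialMultiplier κ T) :
    Continuous fun z : E d × ℝ => deriv κ (tau z) :=
  h.continuousOn_deriv.comp_continuous continuous_tau tau_pos

end RadialMultiplier

/-- The integrand of the horizontal multiplier identity. -/
def horizontalForm (R : ℝ) (κ : ℝ → ℝ) (U : E d × ℝ → ℝ) (G : E d × ℝ → E d × ℝ →L[ℝ] ℝ)
    (z : E d × ℝ) : ℝ :=
  outerCutoff R z.1 * ((d * κ (tau z) + 2 * ‖z.1‖ ^ 2 * deriv κ (tau z)) * U z ^ 2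
    + 2 * κ (tau z) * (U z * (G z).comp (ContinuousLinearMap.inl ℝ (E d) ℝ) z.1))

/-- The integrand of the vertical multiplier identity. -/
def verticalForm (α R : ℝ) (κ : ℝ → ℝ) (U : E d × ℝ → ℝ) (G : E d × ℝ → E d × ℝ →L[ℝ] ℝ)
    (z : E d × ℝ) : ℝ :=
  outerCutoff R z.1 * (((1 + α) * κ (tau z) + 2 * z.2 ^ 2 * deriv κ (tau z)) * U z ^ 2
    + 2 * κ (tau z) * (U z * (z.2 * G z (0, 1))))

section Forms

variable {α : ℝ} {Ω : Set (E d)} {Y : EReal} {U : E d × ℝ → ℝ} {G : E d × ℝ → E d × ℝ →L[ℝ] ℝ}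
  {κ : ℝ → ℝ} {T : ℝ}

theorem abs_inl_apply_sq_le (L : E d × ℝ →L[ℝ] ℝ) (z : E d × ℝ) :
    (L.comp (ContinuousLinearMap.inl ℝ (E d) ℝ) z.1) ^ 2 ≤ tau z * gradSq L := by
  have h := (L.comp (ContinuousLinearMap.inl ℝ (E d) ℝ)).le_opNorm z.1
  rw [Real.norm_eq_abs] at h
  have h2 := pow_le_pow_left₀ (abs_nonneg _) h 2
  rw [sq_abs, mul_pow] at h2
  refine h2.trans ?_
  unfold tau gradSq
  nlinarith [sq_nonneg ‖z.1‖, sq_nonneg z.2, sq_nonneg (L (0, 1)),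
    sq_nonneg ‖L.comp (ContinuousLinearMap.inl ℝ (E d) ℝ)‖,
    mul_nonneg (sq_nonneg ‖z.1‖) (sq_nonneg (L (0, 1))),
    mul_nonneg (sq_nonneg z.2) (sq_nonneg ‖L.comp (ContinuousLinearMap.inl ℝ (E d) ℝ)‖),
    mul_nonneg (sq_nonneg z.2) (sq_nonneg (L (0, 1)))]

theorem snd_mul_apply_sq_le (L : E d × ℝ →L[ℝ] ℝ) (z : E d × ℝ) :
    (z.2 * L (0, 1)) ^ 2 ≤ tau z * gradSq L := by
  unfold tau gradSq
  nlinarith [sq_nonneg ‖z.1‖, sq_nonneg z.2, sq_nonneg (L (0, 1)),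
    sq_nonneg ‖L.comp (ContinuousLinearMap.inl ℝ (E d) ℝ)‖,
    mul_nonneg (sq_nonneg ‖z.1‖) (sq_nonneg (L (0, 1))),
    mul_nonneg (sq_nonneg ‖z.1‖) (sq_nonneg ‖L.comp (ContinuousLinearMap.inl ℝ (E d) ℝ)‖),
    mul_nonneg (sq_nonneg z.2) (sq_nonneg ‖L.comp (ContinuousLinearMap.inl ℝ (E d) ℝ)‖)]

theorem aestronglyMeasurable_inl_apply {ν : Measure (E d × ℝ)} (hG : AEStronglyMeasurable G ν) :
    AEStronglyMeasurable (fun z => (G z).comp (ContinuousLinearMap.inl ℝ (E d) ℝ) z.1) ν := by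
  have hc : Continuous fun p : (E d × ℝ →L[ℝ] ℝ) × (E d × ℝ) =>
      p.1 (ContinuousLinearMap.inl ℝ (E d) ℝ p.2.1) := by fun_prop
  exact hc.comp_aestronglyMeasurable (hG.prodMk aestronglyMeasurable_id)

/-- Bound for a form with coefficients bounded by `N`. -/
theorem abs_form_le {ψ N p q u s gr T : ℝ} (hψ0 : 0 ≤ ψ) (hψ1 : ψ ≤ 1) (hp : |p| ≤ N)
    (hq : |q| ≤ N) (hT : 1 ≤ T) (hgr : 0 ≤ gr) (hs : s ^ 2 ≤ T * gr) :
    |ψ * (p * u ^ 2 + 2 * q * (u * s))| ≤ 2 * N * T * (u ^ 2 + gr) := by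
  have hN : 0 ≤ N := (abs_nonneg p).trans hp
  have hus : |u * s| * 2 ≤ u ^ 2 + T * gr := by
    rw [abs_mul]
    nlinarith [sq_nonneg (|u| - |s|), sq_abs u, sq_abs s]
  rw [abs_mul, abs_of_nonneg hψ0]
  calc ψ * |p * u ^ 2 + 2 * q * (u * s)| ≤ 1 * |p * u ^ 2 + 2 * q * (u * s)| := by gcongr
    _ ≤ |p * u ^ 2| + |2 * q * (u * s)| := by rw [one_mul]; exact abs_add_le _ _
    _ = |p| * u ^ 2 + |q| * (|u * s| * 2) := by
        rw [abs_mul, abs_of_nonneg (sq_nonneg u), abs_mul, abs_mul 2 q, abs_two]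
        ring
    _ ≤ N * u ^ 2 + N * (u ^ 2 + T * gr) := by gcongr
    _ ≤ 2 * N * T * (u ^ 2 + gr) := by
        nlinarith [mul_nonneg hN hgr, mul_nonneg hN (sq_nonneg u),
          mul_nonneg (mul_nonneg hN (sq_nonneg u)) (sub_nonneg.2 hT),
          mul_nonneg (mul_nonneg hN hgr) (sub_nonneg.2 hT)]

theorem isCompact_tau_le (T : ℝ) : IsCompact {z : E d × ℝ | tau z ≤ T} := by
  refine Metric.isCompact_of_isClosed_isBounded (isClosed_le continuous_tau continuous_const)
    (isBounded_iff_forall_norm_le.2 ⟨T, fun z hz => ?_⟩)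
  have hz' : 1 + ‖z.1‖ ^ 2 + z.2 ^ 2 ≤ T := hz
  rw [Prod.norm_def, max_le_iff, Real.norm_eq_abs]
  exact ⟨by nlinarith [sq_nonneg (‖z.1‖ - 1), sq_nonneg z.2],
    by nlinarith [sq_nonneg (|z.2| - 1), sq_nonneg ‖z.1‖, sq_abs z.2]⟩

/-- Shared by both forms: their coefficients are bounded with support in the compact set `tau ≤ T`,
and the cross term is at most quadratic in `U` and its gradient by the bound on `s`, so the H¹_ρ
energy dominates. -/
theorem MemH1rho.integrableOn_form (h : MemH1rho α (cutCylinder Ω Y) U G) (R : ℝ)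
    {p q s : E d × ℝ → ℝ} (hp : Continuous p) (hq : Continuous q)
    (hs : AEStronglyMeasurable s (volume.restrict (cutCylinder Ω Y)))
    (hsg : ∀ z, s z ^ 2 ≤ tau z * gradSq (G z))
    (hpT : ∀ z, T < tau z → p z = 0) (hqT : ∀ z, T < tau z → q z = 0) :
    IntegrableOn (fun z => z.2 ^ α * (outerCutoff R z.1 * (p z * U z ^ 2 + 2 * q z * (U z * s z))))
      (cutCylinder Ω Y) := by
  obtain ⟨N₁, hN₁⟩ := (isCompact_tau_le (d := d) T).exists_bound_of_continuousOn hp.continuousOn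
  obtain ⟨N₂, hN₂⟩ := (isCompact_tau_le (d := d) T).exists_bound_of_continuousOn hq.continuousOn
  have hU := h.1.1.aestronglyMeasurable
  refine h.integrableOn_of_le (M := 2 * max 0 (max N₁ N₂) * max T 1 * max T 1) ?_ fun z hz => ?_
  · have c2 : Continuous fun z : E d × ℝ => outerCutoff R z.1 :=
      (contDiff_outerCutoff R).continuous.comp continuous_fst
    exact (measurable_snd_rpow α).aestronglyMeasurable.mul
      (c2.aestronglyMeasurable.mul ((hp.aestronglyMeasurable.mul (hU.pow 2)).add
        ((continuous_const.mul hq).aestronglyMeasurable.mul (hU.mul hs))))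
  · have hT1 : (1 : ℝ) ≤ max T 1 := le_max_right _ _
    by_cases hT : tau z ≤ T
    · have hT' := hT.trans (le_max_left T 1)
      refine abs_le_energyDensity (by positivity) hz hT' ?_
      refine abs_form_le (outerCutoff_nonneg _ _) (outerCutoff_le_one _ _) ?_ ?_ hT1
        (gradSq_nonneg _) ((hsg z).trans (by gcongr; exact gradSq_nonneg _))
      · exact (hN₁ z hT).trans ((le_max_left _ _).trans (le_max_right _ _))
      · exact (hN₂ z hT).trans ((le_max_right _ _).trans (le_max_right _ _))
    · rw [hpT z (not_le.1 hT), hqT z (not_le.1 hT)]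
      have := energyDensity_nonneg (α := α) (U := U) (G := G) hz
      simp only [zero_mul, mul_zero, add_zero, abs_zero]
      positivity

theorem MemH1rho.integrableOn_horizontalForm (h : MemH1rho α (cutCylinder Ω Y) U G)
    (hκ : RadialMultiplier κ T) (R : ℝ) :
    IntegrableOn (fun z => z.2 ^ α * horizontalForm R κ U G z) (cutCylinder Ω Y) := by
  have c0 : Continuous fun z : E d × ℝ => κ (tau z) := hκ.continuous_comp_tau
  have c1 : Continuous fun z : E d × ℝ => deriv κ (tau z) := hκ.continuous_deriv_comp_tau
  refine h.integrableOn_form (T := T) R ?_ c0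
    (aestronglyMeasurable_inl_apply h.1.2.1.aestronglyMeasurable)
    (fun z => abs_inl_apply_sq_le _ _) (fun z hz => ?_) (fun z hz => hκ.eq_zero _ hz.le)
  · exact (continuous_const.mul c0).add
      ((continuous_const.mul (continuous_fst.norm.pow 2)).mul c1)
  · simp [hκ.eq_zero _ hz.le, hκ.deriv_eq_zero hz]

theorem MemH1rho.integrableOn_verticalForm (h : MemH1rho α (cutCylinder Ω Y) U G)
    (hκ : RadialMultiplier κ T) (R : ℝ) :
    IntegrableOn (fun z => z.2 ^ α * verticalForm α R κ U G z) (cutCylinder Ω Y) := by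
  have c0 : Continuous fun z : E d × ℝ => κ (tau z) := hκ.continuous_comp_tau
  have c1 : Continuous fun z : E d × ℝ => deriv κ (tau z) := hκ.continuous_deriv_comp_tau
  refine h.integrableOn_form (T := T) R ?_ c0 ?_
    (fun z => snd_mul_apply_sq_le _ _) (fun z hz => ?_) (fun z hz => hκ.eq_zero _ hz.le)
  · exact (continuous_const.mul c0).add ((continuous_const.mul (continuous_snd.pow 2)).mul c1)
  · exact continuous_snd.aestronglyMeasurable.mul
      ((ContinuousLinearMap.apply ℝ ℝ ((0, 1) : E d × ℝ)).continuous.comp_aestronglyMeasurable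
        h.1.2.1.aestronglyMeasurable)
  · simp [hκ.eq_zero _ hz.le, hκ.deriv_eq_zero hz]

theorem volume_restrict_cutCylinder (Ω : Set (E d)) (Y : EReal) :
    (volume : Measure (E d × ℝ)).restrict (cutCylinder Ω Y) =
      (volume.restrict (frontier Ω)ᶜ).prod (volume.restrict (yInterval Y)) := by
  rw [Measure.prod_restrict]
  rfl

/-- Fubini reduces to slices. Almost every slice has an exterior trace, which supplies the smooth
approximations needed there; the cutoff discards the closure of `Ω`. -/
theorem integral_horizontalForm_le (h : MemH1rho α (cutCylinder Ω Y) U G)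
    (hj : ∀ᵐ y : ℝ, y ∈ yInterval Y → JumpMeanZero Ω (fun x => U (x, y))) {R : ℝ}
    (hR : ∀ x ∈ closure Ω, ‖x‖ ^ 2 ≤ R ^ 2) (hκ : RadialMultiplier κ T) :
    ∫ z in cutCylinder Ω Y, z.2 ^ α * horizontalForm R κ U G z ≤ 0 := by
  have hi := h.integrableOn_horizontalForm hκ R
  rw [IntegrableOn, volume_restrict_cutCylinder] at hi
  rw [volume_restrict_cutCylinder, integral_prod_symm _ hi]
  refine integral_nonpos_of_ae ?_
  have hslice := h.1.ae_slice_fst isClosed_frontier.isOpen_compl (isOpen_yInterval Y)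
  refine (ae_restrict_iff' (isOpen_yInterval Y).measurableSet).2 ?_
  filter_upwards [hslice, hj] with y hy hjy hyY
  obtain ⟨gi, ge, -, hge, -⟩ := hjy hyY
  have heo : IsOpen (closure Ω)ᶜ := isClosed_closure.isOpen_compl
  have hsub : (closure Ω)ᶜ ⊆ (frontier Ω)ᶜ := compl_subset_compl.2 frontier_subset_closure
  obtain ⟨φ, hφ⟩ := hge.exists_traceApprox heo hsub (hy hyY)
  have hRe : ∀ x : E d, R ^ 2 < ‖x‖ ^ 2 → x ∈ (closure Ω)ᶜ :=
    fun x hx hxc => (hR x hxc).not_gt hx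
  have key := hφ.integral_outerCutoff_le heo hRe hκ (b := 1 + y ^ 2) (by positivity)
  simp only [integral_const_mul]
  refine mul_nonpos_of_nonneg_of_nonpos (Real.rpow_nonneg hyY.1.le α) ?_
  rw [setIntegral_eq_of_subset_of_forall_sdiff_eq_zero isClosed_frontier.isOpen_compl.measurableSet
    hsub fun x hx => ?_]
  · refine le_of_eq_of_le (integral_congr_ae (ae_of_all _ fun x => ?_)) key
    simp only [horizontalForm, tau]
    rw [show 1 + ‖x‖ ^ 2 + y ^ 2 = 1 + y ^ 2 + ‖x‖ ^ 2 by ring]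
  · have : outerCutoff R x = 0 := outerCutoff_eq_zero (hR x (not_not.1 hx.2))
    simp [horizontalForm, this]

/-- Fubini over vertical lines; the cutoff depends on `x` only and is a nonnegative constant factor
on each of them. -/
theorem integral_verticalForm_le (h : MemH1rho α (cutCylinder Ω ⊤) U G) (R : ℝ)
    (hκ : RadialMultiplier κ T) :
    ∫ z in cutCylinder Ω ⊤, z.2 ^ α * verticalForm α R κ U G z ≤ 0 := by
  have hi := h.integrableOn_verticalForm hκ R
  rw [IntegrableOn, volume_restrict_cutCylinder] at hi
  rw [volume_restrict_cutCylinder, integral_prod _ hi]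
  refine integral_nonpos_of_ae ?_
  have h1 := h.1
  unfold cutCylinder at h1
  rw [yInterval_top] at h1 ⊢
  have hslice := h1.ae_slice_snd isClosed_frontier.isOpen_compl
  refine (ae_restrict_iff' isClosed_frontier.isOpen_compl.measurableSet).2 ?_
  filter_upwards [hslice] with x hx hxD
  obtain ⟨hg, c, hc⟩ := hx hxD
  have key := integral_vertical_le hκ α (b := 1 + ‖x‖ ^ 2) (by positivity) hg hc
  refine le_of_eq_of_le ?_ (mul_nonpos_of_nonneg_of_nonpos (outerCutoff_nonneg R x) key)
  rw [← integral_const_mul]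
  refine integral_congr_ae (ae_of_all _ fun t => ?_)
  simp only [verticalForm, tau]
  ring

/-- The amount by which a multiplier fails to satisfy `t κ' ≥ -κ`. -/
def multiplierDefect (κ : ℝ → ℝ) (t : ℝ) : ℝ := max 0 (-κ t - t * deriv κ t)

/-- With m = X² + θ Y² ≤ t, the near monotonicity of t κ gives m κ₁ ≥ -κ₀ - e, so the coefficient of
u² is at least (n + θ a - 2) κ₀ - 2 e = c κ₀ - 2 e. Half of c κ₀ u² then absorbs the cross term by
completing a square. -/
theorem form_lower_bound {κ₀ κ₁ e t c n X Y u gx b a L θ : ℝ} (hc : 0 < c) (hκ : 0 ≤ κ₀)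
    (he : -κ₀ - t * κ₁ ≤ e) (he0 : 0 ≤ e) (ht : t = 1 + X ^ 2 + Y ^ 2) (hθ : θ = 0 ∨ θ = 1)
    (hn : n + θ * a - 2 = c) (hgx : |gx| ≤ L * X) :
    c / 2 * (κ₀ * u ^ 2) ≤ ((n * κ₀ + 2 * X ^ 2 * κ₁) * u ^ 2 + 2 * κ₀ * (u * gx))
      + θ * ((a * κ₀ + 2 * Y ^ 2 * κ₁) * u ^ 2 + 2 * κ₀ * (u * (Y * b)))
      + 2 / c * (t * κ₀ * (L ^ 2 + b ^ 2)) + 2 * (e * u ^ 2) := by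
  have ht0 : 0 < t := by rw [ht]; positivity
  set m := X ^ 2 + θ * Y ^ 2 with hm
  have hm0 : 0 ≤ m := by rcases hθ with rfl | rfl <;> simp only [hm] <;> positivity
  have hmt : m ≤ t := by
    rcases hθ with rfl | rfl <;> simp only [hm, ht] <;> nlinarith [sq_nonneg Y]
  -- Multiplied by t, this is m (t κ₁ + κ₀ + e) + (t - m)(κ₀ + e), a sum of nonnegative terms.
  have hcoef : 0 ≤ m * κ₁ + κ₀ + e := by
    have : 0 ≤ t * (m * κ₁ + κ₀ + e) := by
      have h1 := mul_nonneg hm0 (by linarith : 0 ≤ t * κ₁ + κ₀ + e)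
      have h2 := mul_nonneg (sub_nonneg.2 hmt) (by linarith : 0 ≤ κ₀ + e)
      linarith
    exact nonneg_of_mul_nonneg_right this ht0
  set s := gx + θ * (Y * b) with hs
  have hgx2 : gx ^ 2 ≤ L ^ 2 * X ^ 2 := by
    have := pow_le_pow_left₀ (abs_nonneg gx) hgx 2
    rwa [sq_abs, mul_pow] at this
  have hs2 : s ^ 2 ≤ t * (L ^ 2 + b ^ 2) := by
    have h1 : (gx + Y * b) ^ 2 ≤ (X ^ 2 + Y ^ 2) * (L ^ 2 + b ^ 2) := by
      have h2 : 2 * (gx * (Y * b)) ≤ (L * Y) ^ 2 + (X * b) ^ 2 := by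
        have h3 : gx * (Y * b) ≤ L * X * |Y * b| :=
          (le_abs_self _).trans (by rw [abs_mul]; gcongr)
        have h4 : L * X * |Y * b| ≤ |L * Y| * |X * b| := by
          rw [abs_mul, abs_mul, abs_mul]
          have : L * X ≤ |L| * |X| := by rw [← abs_mul]; exact le_abs_self _
          calc L * X * (|Y| * |b|) ≤ |L| * |X| * (|Y| * |b|) := by gcongr
            _ = _ := by ring
        nlinarith [sq_nonneg (|L * Y| - |X * b|), sq_abs (L * Y), sq_abs (X * b)]
      nlinarith
    have h5 : 0 ≤ L ^ 2 + b ^ 2 := by positivity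
    rcases hθ with rfl | rfl
    · simp only [hs, zero_mul, add_zero]
      rw [ht]
      nlinarith [mul_nonneg (sq_nonneg X) (sq_nonneg b), mul_nonneg (sq_nonneg Y) h5]
    · simp only [hs, one_mul]
      rw [ht]
      nlinarith
  have hcross : 0 ≤ c / 2 * u ^ 2 + 2 * (u * s) + 2 / c * s ^ 2 := by
    have : c / 2 * u ^ 2 + 2 * (u * s) + 2 / c * s ^ 2 = (c * u + 2 * s) ^ 2 / (2 * c) := by
      field_simp
      ring
    rw [this]
    positivity
  have h6 := mul_nonneg hκ hcross
  have h7 : 2 / c * (κ₀ * s ^ 2) ≤ 2 / c * (κ₀ * (t * (L ^ 2 + b ^ 2))) := by gcongr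
  have h8 := mul_nonneg (sq_nonneg u) hcoef
  have hne : n = c + 2 - θ * a := by linarith
  rw [hne]
  simp only [hs, hm] at h6 h7 h8 ⊢
  nlinarith [h6, h7, h8]

theorem multiplierDefect_nonneg (κ : ℝ → ℝ) (t : ℝ) : 0 ≤ multiplierDefect κ t := le_max_left _ _

theorem continuous_multiplierDefect_comp_tau (hκ : RadialMultiplier κ T) :
    Continuous fun z : E d × ℝ => multiplierDefect κ (tau z) :=
  continuous_const.max (hκ.continuous_comp_tau.neg.sub
    (continuous_tau.mul hκ.continuous_deriv_comp_tau))

/-- Passes from a signed inequality between Bochner integrals to one in `[0, ∞]`; the term `A`, of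
nonpositive integral, is dropped, and `B` may have infinite integral. -/
theorem lintegral_ofReal_le_of_le_add {X : Type*} [MeasurableSpace X] {ν : Measure X}
    {f A B : X → ℝ} (hf : Integrable f ν) (hA : Integrable A ν) (hA0 : ∫ x, A x ∂ν ≤ 0)
    (hB : AEStronglyMeasurable B ν) (hf0 : ∀ᵐ x ∂ν, 0 ≤ f x) (hB0 : ∀ᵐ x ∂ν, 0 ≤ B x)
    (h : ∀ᵐ x ∂ν, f x ≤ A x + B x) :
    ∫⁻ x, ENNReal.ofReal (f x) ∂ν ≤ ∫⁻ x, ENNReal.ofReal (B x) ∂ν := by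
  rcases eq_or_ne (∫⁻ x, ENNReal.ofReal (B x) ∂ν) ⊤ with htop | htop
  · rw [htop]
    exact le_top
  have hBi : Integrable B ν :=
    ⟨hB, (hasFiniteIntegral_iff_ofReal hB0).2 (lt_top_iff_ne_top.2 htop)⟩
  rw [← ofReal_integral_eq_lintegral_ofReal hf hf0, ← ofReal_integral_eq_lintegral_ofReal hBi hB0]
  refine ENNReal.ofReal_le_ofReal ?_
  have := integral_mono_ae hf (hA.add hBi) h
  rw [integral_add' hA hBi] at this
  linarith

/-- The weighted estimate resulting from a multiplier, up to its defect. -/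
theorem MemH1rho.lintegral_multiplier_le (h : MemH1rho α (cutCylinder Ω Y) U G)
    (hj : ∀ᵐ y : ℝ, y ∈ yInterval Y → JumpMeanZero Ω (fun x => U (x, y))) {R : ℝ}
    (hR : ∀ x ∈ closure Ω, ‖x‖ ^ 2 ≤ R ^ 2) (hκ : RadialMultiplier κ T) {θ c : ℝ} (hc : 0 < c)
    (hθ : θ = 0 ∨ θ = 1 ∧ Y = ⊤) (hcd : d + θ * (1 + α) - 2 = c) :
    ENNReal.ofReal (c / 2) * ∫⁻ z in cutCylinder Ω Y,
        ENNReal.ofReal (z.2 ^ α * (outerCutoff R z.1 * (κ (tau z) * U z ^ 2))) ≤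
      ENNReal.ofReal (2 / c) * (∫⁻ z in cutCylinder Ω Y,
        ENNReal.ofReal (z.2 ^ α * (tau z * κ (tau z) * gradSq (G z)))) +
      2 * ∫⁻ z in cutCylinder Ω Y,
        ENNReal.ofReal (z.2 ^ α * (multiplierDefect κ (tau z) * U z ^ 2)) := by
  have hD := (isOpen_cutCylinder Ω Y).measurableSet
  set ν := (volume : Measure (E d × ℝ)).restrict (cutCylinder Ω Y) with hν
  have hU : AEStronglyMeasurable U ν := h.1.1.aestronglyMeasurable
  have hG := aestronglyMeasurable_gradSq (h.1.2.1.aestronglyMeasurable : AEStronglyMeasurable G ν)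
  have hα : AEStronglyMeasurable (fun z : E d × ℝ => z.2 ^ α) ν :=
    (measurable_snd_rpow α).aestronglyMeasurable
  have c0 : Continuous fun z : E d × ℝ => κ (tau z) := hκ.continuous_comp_tau
  have mq : AEStronglyMeasurable (fun z => z.2 ^ α * (tau z * κ (tau z) * gradSq (G z))) ν :=
    hα.mul ((continuous_tau.mul c0).aestronglyMeasurable.mul hG)
  have mr : AEStronglyMeasurable
      (fun z => z.2 ^ α * (multiplierDefect κ (tau z) * U z ^ 2)) ν :=
    hα.mul ((continuous_multiplierDefect_comp_tau hκ).aestronglyMeasurable.mul (hU.pow 2))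
  have hκ0 : ∀ z : E d × ℝ, 0 ≤ κ (tau z) := fun z => hκ.nonneg _ (tau_pos z)
  have hA : IntegrableOn (fun z => z.2 ^ α * horizontalForm R κ U G z
      + θ * (z.2 ^ α * verticalForm α R κ U G z)) (cutCylinder Ω Y) :=
    (h.integrableOn_horizontalForm hκ R).add ((h.integrableOn_verticalForm hκ R).const_mul θ)
  -- The vertical form takes part only for θ = 1, which forces the half line, where its integral is
  -- known to be nonpositive.
  have hA0 : ∫ z, (z.2 ^ α * horizontalForm R κ U G z
      + θ * (z.2 ^ α * verticalForm α R κ U G z)) ∂ν ≤ 0 := by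
    rw [integral_add (h.integrableOn_horizontalForm hκ R)
      ((h.integrableOn_verticalForm hκ R).const_mul θ), integral_const_mul]
    have h1 := integral_horizontalForm_le h hj hR hκ
    rcases hθ with rfl | ⟨rfl, rfl⟩
    · rw [zero_mul, add_zero]
      exact h1
    · rw [one_mul]
      exact add_nonpos h1 (integral_verticalForm_le h R hκ)
  have hp : IntegrableOn (fun z => c / 2 * (z.2 ^ α * (outerCutoff R z.1 * (κ (tau z) * U z ^ 2))))
      (cutCylinder Ω Y) := by
    have := h.integrableOn_form (T := T) R c0 continuous_const (q := fun _ => 0) (s := fun _ => 0)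
      aestronglyMeasurable_const (fun z => by
        rw [sq, zero_mul]
        exact mul_nonneg (tau_pos z).le (gradSq_nonneg (G z))) (fun z hz => hκ.eq_zero _ hz.le) fun _ _ => rfl
    simp only [mul_zero, add_zero] at this
    exact this.const_mul _
  have key := lintegral_ofReal_le_of_le_add (ν := ν)
    (B := fun z => 2 / c * (z.2 ^ α * (tau z * κ (tau z) * gradSq (G z)))
      + 2 * (z.2 ^ α * (multiplierDefect κ (tau z) * U z ^ 2))) hp hA hA0
    ((mq.const_mul _).add (mr.const_mul _)) ?_ ?_ ?_
  · have hpos : ∀ᵐ z ∂ν, 0 ≤ z.2 ^ α :=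
      (ae_restrict_iff' hD).2 (ae_of_all _ fun z hz => Real.rpow_nonneg hz.2.1.le α)
    have e1 : ∫⁻ z, ENNReal.ofReal (c / 2 *
        (z.2 ^ α * (outerCutoff R z.1 * (κ (tau z) * U z ^ 2)))) ∂ν =
        ENNReal.ofReal (c / 2) * ∫⁻ z, ENNReal.ofReal
          (z.2 ^ α * (outerCutoff R z.1 * (κ (tau z) * U z ^ 2))) ∂ν := by
      rw [← lintegral_const_mul' _ _ ENNReal.ofReal_ne_top]
      simp only [ENNReal.ofReal_mul (half_pos hc).le]
    rw [← e1]
    refine key.trans (le_of_eq ?_)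
    rw [← lintegral_const_mul' _ _ ENNReal.ofReal_ne_top,
      ← lintegral_const_mul' _ _ ENNReal.ofNat_ne_top,
      ← lintegral_add_left' (mq.aemeasurable.ennreal_ofReal.const_mul _)]
    refine lintegral_congr_ae ?_
    filter_upwards [hpos] with z hz
    have h1 := hκ0 z
    have h2 := gradSq_nonneg (G z)
    have h3 := tau_pos z
    have h4 := multiplierDefect_nonneg κ (tau z)
    rw [ENNReal.ofReal_add (by positivity) (by positivity), ENNReal.ofReal_mul (by positivity),
      ENNReal.ofReal_mul zero_le_two, ENNReal.ofReal_ofNat]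
  · refine (ae_restrict_iff' hD).2 (ae_of_all _ fun z hz => ?_)
    have h1 := hκ0 z
    have := outerCutoff_nonneg R z.1
    have := Real.rpow_nonneg hz.2.1.le α
    positivity
  · refine (ae_restrict_iff' hD).2 (ae_of_all _ fun z hz => ?_)
    have h1 := hκ0 z
    have h2 := gradSq_nonneg (G z)
    have h3 := tau_pos z
    have h4 := multiplierDefect_nonneg κ (tau z)
    have := Real.rpow_nonneg hz.2.1.le α
    positivity
  · refine (ae_restrict_iff' hD).2 (ae_of_all _ fun z hz => ?_)
    have h1 := hκ0 z
    have h2 := gradSq_nonneg (G z)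
    have h3 := tau_pos z
    have h4 := multiplierDefect_nonneg κ (tau z)
    have hy := Real.rpow_nonneg hz.2.1.le α
    set L := (G z).comp (ContinuousLinearMap.inl ℝ (E d) ℝ) with hL
    have hlow := form_lower_bound (u := U z) (gx := L z.1) (b := G z (0, 1)) (X := ‖z.1‖)
      (Y := z.2) (L := ‖L‖) (a := 1 + α) (n := d) hc h1 (le_max_right _ _) h4 (t := tau z) rfl
      (hθ.imp_right And.left) hcd (L.le_opNorm z.1)
    have hψ0 := outerCutoff_nonneg R z.1
    have hψ1 := outerCutoff_le_one R z.1
    have hq0 : 0 ≤ 2 / c * (tau z * κ (tau z) * gradSq (G z))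
        + 2 * (multiplierDefect κ (tau z) * U z ^ 2) := by positivity
    have h5 := mul_le_mul_of_nonneg_left hlow hψ0
    have h6 := mul_le_mul_of_nonneg_right hψ1 hq0
    have h7 : c / 2 * (outerCutoff R z.1 * (κ (tau z) * U z ^ 2)) ≤
        horizontalForm R κ U G z + θ * verticalForm α R κ U G z
          + (2 / c * (tau z * κ (tau z) * gradSq (G z))
            + 2 * (multiplierDefect κ (tau z) * U z ^ 2)) := by
      rw [multiplierDefect] at h6 ⊢
      simp only [horizontalForm, verticalForm, gradSq, ← hL] at h5 h6 ⊢
      linarith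
    have h8 := mul_le_mul_of_nonneg_left h7 hy
    linarith

end Forms

end

/-! ### Truncated power multipliers and the exterior Hardy inequality. -/

section


/-- Fatou's lemma on the left, with a bound on the right that holds up to a vanishing error; serves
every truncation below. -/
theorem mul_lintegral_le_of_tendsto {X : Type*} [MeasurableSpace X] {ν : Measure X} {c M : ℝ≥0∞}
    (hc : c ≠ ⊤) {F : ℕ → X → ℝ≥0∞} {F₀ : X → ℝ≥0∞} (hF : ∀ n, AEMeasurable (F n) ν)
    (hlim : ∀ᵐ x ∂ν, Tendsto (fun n => F n x) atTop (𝓝 (F₀ x))) {e : ℕ → ℝ≥0∞}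
    (he : Tendsto e atTop (𝓝 0)) (h : ∀ n, c * ∫⁻ x, F n x ∂ν ≤ M + e n) :
    c * ∫⁻ x, F₀ x ∂ν ≤ M := by
  calc c * ∫⁻ x, F₀ x ∂ν = ∫⁻ x, liminf (fun n => c * F n x) atTop ∂ν := by
        rw [← lintegral_const_mul' _ _ hc]
        refine lintegral_congr_ae ?_
        filter_upwards [hlim] with x hx
        exact (ENNReal.Tendsto.const_mul hx (Or.inr hc)).liminf_eq.symm
    _ ≤ liminf (fun n => ∫⁻ x, c * F n x ∂ν) atTop :=
        lintegral_liminf_le' fun n => (hF n).const_mul c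
    _ ≤ liminf (fun n => M + e n) atTop := by
        refine liminf_le_liminf (Eventually.of_forall fun n => ?_)
        rw [lintegral_const_mul' _ _ hc]
        exact h n
    _ = M := by
        have : Tendsto (fun n => M + e n) atTop (𝓝 (M + 0)) := tendsto_const_nhds.add he
        rw [this.liminf_eq, add_zero]

theorem exists_deriv_smoothTransition_le :
    ∃ B : ℝ, 0 ≤ B ∧ ∀ x, deriv Real.smoothTransition x ≤ B ∧
      (x < 0 ∨ 1 < x → deriv Real.smoothTransition x = 0) := by
  have hc : Continuous (deriv Real.smoothTransition) :=
    (Real.smoothTransition.contDiff (n := 1)).continuous_deriv (by norm_num)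
  have h0 : ∀ x, x < 0 ∨ 1 < x → deriv Real.smoothTransition x = 0 := by
    rintro x (hx | hx)
    · have : Real.smoothTransition =ᶠ[𝓝 x] fun _ => 0 := by
        filter_upwards [Iio_mem_nhds hx] with y hy
        exact Real.smoothTransition.zero_of_nonpos (le_of_lt hy)
      rw [this.deriv_eq, deriv_const]
    · have : Real.smoothTransition =ᶠ[𝓝 x] fun _ => 1 := by
        filter_upwards [Ioi_mem_nhds hx] with y hy
        exact Real.smoothTransition.one_of_one_le (le_of_lt hy)
      rw [this.deriv_eq, deriv_const]
  obtain ⟨B, hB⟩ := (isCompact_Icc (a := (0 : ℝ)) (b := 1)).exists_bound_of_continuousOn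
    hc.continuousOn
  refine ⟨max B 0, le_max_right _ _, fun x => ⟨?_, h0 x⟩⟩
  by_cases hx : x ∈ Icc (0 : ℝ) 1
  · exact (le_abs_self _).trans ((hB x hx).trans (le_max_left _ _))
  · rw [h0 x (by
      by_contra hcon
      push Not at hcon
      exact hx hcon)]
    exact le_max_right _ _

/-- The truncation `(t / (1 + δ t)) ^ s` of the power `t ^ s`. -/
def truncPow (s δ t : ℝ) : ℝ := (t / (1 + δ * t)) ^ s

/-- The multiplier `t ^ (s - 1)`, with the growth truncated and cut off beyond `N`. -/
def hardyMultiplier (s δ N t : ℝ) : ℝ :=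
  truncPow s δ t * Real.smoothTransition (2 - t / N) / t

section Multiplier

variable {s δ N t : ℝ}

theorem truncPow_nonneg (hδ : 0 ≤ δ) (ht : 0 < t) : 0 ≤ truncPow s δ t := by
  unfold truncPow
  positivity

theorem truncPow_le (hs : 0 ≤ s) (hδ : 0 ≤ δ) (ht : 0 < t) : truncPow s δ t ≤ t ^ s := by
  unfold truncPow
  refine Real.rpow_le_rpow (by positivity) ?_ hs
  rw [div_le_iff₀ (by positivity)]
  nlinarith [mul_nonneg hδ (sq_nonneg t)]

theorem truncPow_le' (hs : 0 ≤ s) (hδ : 0 < δ) (ht : 0 < t) : truncPow s δ t ≤ (1 / δ) ^ s := by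
  unfold truncPow
  refine Real.rpow_le_rpow (by positivity) ?_ hs
  rw [div_le_div_iff₀ (by positivity) hδ]
  linarith

theorem hasDerivAt_truncPow (hs : 0 ≤ s) (hδ : 0 ≤ δ) (ht : 0 < t) :
    ∃ w' : ℝ, 0 ≤ w' ∧ HasDerivAt (truncPow s δ) w' t := by
  have h1 : 0 < 1 + δ * t := by positivity
  have hb : HasDerivAt (fun t : ℝ => t / (1 + δ * t)) (1 / (1 + δ * t) ^ 2) t := by
    have h2 : HasDerivAt (fun t : ℝ => 1 + δ * t) δ t := by
      simpa using ((hasDerivAt_id t).const_mul δ).const_add 1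
    exact HasDerivAt.congr_deriv ((hasDerivAt_id' t).div h2 h1.ne')
      (show (1 * (1 + δ * t) - t * δ) / (1 + δ * t) ^ 2 = 1 / (1 + δ * t) ^ 2 by ring)
  have hpos : 0 < t / (1 + δ * t) := by positivity
  refine ⟨_, ?_, hb.rpow_const (Or.inl hpos.ne')⟩
  positivity

theorem contDiffOn_truncPow (hδ : 0 ≤ δ) : ContDiffOn ℝ 1 (truncPow s δ) (Ioi 0) := by
  intro t ht
  have ht' : 0 < t := ht
  have h1 : 0 < 1 + δ * t := by positivity
  refine ContDiffAt.contDiffWithinAt ?_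
  refine ContDiffAt.rpow_const_of_ne (ContDiffAt.div contDiffAt_id (by fun_prop) h1.ne') ?_
  exact (div_pos ht' h1).ne'

theorem radialMultiplier_hardyMultiplier (hδ : 0 ≤ δ) (hN : 0 < N) :
    RadialMultiplier (hardyMultiplier s δ N) (2 * N) where
  contDiffOn := by
    refine ContDiffOn.div ((contDiffOn_truncPow hδ).mul ?_) contDiffOn_id
      fun t ht => ne_of_gt ht
    exact ((Real.smoothTransition.contDiff (n := 1)).comp (by fun_prop)).contDiffOn
  nonneg t ht := by
    have := truncPow_nonneg (s := s) hδ ht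
    have := Real.smoothTransition.nonneg (2 - t / N)
    unfold hardyMultiplier
    positivity
  eq_zero t ht := by
    have : Real.smoothTransition (2 - t / N) = 0 := by
      refine Real.smoothTransition.zero_of_nonpos ?_
      rw [sub_nonpos, le_div_iff₀ hN]
      exact ht
    simp [hardyMultiplier, this]

theorem mul_hardyMultiplier_le (hs : 0 ≤ s) (hδ : 0 ≤ δ) (ht : 0 < t) :
    t * hardyMultiplier s δ N t ≤ t ^ s := by
  have h1 : t * hardyMultiplier s δ N t
      = truncPow s δ t * Real.smoothTransition (2 - t / N) := by
    unfold hardyMultiplier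
    field_simp
  rw [h1]
  calc truncPow s δ t * Real.smoothTransition (2 - t / N) ≤ truncPow s δ t * 1 :=
        mul_le_mul_of_nonneg_left (Real.smoothTransition.le_one _) (truncPow_nonneg hδ ht)
    _ ≤ t ^ s := by rw [mul_one]; exact truncPow_le hs hδ ht

/-- The defect is the negative part of the derivative of t κ, and t κ is the increasing truncated
power times the cutoff. Only the derivative of the cutoff is negative; it lives where N ≤ t ≤ 2 N,
where 1 / N ≤ 2 / t. Boundedness of the truncated power makes `K` independent of `N`. -/
theorem exists_multiplierDefect_hardyMultiplier_le (hs : 0 ≤ s) (hδ : 0 < δ) :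
    ∃ K : ℝ, 0 ≤ K ∧ ∀ N t : ℝ, 0 < N → 0 < t →
      multiplierDefect (hardyMultiplier s δ N) t ≤ K / t ∧
      (t < N → multiplierDefect (hardyMultiplier s δ N) t = 0) := by
  obtain ⟨B, hB0, hB⟩ := exists_deriv_smoothTransition_le
  refine ⟨(1 / δ) ^ s * (2 * B), by positivity, fun N t hN ht => ?_⟩
  obtain ⟨w', hw'0, hw'⟩ := hasDerivAt_truncPow hs hδ.le ht
  set S := deriv Real.smoothTransition (2 - t / N) with hS
  have hS0 : 0 ≤ S := Real.smoothTransition.monotone.deriv_nonneg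
  have hζ : HasDerivAt (fun t : ℝ => Real.smoothTransition (2 - t / N)) (-(S / N)) t := by
    have h1 : HasDerivAt Real.smoothTransition S (2 - t / N) :=
      ((Real.smoothTransition.contDiff (n := 1)).differentiable (by norm_num) _).hasDerivAt
    have h2 : HasDerivAt (fun t : ℝ => 2 - t / N) (-(1 / N)) t :=
      ((hasDerivAt_id t).div_const N).const_sub 2
    have h3 : HasDerivAt (fun t : ℝ => Real.smoothTransition (2 - t / N)) (S * -(1 / N)) t :=
      HasDerivAt.comp (h₂ := Real.smoothTransition) t h1 h2
    rwa [show S * -(1 / N) = -(S / N) by ring] at h3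
  have hder : HasDerivAt (hardyMultiplier s δ N) _ t :=
    (hw'.mul hζ).div (hasDerivAt_id t) ht.ne'
  have hval : -hardyMultiplier s δ N t - t * deriv (hardyMultiplier s δ N) t
      = truncPow s δ t * S / N - w' * Real.smoothTransition (2 - t / N) := by
    rw [hder.deriv]
    simp only [hardyMultiplier, Pi.mul_apply]
    field_simp
    ring
  have hwζ : 0 ≤ w' * Real.smoothTransition (2 - t / N) :=
    mul_nonneg hw'0 (Real.smoothTransition.nonneg _)
  have hw := truncPow_nonneg (s := s) hδ.le ht
  have hw2 := truncPow_le' hs hδ ht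
  have hle : multiplierDefect (hardyMultiplier s δ N) t ≤ truncPow s δ t * S / N := by
    refine max_le (by positivity) ?_
    rw [hval]
    linarith
  constructor
  · refine hle.trans ?_
    by_cases h2 : 2 * N < t
    · have : S = 0 := (hB _).2 (Or.inl (by
        rw [sub_neg, lt_div_iff₀ hN]
        exact h2))
      rw [this, mul_zero, zero_div]
      positivity
    · rw [div_le_div_iff₀ hN ht]
      have hSB : S ≤ B := (hB _).1
      calc truncPow s δ t * S * t ≤ (1 / δ) ^ s * B * (2 * N) := by
            gcongr
            exact not_lt.1 h2
        _ = (1 / δ) ^ s * (2 * B) * N := by ring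
  · intro htN
    have : S = 0 := (hB _).2 (Or.inr (by
      have := (div_lt_one hN).2 htN
      linarith))
    rw [this, mul_zero, zero_div] at hle
    exact le_antisymm hle (multiplierDefect_nonneg _ _)

theorem tendsto_hardyMultiplier (s δ t : ℝ) :
    Tendsto (fun n : ℕ => hardyMultiplier s δ (n + 1) t) atTop (𝓝 (truncPow s δ t / t)) := by
  refine tendsto_const_nhds.congr' ?_
  filter_upwards [eventually_ge_atTop ⌈t⌉₊] with n hn
  have h1 : t ≤ n + 1 := (Nat.le_ceil t).trans (by exact_mod_cast hn.trans n.le_succ)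
  have h2 : Real.smoothTransition (2 - t / (n + 1)) = 1 := by
    refine Real.smoothTransition.one_of_one_le ?_
    have := div_le_one_of_le₀ h1 (by positivity)
    linarith
  rw [hardyMultiplier, h2, mul_one]

theorem tendsto_truncPow (ht : 0 < t) :
    Tendsto (fun n : ℕ => truncPow s (1 / ((n : ℝ) + 1)) t) atTop (𝓝 (t ^ s)) := by
  have h1 : Tendsto (fun n : ℕ => 1 + 1 / ((n : ℝ) + 1) * t) atTop (𝓝 (1 + 0 * t)) :=
    (tendsto_one_div_add_atTop_nhds_zero_nat.mul_const t).const_add 1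
  have h2 : Tendsto (fun n : ℕ => t / (1 + 1 / ((n : ℝ) + 1) * t)) atTop (𝓝 t) := by
    have := (tendsto_const_nhds (x := t)).div h1 (by simp)
    rwa [zero_mul, add_zero, div_one] at this
  exact h2.rpow_const (Or.inl ht.ne')

end Multiplier

section Hardy

variable {d : ℕ} {α : ℝ} {Ω : Set (E d)} {Y : EReal} {U : E d × ℝ → ℝ}
  {G : E d × ℝ → E d × ℝ →L[ℝ] ℝ}

/-- Weighted Hardy inequality in the exterior of a ball. -/
theorem MemH1rho.exterior_hardy (h : MemH1rho α (cutCylinder Ω Y) U G)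
    (hj : ∀ᵐ y : ℝ, y ∈ yInterval Y → JumpMeanZero Ω (fun x => U (x, y))) {R : ℝ}
    (hR : ∀ x ∈ closure Ω, ‖x‖ ^ 2 ≤ R ^ 2) {θ c μ : ℝ} (hc : 0 < c)
    (hθ : θ = 0 ∨ θ = 1 ∧ Y = ⊤) (hcd : d + θ * (1 + α) - 2 = c) (hμ : 0 ≤ μ) :
    ENNReal.ofReal (c / 2) * ∫⁻ z in cutCylinder Ω Y,
        ENNReal.ofReal (z.2 ^ α * (outerCutoff R z.1 * (rho z ^ (μ - 2) * U z ^ 2))) ≤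
      ENNReal.ofReal (2 / c) * weightedEnergy α μ Ω Y G := by
  have hD := (isOpen_cutCylinder Ω Y).measurableSet
  set ν := (volume : Measure (E d × ℝ)).restrict (cutCylinder Ω Y) with hν
  have hU : AEStronglyMeasurable U ν := h.1.1.aestronglyMeasurable
  have hα : AEStronglyMeasurable (fun z : E d × ℝ => z.2 ^ α) ν :=
    (measurable_snd_rpow α).aestronglyMeasurable
  have c2 : Continuous fun z : E d × ℝ => outerCutoff R z.1 :=
    (contDiff_outerCutoff R).continuous.comp continuous_fst
  set s := μ / 2 with hs
  have hs0 : 0 ≤ s := by positivity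
  have hmeas : ∀ {k : E d × ℝ → ℝ}, Continuous k → AEMeasurable (fun z => ENNReal.ofReal
      (z.2 ^ α * (outerCutoff R z.1 * (k z * U z ^ 2)))) ν := fun hk =>
    (hα.mul (c2.aestronglyMeasurable.mul
      (hk.aestronglyMeasurable.mul (hU.pow 2)))).aemeasurable.ennreal_ofReal
  have hlimit : ∀ {k : ℕ → ℝ} {k₀ : ℝ} (z : E d × ℝ), Tendsto k atTop (𝓝 k₀) →
      Tendsto (fun n => ENNReal.ofReal (z.2 ^ α * (outerCutoff R z.1 * (k n * U z ^ 2)))) atTop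
        (𝓝 (ENNReal.ofReal (z.2 ^ α * (outerCutoff R z.1 * (k₀ * U z ^ 2))))) := fun z hk =>
    (ENNReal.continuous_ofReal.tendsto _).comp
      ((hk.mul_const _).const_mul _ |>.const_mul _)
  -- The cutoff `N` is sent to infinity first, with δ fixed, because the uniform bound on the defect
  -- degenerates as δ tends to 0.
  have htrunc : ∀ δ : ℝ, 0 < δ → ENNReal.ofReal (c / 2) * ∫⁻ z, ENNReal.ofReal
      (z.2 ^ α * (outerCutoff R z.1 * (truncPow s δ (tau z) / tau z * U z ^ 2))) ∂ν ≤
      ENNReal.ofReal (2 / c) * weightedEnergy α μ Ω Y G := by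
    intro δ hδ
    obtain ⟨K, hK0, hK⟩ := exists_multiplierDefect_hardyMultiplier_le hs0 hδ
    have hN : ∀ n : ℕ, (0 : ℝ) < n + 1 := fun n => by positivity
    have hκ := fun n : ℕ => radialMultiplier_hardyMultiplier (s := s) hδ.le (hN n)
    refine mul_lintegral_le_of_tendsto ENNReal.ofReal_ne_top
      (F := fun n z => ENNReal.ofReal (z.2 ^ α * (outerCutoff R z.1 *
        (hardyMultiplier s δ (n + 1) (tau z) * U z ^ 2))))
      (fun n => hmeas (hκ n).continuous_comp_tau)
      (ae_of_all _ fun z => hlimit z (tendsto_hardyMultiplier s δ (tau z)))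
      (e := fun n => 2 * ∫⁻ z, ENNReal.ofReal (z.2 ^ α *
        (multiplierDefect (hardyMultiplier s δ (n + 1)) (tau z) * U z ^ 2)) ∂ν) ?_ fun n => ?_
    · refine tendsto_const_mul_zero ENNReal.ofNat_ne_top ?_
      rw [← lintegral_zero (μ := ν)]
      -- Membership in H¹_ρ is decisive here: the defect is at most `K / tau`, matching the weight
      -- ρ^(-2), so the finite energy is a majorant, and the defect vanishes at each point once `N`
      -- exceeds `tau z`.
      refine tendsto_lintegral_of_dominated_convergence'
        (fun z => ENNReal.ofReal (K * energyDensity α U G z)) (fun n => ?_) (fun n => ?_) ?_ ?_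
      · exact (hα.mul ((continuous_multiplierDefect_comp_tau (hκ n)).aestronglyMeasurable.mul
          (hU.pow 2))).aemeasurable.ennreal_ofReal
      · refine (ae_restrict_iff' hD).2 (ae_of_all _ fun z hz => ENNReal.ofReal_le_ofReal ?_)
        have h1 := (hK (n + 1) (tau z) (hN n) (tau_pos z)).1
        have h2 := Real.rpow_nonneg hz.2.1.le α
        have h3 := gradSq_nonneg (G z)
        have hrho : rho z ^ (-2 : ℝ) = (tau z)⁻¹ := by
          rw [rho_rpow, show (-2 : ℝ) / 2 = -1 by norm_num, Real.rpow_neg_one]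
        calc z.2 ^ α * (multiplierDefect (hardyMultiplier s δ (n + 1)) (tau z) * U z ^ 2)
            ≤ z.2 ^ α * (K / tau z * U z ^ 2) := by gcongr
          _ = K * (z.2 ^ α * (0 + rho z ^ (-2 : ℝ) * U z ^ 2)) := by rw [hrho]; ring
          _ ≤ K * energyDensity α U G z := by unfold energyDensity; gcongr
      · have := (h.integrableOn_energyDensity.const_mul K).lintegral_lt_top
        exact this.ne
      · refine ae_of_all _ fun z => tendsto_const_nhds.congr' ?_
        filter_upwards [eventually_ge_atTop ⌈tau z⌉₊] with n hn
        have h1 : tau z < n + 1 :=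
          (Nat.le_ceil _).trans_lt (by exact_mod_cast Nat.lt_succ_of_le hn)
        rw [(hK (n + 1) (tau z) (hN n) (tau_pos z)).2 h1, zero_mul, mul_zero, ENNReal.ofReal_zero]
    · refine (h.lintegral_multiplier_le hj hR (hκ n) hc hθ hcd).trans ?_
      gcongr
      refine setLIntegral_mono' hD fun z hz => ENNReal.ofReal_le_ofReal ?_
      have h1 := mul_hardyMultiplier_le (N := n + 1) hs0 hδ.le (tau_pos z)
      have h2 := Real.rpow_nonneg hz.2.1.le α
      have h3 := gradSq_nonneg (G z)
      rw [rho_rpow, mul_assoc (z.2 ^ α)]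
      gcongr
  -- Now δ tends to 0 along 1 / (n + 1). No error term is left, since the right-hand side does not
  -- depend on δ.
  have hd : ∀ n : ℕ, (0 : ℝ) < 1 / ((n : ℝ) + 1) := fun n => by positivity
  refine mul_lintegral_le_of_tendsto ENNReal.ofReal_ne_top
    (F := fun (n : ℕ) z => ENNReal.ofReal (z.2 ^ α * (outerCutoff R z.1 *
      (truncPow s (1 / ((n : ℝ) + 1)) (tau z) / tau z * U z ^ 2)))) (fun n => hmeas ?_)
    (ae_of_all _ fun z => ?_) (e := fun _ => 0) tendsto_const_nhds fun n => ?_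
  · exact ((contDiffOn_truncPow (hd n).le).continuousOn.comp_continuous continuous_tau
      tau_pos).div continuous_tau fun z => (tau_pos z).ne'
  · refine hlimit z ?_
    have : rho z ^ (μ - 2) = tau z ^ s / tau z := by
      rw [rho_rpow, show (μ - 2) / 2 = s - 1 by rw [hs]; ring, Real.rpow_sub_one (tau_pos z).ne']
    rw [this]
    exact (tendsto_truncPow (tau_pos z)).div_const _
  · rw [add_zero]
    exact htrunc _ (hd n)

end Hardy

end

/-! ### Gluing the exterior inequality to the slice estimate. -/

section


section Combine

variable {d : ℕ} {α : ℝ} {Ω : Set (E d)} {Y : EReal} {U : E d × ℝ → ℝ}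
  {G : E d × ℝ → E d × ℝ →L[ℝ] ℝ}

theorem cutCylinder_ae_eq (hΩ : IsBoundedLipschitzDomain Ω) (Y : EReal) :
    (cutCylinder Ω Y : Set (E d × ℝ)) =ᵐ[volume] (univ ×ˢ yInterval Y : Set (E d × ℝ)) := by
  have h0 : (volume : Measure (E d)) (frontier Ω) = 0 := hΩ.isLipschitzRegion.volume_frontier
  have h1 : ((frontier Ω)ᶜ : Set (E d)) =ᵐ[volume] univ := by
    rw [ae_eq_univ, compl_compl]
    exact h0
  rw [Measure.volume_eq_prod]
  exact Measure.set_prod_ae_eq h1 (ae_eq_refl _)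

theorem setLIntegral_prod_symm' {S : Set (E d)} {I : Set ℝ} {F : E d × ℝ → ℝ≥0∞}
    (hF : AEMeasurable F (volume.restrict (S ×ˢ I))) :
    ∫⁻ z in S ×ˢ I, F z = ∫⁻ y in I, ∫⁻ x in S, F (x, y) := by
  rw [Measure.volume_eq_prod, ← Measure.prod_restrict] at hF ⊢
  exact lintegral_prod_symm _ hF

theorem rho_rpow_sub_two_le {μ : ℝ} (hμ : μ ≤ 2) (z : E d × ℝ) :
    rho z ^ (μ - 2) ≤ (1 + z.2 ^ 2) ^ ((μ - 2) / 2) := by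
  rw [rho_rpow]
  refine Real.rpow_le_rpow_of_nonpos (by positivity) ?_ (by linarith)
  unfold tau
  nlinarith [sq_nonneg ‖z.1‖]

/-- For bounded `x`, `tau z` is at most (1 + M²)(1 + y²). As (μ - 2)/2 lies in [-1, 0], replacing ρ²
by 1 + y² costs no more than the factor 1 + M², whatever μ is. -/
theorem le_mul_rho_rpow_sub_two {μ M : ℝ} (hμ0 : 0 ≤ μ) (hμ : μ ≤ 2) {z : E d × ℝ}
    (hz : ‖z.1‖ ≤ M) :
    (1 + z.2 ^ 2) ^ ((μ - 2) / 2) ≤ (1 + M ^ 2) * rho z ^ (μ - 2) := by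
  have hM : 0 ≤ M := (norm_nonneg _).trans hz
  have ha : 0 < 1 + z.2 ^ 2 := by positivity
  have hb : 1 ≤ 1 + M ^ 2 := by nlinarith [sq_nonneg M]
  have h1 : tau z ≤ (1 + M ^ 2) * (1 + z.2 ^ 2) := by
    unfold tau
    have : ‖z.1‖ ^ 2 ≤ M ^ 2 := pow_le_pow_left₀ (norm_nonneg _) hz 2
    nlinarith [mul_nonneg (sq_nonneg M) (sq_nonneg z.2)]
  have h2 := Real.rpow_le_rpow_of_nonpos (z := (μ - 2) / 2) (tau_pos z) h1 (by linarith)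
  rw [Real.mul_rpow (by positivity) ha.le] at h2
  have h3 : 1 ≤ (1 + M ^ 2) * (1 + M ^ 2) ^ ((μ - 2) / 2) := by
    have h := Real.one_le_rpow hb (show 0 ≤ 1 + (μ - 2) / 2 by linarith)
    rwa [Real.rpow_add (by positivity), Real.rpow_one] at h
  rw [rho_rpow]
  have h4 : 0 ≤ (1 + z.2 ^ 2) ^ ((μ - 2) / 2) := by positivity
  calc (1 + z.2 ^ 2) ^ ((μ - 2) / 2)
      ≤ (1 + M ^ 2) * (1 + M ^ 2) ^ ((μ - 2) / 2) * (1 + z.2 ^ 2) ^ ((μ - 2) / 2) :=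
        le_mul_of_one_le_left h4 h3
    _ = (1 + M ^ 2) * ((1 + M ^ 2) ^ ((μ - 2) / 2) * (1 + z.2 ^ 2) ^ ((μ - 2) / 2)) := by ring
    _ ≤ _ := by gcongr

theorem exists_norm_eq (hd : 0 < d) {r : ℝ} (hr : 0 ≤ r) : ∃ p : E d, ‖p‖ = r :=
  ⟨EuclideanSpace.single ⟨0, hd⟩ r, by simp [abs_of_nonneg hr]⟩

/-- Poincaré inequality on the whole cylinder, from the Hardy inequality outside a ball and the
Poincaré inequality on slices. -/
theorem exists_weightedL2_le (hd : 0 < d) (hΩ : IsBoundedLipschitzDomain Ω)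
    (hext : IsConnected (closure Ω)ᶜ) {c : ℝ} (hc : 0 < c) :
    ∃ C : ℝ≥0, ∀ (α θ μ : ℝ) (Y : EReal), 0 ≤ μ → μ ≤ 2 → (θ = 0 ∨ θ = 1 ∧ Y = ⊤) →
      d + θ * (1 + α) - 2 = c →
      ∀ (U : E d × ℝ → ℝ) (G : E d × ℝ → E d × ℝ →L[ℝ] ℝ), MemH1rho α (cutCylinder Ω Y) U G →
      (∀ᵐ y : ℝ, y ∈ yInterval Y → JumpMeanZero Ω (fun x => U (x, y))) →
      weightedL2 α μ Y U ≤ C * weightedEnergy α μ Ω Y G := by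
  obtain ⟨R, hR0, hRb⟩ : ∃ R : ℝ, 0 ≤ R ∧ ∀ x ∈ closure Ω, ‖x‖ ≤ R := by
    obtain ⟨R, hR⟩ := isBounded_iff_forall_norm_le.1 hΩ.isBounded.closure
    exact ⟨max R 0, le_max_right _ _, fun x hx => (hR x hx).trans (le_max_left _ _)⟩
  have hR : ∀ x ∈ closure Ω, ‖x‖ ^ 2 ≤ R ^ 2 :=
    fun x hx => pow_le_pow_left₀ (norm_nonneg _) (hRb x hx) 2
  -- A unit ball around a point at distance R + 3 avoids the closure of `Ω` and lies where the
  -- cutoff equals 1, since (R + 2)² ≥ R² + 1.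
  obtain ⟨p, hp⟩ := exists_norm_eq hd (show 0 ≤ R + 3 by positivity)
  have hpball : ∀ x ∈ Metric.ball p 1, R + 2 ≤ ‖x‖ ∧ ‖x‖ ≤ R + 4 := by
    intro x hx
    rw [mem_ball_iff_norm] at hx
    have h1 := norm_sub_norm_le p x
    have h2 := norm_sub_norm_le x p
    rw [norm_sub_rev] at h1
    constructor <;> linarith
  have hpe : Metric.ball p 1 ⊆ (closure Ω)ᶜ := by
    intro x hx hxc
    linarith [(hpball x hx).1, hRb x hxc]
  obtain ⟨C₁, hC₁⟩ := exists_slice_estimate hd hΩ hext one_pos hpe (R + 1)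
  set M : ℝ := 1 + (R + 4) ^ 2 with hM
  have hM0 : 0 ≤ M := by positivity
  -- One factor is the constant of the Hardy inequality, the other comes from dividing by c / 2.
  set C₂ : ℝ≥0∞ := ENNReal.ofReal (2 / c) * ENNReal.ofReal (2 / c) with hC₂
  have hfin : C₁ * (ENNReal.ofReal M * C₂ + 1) + C₂ ≠ ⊤ := by
    simp only [hC₂]
    finiteness
  refine ⟨(C₁ * (ENNReal.ofReal M * C₂ + 1) + C₂).toNNReal,
    fun α θ μ Y hμ0 hμ2 hθ hcd U G h hj => ?_⟩
  rw [ENNReal.coe_toNNReal hfin]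
  set I := yInterval Y with hI
  have hIm : MeasurableSet I := (isOpen_yInterval Y).measurableSet
  have hae := cutCylinder_ae_eq hΩ Y
  set W := weightedEnergy α μ Ω Y G with hW
  set ψU : E d × ℝ → ℝ≥0∞ := fun z =>
    ENNReal.ofReal (z.2 ^ α * (outerCutoff R z.1 * (rho z ^ (μ - 2) * U z ^ 2))) with hψU
  set P := ∫⁻ z in cutCylinder Ω Y, ψU z with hP
  have hhardy : P ≤ C₂ * W := by
    have h1 := h.exterior_hardy hj hR hc hθ hcd hμ0
    calc P = ENNReal.ofReal (2 / c) * (ENNReal.ofReal (c / 2) * P) := by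
          rw [← mul_assoc, ← ENNReal.ofReal_mul (by positivity),
            show 2 / c * (c / 2) = 1 by field_simp, ENNReal.ofReal_one, one_mul]
      _ ≤ ENNReal.ofReal (2 / c) * (ENNReal.ofReal (2 / c) * W) := by gcongr
      _ = C₂ * W := by rw [hC₂, mul_assoc]
  have hPuniv : P = ∫⁻ z in univ ×ˢ I, ψU z := setLIntegral_congr hae
  -- The weight with ρ replaced by its value at x = 0. It depends on `y` only, so it multiplies the
  -- slice estimate as a constant.
  set A : ℝ → ℝ≥0∞ := fun y => ENNReal.ofReal (y ^ α * (1 + y ^ 2) ^ ((μ - 2) / 2)) with hA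
  have hAm : Measurable A := by
    refine Measurable.ennreal_ofReal (Measurable.mul (measurable_id.pow_const α) ?_)
    exact Measurable.pow_const (by fun_prop) _
  have mU : AEMeasurable U (volume.restrict (univ ×ˢ I)) := by
    rw [← Measure.restrict_congr_set hae]
    exact h.1.1.aestronglyMeasurable.aemeasurable
  have mUS : ∀ S : Set (E d), AEMeasurable (fun z : E d × ℝ => A z.2 * ‖U z‖ₑ ^ 2)
      (volume.restrict (S ×ˢ I)) := fun S =>
    ((hAm.comp measurable_snd).aemeasurable.mul (mU.enorm.pow_const 2)).mono_measure
      (Measure.restrict_mono (prod_mono_left (subset_univ S)) le_rfl)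
  set Gx : E d × ℝ → E d →L[ℝ] ℝ := fun z => (G z).comp (ContinuousLinearMap.inl ℝ (E d) ℝ)
    with hGx
  have mG : AEMeasurable (fun z : E d × ℝ => A z.2 * ‖Gx z‖ₑ ^ 2)
      (volume.restrict ((frontier Ω)ᶜ ×ˢ I)) := by
    have hcont : Continuous fun L : E d × ℝ →L[ℝ] ℝ =>
        L.comp (ContinuousLinearMap.inl ℝ (E d) ℝ) :=
      ((ContinuousLinearMap.compL ℝ (E d) (E d × ℝ) ℝ).flip
        (ContinuousLinearMap.inl ℝ (E d) ℝ)).continuous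
    exact (hAm.comp measurable_snd).aemeasurable.mul
      (((hcont.comp_aestronglyMeasurable h.1.2.1.aestronglyMeasurable).enorm).pow_const 2)
  have hball : ∫⁻ z in Metric.ball 0 (R + 1) ×ˢ I, A z.2 * ‖U z‖ₑ ^ 2 ≤
      C₁ * ((∫⁻ z in Metric.ball p 1 ×ˢ I, A z.2 * ‖U z‖ₑ ^ 2)
        + ∫⁻ z in (frontier Ω)ᶜ ×ˢ I, A z.2 * ‖Gx z‖ₑ ^ 2) := by
    have hslice := h.1.ae_slice_fst isClosed_frontier.isOpen_compl (isOpen_yInterval Y)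
    have m1 : AEMeasurable (fun y => ∫⁻ x in Metric.ball p 1, A y * ‖U (x, y)‖ₑ ^ 2)
        (volume.restrict I) := by
      have := mUS (Metric.ball p 1)
      rw [Measure.volume_eq_prod, ← Measure.prod_restrict] at this
      exact this.lintegral_prod_left'
    rw [setLIntegral_prod_symm' (mUS _), setLIntegral_prod_symm' (mUS _),
      setLIntegral_prod_symm' mG, ← lintegral_add_left' m1,
      ← lintegral_const_mul' _ _ ENNReal.coe_ne_top]
    refine lintegral_mono_ae ((ae_restrict_iff' hIm).2 ?_)
    filter_upwards [hslice, hj] with y hy hjy hyI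
    have hAy : A y ≠ ⊤ := ENNReal.ofReal_ne_top
    have := hC₁ _ _ (hy hyI) (hjy hyI)
    simp only [lintegral_const_mul' _ _ hAy]
    calc A y * ∫⁻ x in Metric.ball 0 (R + 1), ‖U (x, y)‖ₑ ^ 2
        ≤ A y * (C₁ * ((∫⁻ x in Metric.ball p 1, ‖U (x, y)‖ₑ ^ 2)
          + ∫⁻ x in (frontier Ω)ᶜ, ‖Gx (x, y)‖ₑ ^ 2)) := by gcongr
      _ = _ := by ring
  have hGW : ∫⁻ z in (frontier Ω)ᶜ ×ˢ I, A z.2 * ‖Gx z‖ₑ ^ 2 ≤ W := by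
    refine setLIntegral_mono' (isClosed_frontier.isOpen_compl.measurableSet.prod hIm)
      fun z hz => ?_
    rw [← ofReal_sq_eq_enorm_sq, ← ENNReal.ofReal_mul (by have := hz.2.1; positivity)]
    refine ENNReal.ofReal_le_ofReal ?_
    have h1 : (1 + z.2 ^ 2) ^ ((μ - 2) / 2) ≤ 1 :=
      Real.rpow_le_one_of_one_le_of_nonpos (by nlinarith [sq_nonneg z.2]) (by linarith)
    have h2 : 1 ≤ rho z ^ μ := by
      rw [rho_rpow]
      exact Real.one_le_rpow (one_le_tau z) (by positivity)
    have h3 : ‖Gx z‖ ^ 2 ≤ gradSq (G z) := by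
      unfold gradSq
      exact le_add_of_nonneg_right (sq_nonneg _)
    have := hz.2.1
    gcongr
    exact h1.trans h2
  have hpP : ∫⁻ z in Metric.ball p 1 ×ˢ I, A z.2 * ‖U z‖ₑ ^ 2 ≤ ENNReal.ofReal M * P := by
    rw [hPuniv, ← lintegral_const_mul' _ _ ENNReal.ofReal_ne_top]
    refine (setLIntegral_mono' (Metric.isOpen_ball.measurableSet.prod hIm) fun z hz => ?_).trans
      (lintegral_mono_set (prod_mono_left (subset_univ _)))
    have hzy := hz.2.1
    obtain ⟨hz1, hz2⟩ := hpball z.1 hz.1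
    rw [← ofReal_sq_eq_enorm_sq', ← ENNReal.ofReal_mul (by positivity), hψU,
      ← ENNReal.ofReal_mul hM0]
    refine ENNReal.ofReal_le_ofReal ?_
    rw [outerCutoff_eq_one (by nlinarith)]
    have := le_mul_rho_rpow_sub_two hμ0 hμ2 hz2
    calc z.2 ^ α * (1 + z.2 ^ 2) ^ ((μ - 2) / 2) * U z ^ 2
        ≤ z.2 ^ α * (M * rho z ^ (μ - 2)) * U z ^ 2 := by gcongr
      _ = _ := by ring
  have hin : ∫⁻ z in Metric.ball 0 (R + 1) ×ˢ I,
      ENNReal.ofReal (z.2 ^ α * rho z ^ (μ - 2) * U z ^ 2) ≤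
      ∫⁻ z in Metric.ball 0 (R + 1) ×ˢ I, A z.2 * ‖U z‖ₑ ^ 2 := by
    refine setLIntegral_mono' (Metric.isOpen_ball.measurableSet.prod hIm) fun z hz => ?_
    have hzy := hz.2.1
    rw [← ofReal_sq_eq_enorm_sq', ← ENNReal.ofReal_mul (by positivity)]
    refine ENNReal.ofReal_le_ofReal ?_
    have := rho_rpow_sub_two_le hμ2 z
    gcongr
  have hout : ∫⁻ z in (Metric.ball 0 (R + 1))ᶜ ×ˢ I,
      ENNReal.ofReal (z.2 ^ α * rho z ^ (μ - 2) * U z ^ 2) ≤ P := by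
    rw [hPuniv]
    refine (setLIntegral_mono' (Metric.isOpen_ball.measurableSet.compl.prod hIm)
      fun z hz => ?_).trans (lintegral_mono_set (prod_mono_left (subset_univ _)))
    refine ENNReal.ofReal_le_ofReal (le_of_eq ?_)
    have hz1 := hz.1
    rw [mem_compl_iff, mem_ball_zero_iff, not_lt] at hz1
    rw [outerCutoff_eq_one (by nlinarith)]
    ring
  have hsplit : weightedL2 α μ Y U ≤
      (∫⁻ z in Metric.ball 0 (R + 1) ×ˢ I,
        ENNReal.ofReal (z.2 ^ α * rho z ^ (μ - 2) * U z ^ 2)) +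
      ∫⁻ z in (Metric.ball 0 (R + 1))ᶜ ×ˢ I,
        ENNReal.ofReal (z.2 ^ α * rho z ^ (μ - 2) * U z ^ 2) := by
    refine le_trans (lintegral_mono_set ?_) (lintegral_union_le _ _ _)
    rw [← union_prod, union_compl_self]
  calc weightedL2 α μ Y U ≤ C₁ * (ENNReal.ofReal M * P + W) + P := by
        refine hsplit.trans (add_le_add (hin.trans (hball.trans ?_)) hout)
        gcongr
    _ ≤ C₁ * (ENNReal.ofReal M * (C₂ * W) + W) + C₂ * W := by gcongr
    _ = _ := by ring

end Combine

end

/-! ### The one-dimensional weighted Hardy inequality. -/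

section


section OneDimHardy

theorem setLIntegral_Ioo_ofReal {f : ℝ → ℝ} {a b : ℝ} (hab : a ≤ b) (hf : ContinuousOn f (Icc a b))
    (hf0 : ∀ x ∈ Icc a b, 0 ≤ f x) :
    ∫⁻ x in Ioo a b, ENNReal.ofReal (f x) = ENNReal.ofReal (∫ x in a..b, f x) := by
  rw [intervalIntegral.integral_of_le hab, integral_Ioc_eq_integral_Ioo,
    ofReal_integral_eq_lintegral_ofReal]
  · exact (hf.integrableOn_compact isCompact_Icc).mono_set Ioo_subset_Icc_self
  · exact (ae_restrict_iff' measurableSet_Ioo).2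
      (ae_of_all _ fun x hx => hf0 x (Ioo_subset_Icc_self hx))

variable {α μ k b : ℝ} {h : ℝ → ℝ}

theorem hasDerivAt_hardyBoundary (hb : 0 < b) (hh : ContDiff ℝ 1 h) {y : ℝ} (hy : 0 < y) :
    HasDerivAt (fun y : ℝ => y ^ (α - 1) * (b + y ^ 2) ^ (μ / 2) * h y ^ 2)
      (((α - 1) * y ^ (α - 2) * (b + y ^ 2) ^ (μ / 2)
        + y ^ (α - 1) * (2 * y * (μ / 2) * (b + y ^ 2) ^ (μ / 2 - 1))) * h y ^ 2
        + y ^ (α - 1) * (b + y ^ 2) ^ (μ / 2) * (2 * h y * deriv h y)) y := by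
  have hpos : 0 < b + y ^ 2 := by positivity
  have h1 : HasDerivAt (fun y : ℝ => y ^ (α - 1)) ((α - 1) * y ^ (α - 2)) y := by
    have := Real.hasDerivAt_rpow_const (x := y) (p := α - 1) (Or.inl hy.ne')
    rwa [show α - 1 - 1 = α - 2 by ring] at this
  have h2 : HasDerivAt (fun y : ℝ => b + y ^ 2) (2 * y) y := by
    simpa using (hasDerivAt_pow 2 y).const_add b
  have h3 := h2.rpow_const (p := μ / 2) (Or.inl hpos.ne')
  have h4 : HasDerivAt (fun y => h y ^ 2) (2 * h y * deriv h y) y := by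
    have h5 := (hh.differentiable one_ne_zero y).hasDerivAt
    have h6 : HasDerivAt (fun y => h y * h y) (deriv h y * h y + h y * deriv h y) y := h5.mul h5
    simp only [sq]
    exact h6.congr_deriv (by ring)
  exact (h1.mul h3).mul h4

/-- The subtracted term is the derivative of y^(α-1) (b + y²)^(μ/2) h². Because y² ≤ b + y², the
coefficient of h² in it is at most (α - 1 + μ) y^(α-2) (b + y²)^(μ/2), and α - 1 + μ ≤ -k. Half of
this gain pays for the cross term. -/
theorem hardy_pointwise (hk : 0 < k) (hμ : 0 ≤ μ) (hkα : μ ≤ 1 - α - k) (hb : 0 < b) {y u v : ℝ}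
    (hy : 0 < y) :
    k / 2 * (y ^ (α - 2) * (b + y ^ 2) ^ (μ / 2) * u ^ 2) ≤
      2 / k * (y ^ α * (b + y ^ 2) ^ (μ / 2) * v ^ 2)
      - (((α - 1) * y ^ (α - 2) * (b + y ^ 2) ^ (μ / 2)
        + y ^ (α - 1) * (2 * y * (μ / 2) * (b + y ^ 2) ^ (μ / 2 - 1))) * u ^ 2
        + y ^ (α - 1) * (b + y ^ 2) ^ (μ / 2) * (2 * u * v)) := by
  have hpos : 0 < b + y ^ 2 := by positivity
  have e1 : y ^ (α - 1) = y ^ (α - 2) * y := by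
    rw [← Real.rpow_add_one hy.ne']
    ring_nf
  have e2 : y ^ α = y ^ (α - 2) * y ^ 2 := by
    rw [sq, ← mul_assoc, ← e1, ← Real.rpow_add_one hy.ne']
    ring_nf
  have hz : 0 ≤ y ^ (α - 2) := Real.rpow_nonneg hy.le _
  have hw : 0 ≤ (b + y ^ 2) ^ (μ / 2) := by positivity
  have hr : y ^ 2 * (b + y ^ 2) ^ (μ / 2 - 1) ≤ (b + y ^ 2) ^ (μ / 2) := by
    rw [Real.rpow_sub_one hpos.ne', mul_div_assoc', div_le_iff₀ hpos]
    nlinarith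
  rw [e1, e2]
  set z := y ^ (α - 2)
  set w := (b + y ^ 2) ^ (μ / 2)
  set w₁ := (b + y ^ 2) ^ (μ / 2 - 1)
  have h1 : z * μ * u ^ 2 * (y ^ 2 * w₁) ≤ z * μ * u ^ 2 * w := by gcongr
  have h2 : z * w * u ^ 2 * μ ≤ z * w * u ^ 2 * (1 - α - k) := by gcongr
  have h3 : 0 ≤ z * w * (k / 2 * u ^ 2 - 2 * (u * (y * v)) + 2 / k * (y * v) ^ 2) := by
    have : k / 2 * u ^ 2 - 2 * (u * (y * v)) + 2 / k * (y * v) ^ 2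
        = (k * u - 2 * (y * v)) ^ 2 / (2 * k) := by
      field_simp
      ring
    rw [this]
    positivity
  nlinarith [h1, h2, h3]

/-- The pointwise inequality is integrated. The boundary term at `Y` has a good sign and is dropped;
the one at `ε` remains. -/
theorem hardy_interval (hk : 0 < k) (hμ : 0 ≤ μ) (hkα : μ ≤ 1 - α - k) (hb : 0 < b)
    (hh : ContDiff ℝ 1 h) {ε Y : ℝ} (hε : 0 < ε) (hεY : ε ≤ Y) :
    ∫ y in ε..Y, k / 2 * (y ^ (α - 2) * (b + y ^ 2) ^ (μ / 2) * h y ^ 2) ≤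
      (∫ y in ε..Y, 2 / k * (y ^ α * (b + y ^ 2) ^ (μ / 2) * deriv h y ^ 2))
        + ε ^ (α - 1) * (b + ε ^ 2) ^ (μ / 2) * h ε ^ 2 := by
  have hIcc : uIcc ε Y = Icc ε Y := uIcc_of_le hεY
  have hy0 : ∀ y ∈ Icc ε Y, y ≠ 0 := fun y hy => (hε.trans_le hy.1).ne'
  have hp0 : ∀ y : ℝ, b + y ^ 2 ≠ 0 := fun y => by positivity
  have cpow : ∀ s : ℝ, ContinuousOn (fun y : ℝ => y ^ s) (Icc ε Y) := fun s =>
    continuousOn_id.rpow_const fun y hy => Or.inl (hy0 y hy)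
  have cw : ∀ s : ℝ, ContinuousOn (fun y : ℝ => (b + y ^ 2) ^ s) (Icc ε Y) := fun s =>
    ContinuousOn.rpow_const (by fun_prop) fun y _ => Or.inl (hp0 y)
  have ch : ContinuousOn h (Icc ε Y) := hh.continuous.continuousOn
  have cd : ContinuousOn (deriv h) (Icc ε Y) :=
    (hh.continuous_deriv le_rfl).continuousOn
  have c1 := cpow (α - 2)
  have c2 := cpow (α - 1)
  have c3 := cpow α
  have c4 := cw (μ / 2)
  have c5 := cw (μ / 2 - 1)
  have iL : IntervalIntegrable
      (fun y => k / 2 * (y ^ (α - 2) * (b + y ^ 2) ^ (μ / 2) * h y ^ 2)) volume ε Y := by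
    refine ContinuousOn.intervalIntegrable ?_
    rw [hIcc]
    fun_prop
  have iR : IntervalIntegrable
      (fun y => 2 / k * (y ^ α * (b + y ^ 2) ^ (μ / 2) * deriv h y ^ 2)) volume ε Y := by
    refine ContinuousOn.intervalIntegrable ?_
    rw [hIcc]
    fun_prop
  have iD : IntervalIntegrable (fun y => ((α - 1) * y ^ (α - 2) * (b + y ^ 2) ^ (μ / 2)
        + y ^ (α - 1) * (2 * y * (μ / 2) * (b + y ^ 2) ^ (μ / 2 - 1))) * h y ^ 2
        + y ^ (α - 1) * (b + y ^ 2) ^ (μ / 2) * (2 * h y * deriv h y)) volume ε Y := by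
    refine ContinuousOn.intervalIntegrable ?_
    rw [hIcc]
    fun_prop
  have hftc := intervalIntegral.integral_eq_sub_of_hasDerivAt
    (fun y hy => hasDerivAt_hardyBoundary (α := α) (μ := μ) hb hh
      (by rw [hIcc] at hy; exact hε.trans_le hy.1)) iD
  have hmono := intervalIntegral.integral_mono_on hεY iL (iR.sub iD) fun y hy =>
    hardy_pointwise (u := h y) (v := deriv h y) hk hμ hkα hb (hε.trans_le hy.1)
  rw [intervalIntegral.integral_sub iR iD, hftc] at hmono
  have hY0 : 0 < Y := hε.trans_le hεY
  have : 0 ≤ Y ^ (α - 1) * (b + Y ^ 2) ^ (μ / 2) * h Y ^ 2 := by positivity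
  linarith

/-- Since h(0) = 0, h(y) is O(y), so the term is O(y^(α+1)) with α + 1 positive. -/
theorem tendsto_hardyBoundary (hα : -1 < α) (hb : 0 < b) (hh : ContDiff ℝ 1 h) (h0 : h 0 = 0) :
    Tendsto (fun y : ℝ => y ^ (α - 1) * (b + y ^ 2) ^ (μ / 2) * h y ^ 2) (𝓝[>] 0) (𝓝 0) := by
  have h1 : Tendsto (fun y : ℝ => y⁻¹ * h y) (𝓝[>] 0) (𝓝 (deriv h 0)) := by
    have := (hh.differentiable one_ne_zero 0).hasDerivAt.tendsto_slope_zero_right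
    simpa [h0] using this
  have h2 : Tendsto (fun y : ℝ => y ^ (α + 1)) (𝓝[>] 0) (𝓝 0) := by
    have := (Real.continuousAt_rpow_const 0 (α + 1) (Or.inr (by linarith))).tendsto
    rw [Real.zero_rpow (by linarith)] at this
    exact this.mono_left nhdsWithin_le_nhds
  have h3 : Tendsto (fun y : ℝ => (b + y ^ 2) ^ (μ / 2)) (𝓝[>] 0) (𝓝 ((b + 0 ^ 2) ^ (μ / 2))) := by
    have hc : Continuous fun y : ℝ => b + y ^ 2 := by fun_prop
    exact (hc.tendsto 0).rpow_const (Or.inl (by positivity)) |>.mono_left nhdsWithin_le_nhds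
  have h4 := (h2.mul h3).mul (h1.pow 2)
  rw [zero_mul, zero_mul] at h4
  refine h4.congr' ?_
  filter_upwards [self_mem_nhdsWithin] with y hy
  have hy0 : (0 : ℝ) < y := hy
  have e : y ^ (α + 1) = y ^ (α - 1) * y ^ 2 := by
    rw [sq, ← mul_assoc, ← Real.rpow_add_one hy0.ne', ← Real.rpow_add_one hy0.ne']
    ring_nf
  rw [e]
  field_simp

/-- Hardy inequality on an interval with a power weight perturbed by an increasing factor. -/
theorem lintegral_hardy (hα : -1 < α) (hk : 0 < k) (hμ : 0 ≤ μ) (hkα : μ ≤ 1 - α - k) (hb : 0 < b)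
    (hh : ContDiff ℝ 1 h) (h0 : h 0 = 0) (Y : ℝ) :
    ENNReal.ofReal (k / 2) * ∫⁻ y in Ioo 0 Y,
        ENNReal.ofReal (y ^ (α - 2) * (b + y ^ 2) ^ (μ / 2) * h y ^ 2) ≤
      ENNReal.ofReal (2 / k) * ∫⁻ y in Ioo 0 Y,
        ENNReal.ofReal (y ^ α * (b + y ^ 2) ^ (μ / 2) * deriv h y ^ 2) := by
  have hε : ∀ n : ℕ, (0 : ℝ) < 1 / ((n : ℝ) + 1) := fun n => by positivity
  have hεl : Tendsto (fun n : ℕ => 1 / ((n : ℝ) + 1)) atTop (𝓝[>] 0) :=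
    tendsto_nhdsWithin_iff.2 ⟨tendsto_one_div_add_atTop_nhds_zero_nat,
      Eventually.of_forall fun n => hε n⟩
  have hmeas : Measurable fun y : ℝ =>
      ENNReal.ofReal (y ^ (α - 2) * (b + y ^ 2) ^ (μ / 2) * h y ^ 2) := by
    refine Measurable.ennreal_ofReal (((measurable_id.pow_const _).mul
      (Measurable.pow_const (by fun_prop) _)).mul (hh.continuous.measurable.pow_const 2))
  refine mul_lintegral_le_of_tendsto ENNReal.ofReal_ne_top
    (F := fun (n : ℕ) => (Ioi (1 / ((n : ℝ) + 1))).indicator fun y =>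
      ENNReal.ofReal (y ^ (α - 2) * (b + y ^ 2) ^ (μ / 2) * h y ^ 2))
    (fun n => (hmeas.indicator measurableSet_Ioi).aemeasurable) ?_
    (e := fun n : ℕ => ENNReal.ofReal ((1 / ((n : ℝ) + 1)) ^ (α - 1)
      * (b + (1 / ((n : ℝ) + 1)) ^ 2) ^ (μ / 2) * h (1 / ((n : ℝ) + 1)) ^ 2)) ?_ fun n => ?_
  · refine (ae_restrict_iff' measurableSet_Ioo).2 (ae_of_all _ fun y hy => ?_)
    refine tendsto_const_nhds.congr' ?_
    have hlt := (tendsto_one_div_add_atTop_nhds_zero_nat (𝕜 := ℝ)).eventually_lt_const hy.1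
    filter_upwards [hlt] with n hn
    exact (indicator_of_mem (s := Ioi (1 / ((n : ℝ) + 1))) hn fun y =>
      ENNReal.ofReal (y ^ (α - 2) * (b + y ^ 2) ^ (μ / 2) * h y ^ 2)).symm
  · have := (tendsto_hardyBoundary (μ := μ) hα hb hh h0).comp hεl
    have h2 := (ENNReal.continuous_ofReal.tendsto 0).comp this
    rw [ENNReal.ofReal_zero] at h2
    exact h2
  · rw [lintegral_indicator measurableSet_Ioi, Measure.restrict_restrict measurableSet_Ioi]
    have hset : Ioi (1 / ((n : ℝ) + 1)) ∩ Ioo 0 Y = Ioo (1 / ((n : ℝ) + 1)) Y := by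
      ext y
      simp only [mem_inter_iff, mem_Ioi, mem_Ioo]
      exact ⟨fun hy => ⟨hy.1, hy.2.2⟩, fun hy => ⟨hy.1, (hε n).trans hy.1, hy.2⟩⟩
    rw [hset]
    rcases lt_or_ge Y (1 / ((n : ℝ) + 1)) with hY | hY
    · rw [Ioo_eq_empty (not_lt.2 hY.le)]
      simp
    set ε := 1 / ((n : ℝ) + 1) with hεdef
    have hε0 : 0 < ε := hε n
    have cpow : ∀ s : ℝ, ContinuousOn (fun y : ℝ => y ^ s) (Icc ε Y) := fun s =>
      continuousOn_id.rpow_const fun y hy => Or.inl (hε0.trans_le hy.1).ne'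
    have cw : ContinuousOn (fun y : ℝ => (b + y ^ 2) ^ (μ / 2)) (Icc ε Y) :=
      ContinuousOn.rpow_const (by fun_prop) fun y _ => Or.inl (by positivity)
    have ch : ContinuousOn h (Icc ε Y) := hh.continuous.continuousOn
    have cd : ContinuousOn (deriv h) (Icc ε Y) := (hh.continuous_deriv le_rfl).continuousOn
    have c1 := cpow (α - 2)
    have c2 := cpow α
    have hnn : ∀ (s c : ℝ) (f : ℝ → ℝ), 0 ≤ c → ∀ y ∈ Icc ε Y,
        0 ≤ c * (y ^ s * (b + y ^ 2) ^ (μ / 2) * f y ^ 2) := by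
      intro s c f hc y hy
      have : 0 < y := hε0.trans_le hy.1
      positivity
    have e1 := setLIntegral_Ioo_ofReal (f := fun y =>
      k / 2 * (y ^ (α - 2) * (b + y ^ 2) ^ (μ / 2) * h y ^ 2)) hY (by fun_prop)
      (hnn _ _ _ (by positivity))
    have e2 := setLIntegral_Ioo_ofReal (f := fun y =>
      2 / k * (y ^ α * (b + y ^ 2) ^ (μ / 2) * deriv h y ^ 2)) hY (by fun_prop)
      (hnn _ _ _ (by positivity))
    have e3 := ENNReal.ofReal_le_ofReal (hardy_interval hk hμ hkα hb hh hε0 hY)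
    rw [ENNReal.ofReal_add (intervalIntegral.integral_nonneg hY (hnn _ _ _ (by positivity)))
      (by positivity), ← e1, ← e2] at e3
    simp only [ENNReal.ofReal_mul (half_pos hk).le,
      ENNReal.ofReal_mul (div_pos two_pos hk).le, lintegral_const_mul' _ _ ENNReal.ofReal_ne_top]
      at e3
    refine e3.trans ?_
    gcongr

end OneDimHardy

end

/-! ### Hardy inequality with a trace at y = 0, for smooth and then general functions. -/

section


section TraceHardy

theorem two_mul_ofReal (a : ℝ) : 2 * ENNReal.ofReal a = ENNReal.ofReal (2 * a) := by
  rw [ENNReal.ofReal_mul zero_le_two, ENNReal.ofReal_ofNat]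

/-- Near 0 the weight is at most y^α, integrable as α > -1. Beyond 1 it is at most y^(α+μ-2) ≤
y^((α-3)/2), whose exponent is below -1 as α < 1. Neither bound involves `b` or μ. -/
theorem exists_lintegral_weight_le {α : ℝ} (hα : -1 < α) (hα' : α < 1) :
    ∃ K : ℝ≥0, ∀ μ b : ℝ, μ ≤ (1 - α) / 2 → 1 ≤ b →
      ∫⁻ y in Ioi (0 : ℝ), ENNReal.ofReal (y ^ α * (b + y ^ 2) ^ (μ / 2 - 1)) ≤ K := by
  have i1 : IntegrableOn (fun y : ℝ => y ^ α) (Ioc 0 1) :=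
    (intervalIntegral.intervalIntegrable_rpow' hα).1
  have i2 : IntegrableOn (fun y : ℝ => y ^ ((α - 3) / 2)) (Ioi 1) :=
    integrableOn_Ioi_rpow_of_lt (by linarith) one_pos
  have h1 := i1.lintegral_lt_top
  have h2 := i2.lintegral_lt_top
  refine ⟨((∫⁻ y in Ioc (0 : ℝ) 1, ENNReal.ofReal (y ^ α))
    + ∫⁻ y in Ioi (1 : ℝ), ENNReal.ofReal (y ^ ((α - 3) / 2))).toNNReal, fun μ b hμ hb => ?_⟩
  rw [ENNReal.coe_toNNReal (ENNReal.add_lt_top.2 ⟨h1, h2⟩).ne,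
    ← Ioc_union_Ioi_eq_Ioi (zero_le_one (α := ℝ))]
  refine (lintegral_union_le _ _ _).trans (add_le_add ?_ ?_)
  · refine setLIntegral_mono' measurableSet_Ioc fun y hy => ENNReal.ofReal_le_ofReal ?_
    have h3 : (b + y ^ 2) ^ (μ / 2 - 1) ≤ 1 :=
      Real.rpow_le_one_of_one_le_of_nonpos (by nlinarith [sq_nonneg y]) (by linarith)
    exact mul_le_of_le_one_right (Real.rpow_nonneg hy.1.le α) h3
  · refine setLIntegral_mono' measurableSet_Ioi fun y hy => ENNReal.ofReal_le_ofReal ?_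
    have hy1 : (1 : ℝ) < y := hy
    have hy0 : 0 < y := one_pos.trans hy1
    have h3 : (b + y ^ 2) ^ (μ / 2 - 1) ≤ (y ^ 2) ^ (μ / 2 - 1) :=
      Real.rpow_le_rpow_of_nonpos (by positivity) (by linarith) (by linarith)
    have h4 : (y ^ 2) ^ (μ / 2 - 1) = y ^ (μ - 2) := by
      rw [← Real.rpow_natCast, ← Real.rpow_mul hy0.le]
      congr 1
      push_cast
      ring
    calc y ^ α * (b + y ^ 2) ^ (μ / 2 - 1) ≤ y ^ α * y ^ (μ - 2) := by
          rw [← h4]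
          gcongr
      _ = y ^ (α + (μ - 2)) := (Real.rpow_add hy0 _ _).symm
      _ ≤ y ^ ((α - 3) / 2) := Real.rpow_le_rpow_of_exponent_le hy1.le (by linarith)

/-- One-dimensional Hardy inequality with a boundary value. -/
theorem exists_lintegral_hardy_trace_le {α : ℝ} (hα : -1 < α) (hα' : α < 1) :
    ∃ C : ℝ≥0, ∀ μ b : ℝ, 0 ≤ μ → μ ≤ (1 - α) / 2 → 1 ≤ b → ∀ f : ℝ → ℝ, ContDiff ℝ 1 f → ∀ Y : ℝ,
      ∫⁻ y in Ioo 0 Y, ENNReal.ofReal (y ^ α * (b + y ^ 2) ^ (μ / 2 - 1) * f y ^ 2) ≤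
        C * ((∫⁻ y in Ioo 0 Y, ENNReal.ofReal (y ^ α * (b + y ^ 2) ^ (μ / 2) * deriv f y ^ 2))
          + ENNReal.ofReal (f 0 ^ 2)) := by
  obtain ⟨K, hK⟩ := exists_lintegral_weight_le hα hα'
  -- Splitting 1 - α in half leaves one half as the Hardy gain and allows μ to use up the other.
  set k := (1 - α) / 2 with hk
  have hk0 : 0 < k := by rw [hk]; linarith
  set c : ℝ≥0 := (2 / k).toNNReal with hc
  refine ⟨2 * (c * c) + 2 * K, fun μ b hμ0 hμ hb f hf Y => ?_⟩
  have hb0 : 0 < b := one_pos.trans_le hb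
  have hh : ContDiff ℝ 1 fun y => f y - f 0 := hf.sub contDiff_const
  have hardy := lintegral_hardy (k := k) hα hk0 hμ0 (by rw [hk] at hμ ⊢; linarith) hb0 hh
    (sub_self _) Y
  simp only [deriv_sub_const] at hardy
  set A := ∫⁻ y in Ioo 0 Y, ENNReal.ofReal (y ^ (α - 2) * (b + y ^ 2) ^ (μ / 2) * (f y - f 0) ^ 2)
  set B := ∫⁻ y in Ioo 0 Y, ENNReal.ofReal (y ^ α * (b + y ^ 2) ^ (μ / 2) * deriv f y ^ 2)
  have hA : A ≤ c * c * B := by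
    calc A = c * (ENNReal.ofReal (k / 2) * A) := by
          rw [← mul_assoc, hc, ← ENNReal.ofReal, ← ENNReal.ofReal_mul (by positivity),
            show 2 / k * (k / 2) = 1 by field_simp, ENNReal.ofReal_one, one_mul]
      _ ≤ c * (ENNReal.ofReal (2 / k) * B) := by gcongr
      _ = c * c * B := by rw [mul_assoc]; rfl
  -- The function is split into f - f(0), to which the Hardy inequality applies, and the constant
  -- f(0), for which the integral of the weight is finite.
  have hpt : ∀ y ∈ Ioo 0 Y, ENNReal.ofReal (y ^ α * (b + y ^ 2) ^ (μ / 2 - 1) * f y ^ 2) ≤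
      2 * ENNReal.ofReal (y ^ (α - 2) * (b + y ^ 2) ^ (μ / 2) * (f y - f 0) ^ 2)
        + 2 * ENNReal.ofReal (f 0 ^ 2) *
          ENNReal.ofReal (y ^ α * (b + y ^ 2) ^ (μ / 2 - 1)) := by
    intro y hy
    have hy0 := hy.1
    have hpos : 0 < b + y ^ 2 := by positivity
    have e2 : y ^ α = y ^ (α - 2) * y ^ 2 := by
      rw [sq, ← mul_assoc, ← Real.rpow_add_one hy0.ne', ← Real.rpow_add_one hy0.ne']
      ring_nf
    have hr : y ^ 2 * (b + y ^ 2) ^ (μ / 2 - 1) ≤ (b + y ^ 2) ^ (μ / 2) := by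
      rw [Real.rpow_sub_one hpos.ne', mul_div_assoc', div_le_iff₀ hpos]
      have : 0 ≤ (b + y ^ 2) ^ (μ / 2) := by positivity
      nlinarith
    have hz : 0 ≤ y ^ (α - 2) := Real.rpow_nonneg hy0.le _
    rw [two_mul_ofReal, two_mul_ofReal, ← ENNReal.ofReal_mul (by positivity),
      ← ENNReal.ofReal_add (by positivity) (by positivity)]
    refine ENNReal.ofReal_le_ofReal ?_
    have h1 : f y ^ 2 ≤ 2 * (f y - f 0) ^ 2 + 2 * f 0 ^ 2 := by
      nlinarith [sq_nonneg (f y - 2 * f 0)]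
    have h2 : y ^ α * (b + y ^ 2) ^ (μ / 2 - 1) ≤ y ^ (α - 2) * (b + y ^ 2) ^ (μ / 2) := by
      rw [e2, mul_assoc]
      gcongr
    have h3 : 0 ≤ y ^ α * (b + y ^ 2) ^ (μ / 2 - 1) := by positivity
    calc _ ≤ y ^ α * (b + y ^ 2) ^ (μ / 2 - 1) * (2 * (f y - f 0) ^ 2 + 2 * f 0 ^ 2) := by gcongr
      _ = 2 * (y ^ α * (b + y ^ 2) ^ (μ / 2 - 1) * (f y - f 0) ^ 2)
          + 2 * f 0 ^ 2 * (y ^ α * (b + y ^ 2) ^ (μ / 2 - 1)) := by ring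
      _ ≤ _ := by gcongr
  have hmeas : Measurable fun y : ℝ =>
      2 * ENNReal.ofReal (y ^ (α - 2) * (b + y ^ 2) ^ (μ / 2) * (f y - f 0) ^ 2) :=
    (((measurable_id.pow_const _).mul (Measurable.pow_const (by fun_prop) _)).mul
      (hh.continuous.measurable.pow_const 2)).ennreal_ofReal.const_mul _
  calc _ ≤ ∫⁻ y in Ioo 0 Y,
        (2 * ENNReal.ofReal (y ^ (α - 2) * (b + y ^ 2) ^ (μ / 2) * (f y - f 0) ^ 2)
        + 2 * ENNReal.ofReal (f 0 ^ 2) *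
          ENNReal.ofReal (y ^ α * (b + y ^ 2) ^ (μ / 2 - 1))) :=
        setLIntegral_mono' measurableSet_Ioo hpt
    _ = 2 * A + 2 * ENNReal.ofReal (f 0 ^ 2) *
          ∫⁻ y in Ioo 0 Y, ENNReal.ofReal (y ^ α * (b + y ^ 2) ^ (μ / 2 - 1)) := by
        rw [lintegral_add_left hmeas, lintegral_const_mul' _ _ ENNReal.ofNat_ne_top,
          lintegral_const_mul' _ _ (by finiteness)]
    _ ≤ 2 * (c * c * B) + 2 * ENNReal.ofReal (f 0 ^ 2) * K := by
        gcongr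
        exact (lintegral_mono_set Ioo_subset_Ioi_self).trans (hK μ b hμ hb)
    _ ≤ (2 * (c * c) + 2 * K) * B + (2 * (c * c) + 2 * K) * ENNReal.ofReal (f 0 ^ 2) := by
        refine add_le_add ?_ ?_
        · rw [← mul_assoc]
          gcongr
          exact le_self_add
        · rw [mul_right_comm]
          gcongr
          exact le_add_self
    _ = _ := by push_cast; ring

variable {d : ℕ}

/-- The Hardy inequality with boundary value for smooth functions on `K × (0, Y)`. -/
theorem exists_lintegral_smooth_trace_le (d : ℕ) {α : ℝ} (hα : -1 < α) (hα' : α < 1) :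
    ∃ C : ℝ≥0, ∀ μ : ℝ, 0 ≤ μ → μ ≤ (1 - α) / 2 → ∀ Φ : E d × ℝ → ℝ, ContDiff ℝ 1 Φ →
      ∀ (K : Set (E d)) (Y : ℝ),
      ∫⁻ z in K ×ˢ Ioo 0 Y, ENNReal.ofReal (z.2 ^ α * rho z ^ (μ - 2) * Φ z ^ 2) ≤
        C * ((∫⁻ z in K ×ˢ Ioo 0 Y,
            ENNReal.ofReal (z.2 ^ α * rho z ^ μ * fderiv ℝ Φ z (0, 1) ^ 2))
          + ∫⁻ x in K, ENNReal.ofReal (Φ (x, 0) ^ 2)) := by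
  obtain ⟨C, hC⟩ := exists_lintegral_hardy_trace_le hα hα'
  refine ⟨C, fun μ hμ0 hμ Φ hΦ K Y => ?_⟩
  have hd : Continuous (fderiv ℝ Φ) := hΦ.continuous_fderiv one_ne_zero
  have hΦc := hΦ.continuous
  have hrho : Continuous (rho : E d × ℝ → ℝ) := continuous_tau.sqrt
  have m1 : Measurable fun z : E d × ℝ =>
      ENNReal.ofReal (z.2 ^ α * rho z ^ (μ - 2) * Φ z ^ 2) :=
    (((measurable_snd_rpow α).mul (hrho.measurable.pow_const _)).mul
      (hΦc.measurable.pow_const 2)).ennreal_ofReal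
  have m2 : Measurable fun z : E d × ℝ =>
      ENNReal.ofReal (z.2 ^ α * rho z ^ μ * fderiv ℝ Φ z (0, 1) ^ 2) :=
    (((measurable_snd_rpow α).mul (hrho.measurable.pow_const _)).mul
      ((hd.clm_apply continuous_const).measurable.pow_const 2)).ennreal_ofReal
  rw [Measure.volume_eq_prod, ← Measure.prod_restrict, lintegral_prod _ m1.aemeasurable,
    lintegral_prod _ m2.aemeasurable, ← lintegral_add_left m2.lintegral_prod_right',
    ← lintegral_const_mul' _ _ ENNReal.coe_ne_top]
  refine lintegral_mono fun x => ?_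
  have hslice : ContDiff ℝ 1 fun y : ℝ => Φ (x, y) := hΦ.comp (by fun_prop)
  have hder : ∀ y, deriv (fun y : ℝ => Φ (x, y)) y = fderiv ℝ Φ (x, y) (0, 1) := by
    intro y
    have h1 : HasDerivAt (fun y : ℝ => ((x, y) : E d × ℝ)) (0, 1) y :=
      (hasDerivAt_const y x).prodMk (hasDerivAt_id y)
    exact ((hΦ.differentiable one_ne_zero (x, y)).hasFDerivAt.comp_hasDerivAt y h1).deriv
  have := hC μ (1 + ‖x‖ ^ 2) hμ0 hμ (by nlinarith [sq_nonneg ‖x‖]) _ hslice Y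
  simp only [hder] at this
  simpa only [rho_rpow, tau, show (μ - 2) / 2 = μ / 2 - 1 by ring] using this

/-- The smooth inequality is applied to the approximations on K × (0, Y') with `K` compact away from
Γ and Y' < Y. The resulting constant depends on neither, so monotone exhaustion reaches the whole
cylinder; Γ itself is null. -/
theorem exists_weightedL2_le_of_trace (d : ℕ) {α : ℝ} (hα : -1 < α) (hα' : α < 1) :
    ∃ C : ℝ≥0, ∀ (Ω : Set (E d)), IsBoundedLipschitzDomain Ω → ∀ Y : ℝ, 0 < Y →
      ∀ μ : ℝ, 0 ≤ μ → μ ≤ (1 - α) / 2 →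
      ∀ (U : E d × ℝ → ℝ) (G : E d × ℝ → E d × ℝ →L[ℝ] ℝ) (g : E d → ℝ),
      HasWeakDeriv (cutCylinder Ω Y) U G → HasTraceZero α Ω Y U G g →
      weightedL2 α μ Y U ≤
        C * (weightedEnergy α μ Ω Y G + ∫⁻ x, ENNReal.ofReal (g x ^ 2)) := by
  obtain ⟨C, hC⟩ := exists_lintegral_smooth_trace_le d hα hα'
  refine ⟨4 * C, fun Ω hΩ Y hY μ hμ0 hμ U G g hU htr => ?_⟩
  obtain ⟨hg, Φ, hΦ, hlim⟩ := htr
  set W := weightedEnergy α μ Ω Y G with hW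
  set N := ∫⁻ x, ENNReal.ofReal (g x ^ 2) with hN
  have hrho : Continuous (rho : E d × ℝ → ℝ) := continuous_tau.sqrt
  have hrho0 : ∀ z : E d × ℝ, 0 ≤ rho z := fun z => Real.sqrt_nonneg _
  have hlocal : ∀ K : Set (E d), IsCompact K → K ⊆ (frontier Ω)ᶜ → ∀ Y' : ℝ, 0 < Y' → Y' < Y →
      ∫⁻ z in K ×ˢ Ioo 0 Y', ENNReal.ofReal (z.2 ^ α * rho z ^ (μ - 2) * U z ^ 2) ≤
        4 * C * (W + N) := by
    intro K hK hKΩ Y' hY' hYY'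
    obtain ⟨l1, l2⟩ := hlim K hK hKΩ
    replace l1 := l1 Y' hY' (by exact_mod_cast hYY')
    have hS := hK.measurableSet.prod (measurableSet_Ioo (a := (0 : ℝ)) (b := Y'))
    have hsub : K ×ˢ Ioo 0 Y' ⊆ cutCylinder Ω Y := prod_mono hKΩ fun y hy =>
      ⟨hy.1, by exact_mod_cast hy.2.trans hYY'⟩
    -- Convergence is known only without the growing weight ρ^μ; a local bound on that weight enters
    -- the vanishing error alone, never the final constant.
    obtain ⟨S, hS1⟩ : ∃ S : ℝ, ∀ z ∈ K ×ˢ Ioo 0 Y', rho z ^ μ ≤ S := by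
      have hc : Continuous fun z : E d × ℝ => rho z ^ μ :=
        hrho.rpow_const fun z => Or.inr hμ0
      obtain ⟨S, hS⟩ := (hK.prod (isCompact_Icc (a := (0 : ℝ)) (b := Y'))).exists_bound_of_continuousOn
        hc.continuousOn
      exact ⟨S, fun z hz => (le_abs_self _).trans
        (hS z (prod_mono_right Ioo_subset_Icc_self hz))⟩
    have hS0 : 0 ≤ max S 0 := le_max_right _ _
    set e := fun n => ∫⁻ z in K ×ˢ Ioo 0 Y', ENNReal.ofReal
      (z.2 ^ α * (gradSq (fderiv ℝ (Φ n) z - G z) + (Φ n z - U z) ^ 2)) with he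
    set t := fun n => ∫⁻ x in K, ENNReal.ofReal ((Φ n (x, 0) - g x) ^ 2) with ht
    have b1 : ∀ n, ∫⁻ z in K ×ˢ Ioo 0 Y', ENNReal.ofReal (z.2 ^ α * rho z ^ (μ - 2) * U z ^ 2) ≤
        2 * (∫⁻ z in K ×ˢ Ioo 0 Y', ENNReal.ofReal (z.2 ^ α * rho z ^ (μ - 2) * Φ n z ^ 2))
          + 2 * e n := by
      intro n
      have hm : Measurable fun z : E d × ℝ =>
          2 * ENNReal.ofReal (z.2 ^ α * rho z ^ (μ - 2) * Φ n z ^ 2) :=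
        (((measurable_snd_rpow α).mul (hrho.measurable.pow_const _)).mul
          ((hΦ n).continuous.measurable.pow_const 2)).ennreal_ofReal.const_mul _
      rw [← lintegral_const_mul' _ _ ENNReal.ofNat_ne_top,
        ← lintegral_const_mul' _ _ ENNReal.ofNat_ne_top, ← lintegral_add_left hm]
      refine setLIntegral_mono' hS fun z hz => ?_
      have hy := Real.rpow_nonneg hz.2.1.le α
      have hr := Real.rpow_nonneg (hrho0 z) (μ - 2)
      have hr1 : rho z ^ (μ - 2) ≤ 1 := by
        rw [rho_rpow]
        exact Real.rpow_le_one_of_one_le_of_nonpos (one_le_tau z) (by linarith)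
      have hgs := gradSq_nonneg (fderiv ℝ (Φ n) z - G z)
      rw [two_mul_ofReal, two_mul_ofReal, ← ENNReal.ofReal_add (by positivity) (by positivity)]
      refine ENNReal.ofReal_le_ofReal ?_
      have h1 : U z ^ 2 ≤ 2 * Φ n z ^ 2 + 2 * (Φ n z - U z) ^ 2 := by
        nlinarith [sq_nonneg (U z - 2 * Φ n z)]
      calc z.2 ^ α * rho z ^ (μ - 2) * U z ^ 2
          ≤ z.2 ^ α * rho z ^ (μ - 2) * (2 * Φ n z ^ 2 + 2 * (Φ n z - U z) ^ 2) := by gcongr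
        _ = 2 * (z.2 ^ α * rho z ^ (μ - 2) * Φ n z ^ 2)
            + 2 * (z.2 ^ α * (rho z ^ (μ - 2) * (Φ n z - U z) ^ 2)) := by ring
        _ ≤ 2 * (z.2 ^ α * rho z ^ (μ - 2) * Φ n z ^ 2)
            + 2 * (z.2 ^ α * (gradSq (fderiv ℝ (Φ n) z - G z) + 1 * (Φ n z - U z) ^ 2)) := by
          gcongr
          refine le_add_of_nonneg_of_le hgs ?_
          gcongr
        _ = _ := by ring
    have b2 : ∀ n, ∫⁻ z in K ×ˢ Ioo 0 Y',
        ENNReal.ofReal (z.2 ^ α * rho z ^ μ * fderiv ℝ (Φ n) z (0, 1) ^ 2) ≤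
        2 * W + 2 * ENNReal.ofReal (max S 0) * e n := by
      intro n
      have hm : AEMeasurable (fun z : E d × ℝ =>
          2 * ENNReal.ofReal (z.2 ^ α * rho z ^ μ * gradSq (G z)))
          (volume.restrict (K ×ˢ Ioo 0 Y')) := by
        have hG : AEStronglyMeasurable G (volume.restrict (K ×ˢ Ioo 0 Y')) :=
          hU.2.1.aestronglyMeasurable.mono_measure (Measure.restrict_mono hsub le_rfl)
        exact (((measurable_snd_rpow α).mul (hrho.measurable.pow_const _)).aemeasurable.mul
          (aestronglyMeasurable_gradSq hG).aemeasurable).ennreal_ofReal.const_mul _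
      have hWle : ∫⁻ z in K ×ˢ Ioo 0 Y', 2 * ENNReal.ofReal (z.2 ^ α * rho z ^ μ * gradSq (G z)) ≤
          2 * W := by
        rw [lintegral_const_mul' _ _ ENNReal.ofNat_ne_top]
        gcongr
        exact lintegral_mono_set hsub
      refine le_trans ?_ (add_le_add_left hWle _)
      rw [← lintegral_const_mul' _ _ (by finiteness), ← lintegral_add_left' hm]
      refine setLIntegral_mono' hS fun z hz => ?_
      have hy := Real.rpow_nonneg hz.2.1.le α
      have hr := Real.rpow_nonneg (hrho0 z) μ
      have hg1 := gradSq_nonneg (G z)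
      have hg2 := gradSq_nonneg (fderiv ℝ (Φ n) z - G z)
      rw [two_mul_ofReal, two_mul_ofReal, ← ENNReal.ofReal_mul (by positivity),
        ← ENNReal.ofReal_add (by positivity) (by positivity)]
      refine ENNReal.ofReal_le_ofReal ?_
      have h1 : fderiv ℝ (Φ n) z (0, 1) ^ 2 ≤
          2 * gradSq (G z) + 2 * gradSq (fderiv ℝ (Φ n) z - G z) := by
        have h2 : G z (0, 1) ^ 2 ≤ gradSq (G z) := le_add_of_nonneg_left (sq_nonneg _)
        have h3 : (fderiv ℝ (Φ n) z (0, 1) - G z (0, 1)) ^ 2 ≤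
            gradSq (fderiv ℝ (Φ n) z - G z) := le_add_of_nonneg_left (sq_nonneg _)
        nlinarith [sq_nonneg (fderiv ℝ (Φ n) z (0, 1) - 2 * G z (0, 1))]
      calc z.2 ^ α * rho z ^ μ * fderiv ℝ (Φ n) z (0, 1) ^ 2
          ≤ z.2 ^ α * rho z ^ μ *
            (2 * gradSq (G z) + 2 * gradSq (fderiv ℝ (Φ n) z - G z)) := by gcongr
        _ = 2 * (z.2 ^ α * rho z ^ μ * gradSq (G z))
            + 2 * rho z ^ μ * (z.2 ^ α * (gradSq (fderiv ℝ (Φ n) z - G z) + 0)) := by ring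
        _ ≤ _ := by
          gcongr
          · exact (hS1 z hz).trans (le_max_left _ _)
          · positivity
    have b3 : ∀ n, ∫⁻ x in K, ENNReal.ofReal (Φ n (x, 0) ^ 2) ≤ 2 * N + 2 * t n := by
      intro n
      have hm : AEMeasurable (fun x => 2 * ENNReal.ofReal (g x ^ 2)) (volume.restrict K) :=
        ((hg.aemeasurable.pow_const 2).ennreal_ofReal.const_mul _).mono_measure
          Measure.restrict_le_self
      have hNle : ∫⁻ x in K, 2 * ENNReal.ofReal (g x ^ 2) ≤ 2 * N := by
        rw [lintegral_const_mul' _ _ ENNReal.ofNat_ne_top]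
        gcongr
        exact setLIntegral_le_lintegral _ _
      refine le_trans ?_ (add_le_add_left hNle _)
      rw [← lintegral_const_mul' _ _ ENNReal.ofNat_ne_top, ← lintegral_add_left' hm]
      refine lintegral_mono fun x => ?_
      rw [two_mul_ofReal, two_mul_ofReal, ← ENNReal.ofReal_add (by positivity) (by positivity)]
      refine ENNReal.ofReal_le_ofReal ?_
      nlinarith [sq_nonneg (Φ n (x, 0) - 2 * g x)]
    refine le_of_forall_le_add_of_tendsto
      (e := fun n => 2 * (C * (2 * ENNReal.ofReal (max S 0) * e n + 2 * t n)) + 2 * e n) ?_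
      fun n => ?_
    · have h1 := tendsto_const_mul_zero (c := 2 * ENNReal.ofReal (max S 0)) (by finiteness) l1
      have h2 := tendsto_const_mul_zero (c := 2) (by finiteness) l2
      have h3 := tendsto_const_mul_zero (c := 2) (by finiteness) l1
      have h12 := h1.add h2
      rw [add_zero] at h12
      have h4 := tendsto_const_mul_zero (c := 2) (by finiteness)
        (tendsto_const_mul_zero (c := (C : ℝ≥0∞)) (by finiteness) h12)
      have h5 := h4.add h3
      rwa [add_zero] at h5
    · calc _ ≤ 2 * (C * ((2 * W + 2 * ENNReal.ofReal (max S 0) * e n) + (2 * N + 2 * t n)))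
            + 2 * e n := by
            refine (b1 n).trans ?_
            gcongr
            refine (hC μ hμ0 hμ (Φ n) ((hΦ n).of_le (by norm_cast)) K Y').trans ?_
            gcongr
            · exact b2 n
            · exact b3 n
        _ = _ := by ring
  have hopen : IsOpen (frontier Ω)ᶜ := isClosed_frontier.isOpen_compl
  -- Heights increasing to `Y` but strictly positive and strictly below it; the 2 in the denominator
  -- keeps the first one positive.
  set Yj : ℕ → ℝ := fun j => Y - Y / (j + 2) with hYj
  set s : ℕ → Set (E d × ℝ) := fun j => compactPart (frontier Ω)ᶜ j ×ˢ Ioo 0 (Yj j) with hs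
  have hYmono : Monotone Yj := fun i j hij => by
    simp only [hYj]
    gcongr
  have hmono : Monotone s := fun i j hij =>
    prod_mono (compactPart_mono _ hij) (Ioo_subset_Ioo_right (hYmono hij))
  have hUnion : cutCylinder Ω Y ⊆ ⋃ j, s j := by
    rintro ⟨x, y⟩ ⟨hx, hy⟩
    have hyY : y < Y := by exact_mod_cast hy.2
    have hx' : x ∈ ⋃ j, compactPart (frontier Ω)ᶜ j := by
      rw [iUnion_compactPart hopen]
      exact hx
    obtain ⟨i, hi⟩ := mem_iUnion.1 hx'
    obtain ⟨j, hj⟩ := exists_nat_gt (Y / (Y - y))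
    refine mem_iUnion.2 ⟨max i j, compactPart_mono _ (le_max_left i j) hi, hy.1,
      lt_of_lt_of_le ?_ (hYmono (le_max_right i j))⟩
    have h1 : Y / (j + 2) < Y - y := by
      rw [div_lt_iff₀ (by linarith)] at hj
      rw [div_lt_iff₀ (by positivity)]
      nlinarith
    simp only [hYj]
    linarith
  calc weightedL2 α μ Y U
      = ∫⁻ z in cutCylinder Ω Y, ENNReal.ofReal (z.2 ^ α * rho z ^ (μ - 2) * U z ^ 2) :=
        (setLIntegral_congr (cutCylinder_ae_eq hΩ Y)).symm
    _ ≤ ∫⁻ z in ⋃ j, s j, ENNReal.ofReal (z.2 ^ α * rho z ^ (μ - 2) * U z ^ 2) :=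
        lintegral_mono_set hUnion
    _ = ⨆ j, ∫⁻ z in s j, ENNReal.ofReal (z.2 ^ α * rho z ^ (μ - 2) * U z ^ 2) :=
        setLIntegral_iUnion_of_directed _ hmono.directed_le
    _ ≤ 4 * C * (W + N) := iSup_le fun j => by
        have h2 : Y / (j + 2) < Y := div_lt_self hY (by linarith [j.cast_nonneg (α := ℝ)])
        have h3 : 0 < Y / (j + 2) := by positivity
        refine hlocal _ (isCompact_compactPart _ _) (compactPart_subset _ _) _ ?_ ?_ <;>
        · simp only [hYj]
          linarith
    _ = _ := by push_cast; ring

end TraceHardy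

end

end FracPoincare

end

/-! ### Assembly of the cases. -/

theorem lemma3p2 (d : ℕ) (hd : d = 2 ∨ d = 3) (α : ℝ) (hα : -1 < α) (hα' : α < 1) :
    ∃ μ₀ : ℝ, 0 < μ₀ ∧
    ∀ Ω : Set (FracPoincare.E d), FracPoincare.IsBoundedLipschitzDomain Ω →
    ∃ C : ℝ≥0,
      -- the half space, `𝒴 = ∞`
      (IsConnected (closure Ω)ᶜ →
        ∀ μ : ℝ, 0 ≤ μ → μ ≤ 2 →
        ∀ (U : FracPoincare.E d × ℝ → ℝ)
          (G : FracPoincare.E d × ℝ → FracPoincare.E d × ℝ →L[ℝ] ℝ),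
        FracPoincare.MemH1rho α (FracPoincare.cutCylinder Ω ⊤) U G →
        (∀ᵐ y : ℝ, y ∈ FracPoincare.yInterval ⊤ →
          FracPoincare.JumpMeanZero Ω (fun x => U (x, y))) →
        FracPoincare.weightedL2 α μ ⊤ U ≤ C * FracPoincare.weightedEnergy α μ Ω ⊤ G) ∧
      -- the truncated cylinder, `0 < 𝒴 < ∞`
      (∀ Y : ℝ, 0 < Y →
        ∀ μ : ℝ, 0 ≤ μ → μ < μ₀ →
        ∀ (U : FracPoincare.E d × ℝ → ℝ)
          (G : FracPoincare.E d × ℝ → FracPoincare.E d × ℝ →L[ℝ] ℝ),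
        FracPoincare.MemH1rho α (FracPoincare.cutCylinder Ω Y) U G →
        (∀ᵐ y : ℝ, y ∈ FracPoincare.yInterval Y →
          FracPoincare.JumpMeanZero Ω (fun x => U (x, y))) →
        (d = 3 → IsConnected (closure Ω)ᶜ →
          FracPoincare.weightedL2 α μ Y U ≤ C * FracPoincare.weightedEnergy α μ Ω Y G) ∧
        (d = 2 → ∀ g : FracPoincare.E d → ℝ, FracPoincare.HasTraceZero α Ω Y U G g →
          FracPoincare.weightedL2 α μ Y U ≤
            C * (FracPoincare.weightedEnergy α μ Ω Y G +
              ∫⁻ x, ENNReal.ofReal (g x ^ 2)))) := by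
  obtain ⟨Ct, hCt⟩ := FracPoincare.exists_weightedL2_le_of_trace d hα hα'
  -- The threshold of the trace inequality in the vertical direction. The multiplier argument allows
  -- all μ up to 2, and (1 - α)/2 is less than 1.
  refine ⟨(1 - α) / 2, by linarith, fun Ω hΩ => ?_⟩
  have hd0 : 0 < d := by omega
  obtain ⟨Cp, hCp₁, hCp₂⟩ : ∃ C : ℝ≥0,
      (IsConnected (closure Ω)ᶜ → ∀ μ : ℝ, 0 ≤ μ → μ ≤ 2 →
        ∀ (U : FracPoincare.E d × ℝ → ℝ)
          (G : FracPoincare.E d × ℝ → FracPoincare.E d × ℝ →L[ℝ] ℝ),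
        FracPoincare.MemH1rho α (FracPoincare.cutCylinder Ω ⊤) U G →
        (∀ᵐ y : ℝ, y ∈ FracPoincare.yInterval ⊤ →
          FracPoincare.JumpMeanZero Ω (fun x => U (x, y))) →
        FracPoincare.weightedL2 α μ ⊤ U ≤ C * FracPoincare.weightedEnergy α μ Ω ⊤ G) ∧
      (IsConnected (closure Ω)ᶜ → d = 3 → ∀ (Y : EReal) (μ : ℝ), 0 ≤ μ → μ ≤ 2 →
        ∀ (U : FracPoincare.E d × ℝ → ℝ)
          (G : FracPoincare.E d × ℝ → FracPoincare.E d × ℝ →L[ℝ] ℝ),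
        FracPoincare.MemH1rho α (FracPoincare.cutCylinder Ω Y) U G →
        (∀ᵐ y : ℝ, y ∈ FracPoincare.yInterval Y →
          FracPoincare.JumpMeanZero Ω (fun x => U (x, y))) →
        FracPoincare.weightedL2 α μ Y U ≤ C * FracPoincare.weightedEnergy α μ Ω Y G) := by
    -- The constant may depend on `Ω`, so connectedness of the exterior is decided before choosing
    -- it; otherwise both claims are vacuous and 0 serves.
    by_cases hext : IsConnected (closure Ω)ᶜ
    swap
    · exact ⟨0, fun h => absurd h hext, fun h => absurd h hext⟩
    -- For d = 2 the vertical field is needed, θ = 1 and c = 1 + α, which confines the argument to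
    -- the half space. For d = 3 the horizontal field suffices, θ = 0 and c = 1, for every height.
    rcases hd with rfl | rfl
    · obtain ⟨C, hC⟩ := FracPoincare.exists_weightedL2_le hd0 hΩ hext
        (show 0 < 1 + α by linarith)
      exact ⟨C, fun _ μ h0 h2 => hC α 1 μ ⊤ h0 h2 (Or.inr ⟨rfl, rfl⟩) (by push_cast; ring),
        fun _ h => absurd h (by norm_num)⟩
    · obtain ⟨C, hC⟩ := FracPoincare.exists_weightedL2_le hd0 hΩ hext one_pos
      exact ⟨C, fun _ μ h0 h2 => hC α 0 μ ⊤ h0 h2 (Or.inl rfl) (by norm_num),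
        fun _ _ Y μ h0 h2 => hC α 0 μ Y h0 h2 (Or.inl rfl) (by norm_num)⟩
  refine ⟨Cp + Ct, fun hext μ h0 h2 U G hU hj => ?_,
    fun Y hY μ h0 hμ U G hU hj => ⟨fun h3 hext => ?_, fun _ g hg => ?_⟩⟩
  · refine (hCp₁ hext μ h0 h2 U G hU hj).trans ?_
    gcongr
    exact le_self_add
  · refine (hCp₂ hext h3 Y μ h0 (by linarith) U G hU hj).trans ?_
    gcongr
    exact le_self_add
  · refine (hCt Ω hΩ Y hY μ h0 hμ.le U G g hU.1 hg).trans ?_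
    gcongr
    exact le_add_self
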